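/- Let $M$ be a closed $3$-manifold, $r\ge 2$ an integer, and $f:M\to M$ a $C^r$ diffeomorphism with two periodic saddles $P,Q$ of periods $\pi(P),\pi(Q)$ satisfying the following conditions. **(A)** There are $C^r$ charts at $P$ and $Q$ (both saddles at the origin) with coordinate neighbourhoods $U_P,U_Q\cong(-10,10)^3$ in which $f^{\pi(P)}$ and $f^{\pi(Q)}$ are the linear maps $$(x,y,z)\mapsto\big(\lambda_P x,\ \sigma_P(\cos(2\pi\varphi_P)\,y-\sin(2\pi\varphi_P)\,z),\ \sigma_P(\sin(2\pi\varphi_P)\,y+\cos(2\pi\varphi_P)\,z)\big),$$ $$(x,y,z)\mapsto\big(\lambda_Q(\cos(2\pi\varphi_Q)\,x-\sin(2\pi\varphi_Q)\,z),\ \sigma_Q\,y,\ \lambda_Q(\sin(2\pi\varphi_Q)\,x+\cos(2\pi\varphi_Q)\,z)\big),$$ with $0<|\lambda_P|,|\lambda_Q|<1<|\sigma_P|,|\sigma_Q|$, $\varphi_P\ne\varphi_Q$ in $[0,1]$, and the rotations having non-real eigenvalues. The spectral condition $$0<\Big|\,\big||\lambda_P|^{1/2}\sigma_P\big|^{\eta}\sigma_Q\Big|<1,\qquad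 \eta=\frac{\log|\lambda_Q^{-1}|}{\log|\sigma_P|},$$ holds, and the number $\log|\lambda_Q|/\log|\sigma_P|$ is irrational. **(B)** For the point $X=(0,1,0)\in U_Q$ there is $N_1\ge 1$ such that $f^{N_1}(X)=\widetilde X=(1,0,0)\in U_P$ and, near $X$, $$f^{N_1}(x,1+y,z)=\big(1+\alpha_1x+\alpha_2y+\alpha_3z+\widetilde H_1,\ \beta_2y+\widetilde H_2,\ \gamma_3z+\widetilde H_3\big),$$ where $\widetilde H=(\widetilde H_1,\widetilde H_2,\widetilde H_3)$ is a $C^r$ function of $(x,y,z)$ that vanishes at $0$ together with its first derivatives (so $X$ is a quasi-transverse heteroclinic point of $W^{\mathrm s}(P)$ and $W^{\mathrm u}(Q)$). **(C)** For the point $Y=(0,1,1)\in U_P$ there is $N_2\ge 1$ such that $f^{N_2}(Y)=\widetilde Y=(1,0,1)\in U_Q$ and, near $Y$, $$f^{N_2}(x,1+y,1+z)=\big(1+a_1x+a_2y+a_3z+H_1,\ b_1x+b_2y^2+b_3z^2+b_4yz+H_2,\ 1+c_1x+c_2y+c_3z+H_3\big),$$ where $c_2=c_3$, $H=(H_1,H_2,H_3)$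 is a $C^r$ function that vanishes at $0$ together with its first derivatives, and $\partial_{yy}H_2(0)=\partial_{zz}H_2(0)=\partial_{yz}H_2(0)=0$ (so $Y$ is a heterodimensional tangency of $W^{\mathrm u}(P)$ and $W^{\mathrm s}(Q)$). Moreover $\gamma_3(a_3-a_2)>0$. For $\xi>0$ and $\mu\in\mathbb R$ let $$E_{\xi,\mu,\bar\varsigma}(x,y,z)=(\xi x+\varsigma_1y,\ \mu+\varsigma_2y^2+\varsigma_3x^2+\varsigma_4xy,\ \varsigma_5y),$$ where $\bar\varsigma=\bar\varsigma(f,\xi)$ is given by $$\varsigma_1=\tfrac{\beta_2(a_2+a_3)}{\sqrt2},\quad \varsigma_2=\tfrac{\beta_2^2(b_2+b_3+b_4)}{2},\quad \varsigma_3=\xi^2\,\tfrac{b_2+b_3-b_4}{(a_3-a_2)^2},\quad \varsigma_4=\sqrt2\,\xi\,\tfrac{\beta_2(b_3-b_2)}{a_3-a_2},\quad \varsigma_5=\tfrac{\beta_2(c_2+c_3)}{\sqrt2}.$$ Then $\bar\varsigma$ is a smooth function of $\xi$ and of the transition coefficients (where $a_2\neq a_3$), and there is an unfolding family $\{f_{\bar\upsilon}\}_{\bar\upsilon\in\mathbb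 R^8}$ of $C^r$ diffeomorphisms of $M$, jointly $C^r$ in the parameter and the point, with $f_{\bar 0}=f$. For $\bar\upsilon=(\bar\mu,\bar\nu,\alpha,\beta)\in\mathbb R^3\times\mathbb R^3\times\mathbb R\times\mathbb R$ near $0$ it is of the form $f_{\bar\upsilon}=\Gamma_{\bar\upsilon}\circ f$. Here, for some $\rho\in(0,1)$ and some $C^r$ function $b:\mathbb R\to\mathbb R$ equal to $1$ on $|t|\le\rho/2$, to $0$ on $|t|\ge\rho$ and with values in $(0,1)$ in between, the map $\Gamma_{\bar\upsilon}$ is, in the charts: * near $P$: $W\mapsto I^x_{\alpha\,b(\|W\|)}W$, where $I^x_\omega$ is the rotation of angle $2\pi\omega$ about the $x$-axis; * near $Q$: $W\mapsto I^y_{\beta\,b(\|W\|)}W$, where $I^y_\omega(x,y,z)=(\cos(2\pi\omega)x-\sin(2\pi\omega)z,\ y,\ \sin(2\pi\omega)x+\cos(2\pi\omega)z)$; * near $\widetilde X$: $\widetilde X+(x,y,z)\mapsto\widetilde X+(x,y,z)+b(x)b(y)b(z)\,\bar\nu$; * near $\widetilde Y$: $\widetilde Y+(x,y,z)\mapsto\widetilde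 Y+(x,y,z)+b(x)b(y)b(z)\,\bar\mu$; the neighbourhoods (of size $\rho$) being pairwise disjoint, and $\Gamma_{\bar\upsilon}$ the identity elsewhere. The family has the following property. For every $\xi>0$ there are sequences of natural numbers $m_k,n_k\to\infty$, $C^r$ parameterisations $\Psi_k:\mathbb R^3\to M$ ($C^r$ diffeomorphisms onto open subsets of $M$), and $C^\infty$ maps $\bar\upsilon_k:\mathbb R\times[-\pi,\pi]^2\to\mathbb R^8$ such that: * for all compact sets $\Delta\subset\mathbb R^3$ and $L\subset\mathbb R\times[-\pi,\pi]^2$, $\Psi_k(\Delta)\to\{\widetilde Y\}$ and $\bar\upsilon_k(L)\to\{0\}$ as $k\to\infty$, where $\widetilde Y=f^{N_2}(Y)$ is the point of the orbit of the heterodimensional tangency in $U_Q$; * for every $\mu\in\mathbb R$, with $\bar\upsilon_k=\bar\upsilon_k(\mu,\varphi_P,\varphi_Q)$, the maps $$\Psi_k^{-1}\circ f_{\bar\upsilon_k}^{\,N_2+m_k+N_1+n_k}\circ\Psi_k$$ are, for every compact set $K\subset\mathbb R^3$, defined on $K$ for all large $k$, and they converge to $E_{\xi,\mu,\bar\varsigma}$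 in the $C^r$ topology on compact subsets of $\mathbb R^3$. -/

import Mathlib

open Set Filter Topology
open scoped Manifold ContDiff

noncomputable section

namespace HetCycle

/-- Euclidean three-space. -/
abbrev E3 := EuclideanSpace ℝ (Fin 3)

/-- The eight-dimensional parameter space. -/
abbrev E8 := EuclideanSpace ℝ (Fin 8)

/-- The open cube `(-10,10)³`. -/
def cube : Set E3 := {w | ∀ i, w i ∈ Ioo (-10 : ℝ) 10}

/-- The local normal form at `P`: the eigenvalue `lam` along the first axis and the rotation of
angle `2πφ` scaled by `sig` on the plane of the last two coordinates. -/
def linP (lam sig φ : ℝ) (w : E3) : E3 :=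
  !₂[lam * w 0,
    sig * (Real.cos (2 * Real.pi * φ) * w 1 - Real.sin (2 * Real.pi * φ) * w 2),
    sig * (Real.sin (2 * Real.pi * φ) * w 1 + Real.cos (2 * Real.pi * φ) * w 2)]

/-- The local normal form at `Q`: the eigenvalue `sig` along the second axis and the rotation of
angle `2πφ` scaled by `lam` on the plane of the first and third coordinates. -/
def linQ (lam sig φ : ℝ) (w : E3) : E3 :=
  !₂[lam * (Real.cos (2 * Real.pi * φ) * w 0 - Real.sin (2 * Real.pi * φ) * w 2),
    sig * w 1,
    lam * (Real.sin (2 * Real.pi * φ) * w 0 + Real.cos (2 * Real.pi * φ) * w 2)]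

/-- The rotation `I^x_t` of angle `2πt` about the first axis. -/
def rotX (t : ℝ) (w : E3) : E3 := linP 1 1 t w

/-- The rotation `I^y_t` of angle `2πt` about the second axis. -/
def rotY (t : ℝ) (w : E3) : E3 := linQ 1 1 t w

/-- The heteroclinic points in coordinates: `X` and `Ytil` are read in the chart at `Q`,
`Xtil` and `Y` in the chart at `P`. -/
def ptX : E3 := !₂[0, 1, 0]
def ptXtil : E3 := !₂[1, 0, 0]
def ptY : E3 := !₂[0, 1, 1]
def ptYtil : E3 := !₂[1, 0, 1]

section Cycle

variable {M : Type*} [TopologicalSpace M] [ChartedSpace E3 M]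

/-- A cycle of the `C^r` diffeomorphism `f`, associated with a pair of saddle-foci `P` (of index
two) and `Q` (of index one), satisfying conditions (A), (B) and (C), with the data that express
these conditions in coordinates. -/
structure SaddleFocusCycle (r : ℕ) (f : M ≃ₘ^r⟮𝓡 3, 𝓡 3⟯ M) where
  /-- The saddles and their periods. -/
  P : M
  Q : M
  perP : ℕ
  perQ : ℕ
  perP_pos : 0 < perP
  perQ_pos : 0 < perQ
  minimalPeriod_P : Function.minimalPeriod f P = perP
  minimalPeriod_Q : Function.minimalPeriod f Q = perQ
  /-- (A) `C^r` charts at the saddles whose images contain the cube `(-10,10)³`. -/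
  chP : OpenPartialHomeomorph M E3
  chQ : OpenPartialHomeomorph M E3
  chP_mem : chP ∈ IsManifold.maximalAtlas (𝓡 3) r M
  chQ_mem : chQ ∈ IsManifold.maximalAtlas (𝓡 3) r M
  P_mem : P ∈ chP.source
  Q_mem : Q ∈ chQ.source
  chP_P : chP P = 0
  chQ_Q : chQ Q = 0
  cube_P : cube ⊆ chP.target
  cube_Q : cube ⊆ chQ.target
  /-- (A) The moduli and the arguments of the eigenvalues. -/
  lamP : ℝ
  sigP : ℝ
  phiP : ℝ
  lamQ : ℝ
  sigQ : ℝ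
  phiQ : ℝ
  lamP_ne : 0 < |lamP|
  lamP_lt : |lamP| < 1
  sigP_gt : 1 < |sigP|
  lamQ_ne : 0 < |lamQ|
  lamQ_lt : |lamQ| < 1
  sigQ_gt : 1 < |sigQ|
  phiP_mem : phiP ∈ Icc (0 : ℝ) 1
  phiQ_mem : phiQ ∈ Icc (0 : ℝ) 1
  phi_ne : phiP ≠ phiQ
  nonreal_P : Real.sin (2 * Real.pi * phiP) ≠ 0
  nonreal_Q : Real.sin (2 * Real.pi * phiQ) ≠ 0
  /-- (A) The return maps to the saddles are linear in the charts. -/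
  linear_P : ∀ w ∈ cube, linP lamP sigP phiP w ∈ cube →
    f^[perP] (chP.symm w) = chP.symm (linP lamP sigP phiP w)
  linear_Q : ∀ w ∈ cube, linQ lamQ sigQ phiQ w ∈ cube →
    f^[perQ] (chQ.symm w) = chQ.symm (linQ lamQ sigQ phiQ w)
  /-- (A) The spectral condition of the cycle. -/
  spectral : |(|(|lamP| ^ (1 / 2 : ℝ) * sigP)|) ^ (Real.log |lamQ⁻¹| / Real.log |sigP|) * sigQ| < 1
  /-- (B) The transition from `Q` to `P` along the orbit of the heteroclinic point `X`. The form
  of the transition makes `X` a quasi-transverse intersection of `W^u(Q)` and `W^s(P)`. -/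
  N₁ : ℕ
  N₁_pos : 0 < N₁
  α : Fin 3 → ℝ
  β : Fin 3 → ℝ
  γ : Fin 3 → ℝ
  β_one : β 0 = 0
  β_three : β 2 = 0
  γ_one : γ 0 = 0
  γ_two : γ 1 = 0
  Htil : E3 → E3
  Htil_contDiff : ContDiffAt ℝ r Htil 0
  Htil_zero : Htil 0 = 0
  Htil_fderiv : fderiv ℝ Htil 0 = 0
  transition_QP : ∀ᶠ w in 𝓝 (0 : E3),
    f^[N₁] (chQ.symm (ptX + w)) = chP.symm
      !₂[1 + α 0 * w 0 + α 1 * w 1 + α 2 * w 2 + Htil w 0,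
        β 0 * w 0 + β 1 * w 1 + β 2 * w 2 + Htil w 1,
        γ 0 * w 0 + γ 1 * w 1 + γ 2 * w 2 + Htil w 2]
  /-- (C) The transition from `P` to `Q` along the orbit of the heteroclinic point `Y`. The form
  of the transition makes `Y` a tangency of `W^u(P)` and `W^s(Q)`. -/
  N₂ : ℕ
  N₂_pos : 0 < N₂
  a : Fin 3 → ℝ
  b : Fin 4 → ℝ
  c : Fin 3 → ℝ
  c_two_three : c 1 = c 2
  H : E3 → E3
  H_contDiff : ContDiffAt ℝ r H 0
  H_zero : H 0 = 0
  H_fderiv : fderiv ℝ H 0 = 0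
  H_yy : iteratedFDeriv ℝ 2 (fun w => H w 1) 0 ![!₂[0, 1, 0], !₂[0, 1, 0]] = 0
  H_zz : iteratedFDeriv ℝ 2 (fun w => H w 1) 0 ![!₂[0, 0, 1], !₂[0, 0, 1]] = 0
  H_yz : iteratedFDeriv ℝ 2 (fun w => H w 1) 0 ![!₂[0, 1, 0], !₂[0, 0, 1]] = 0
  transition_PQ : ∀ᶠ w in 𝓝 (0 : E3),
    f^[N₂] (chP.symm (ptY + w)) = chQ.symm
      !₂[1 + a 0 * w 0 + a 1 * w 1 + a 2 * w 2 + H w 0,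
        b 0 * w 0 + b 1 * w 1 ^ 2 + b 2 * w 2 ^ 2 + b 3 * (w 1 * w 2) + H w 1,
        1 + c 0 * w 0 + c 1 * w 1 + c 2 * w 2 + H w 2]
  /-- The sign condition `γ₃ (a₃ - a₂) > 0`. -/
  sign : 0 < γ 2 * (a 2 - a 1)

variable {r : ℕ} {f : M ≃ₘ^r⟮𝓡 3, 𝓡 3⟯ M}

/-- The point of the orbit of the heterodimensional tangency at which returns are studied:
`f^[N₂] Y`, that is `(1,0,1)` in the chart at `Q`. -/
def SaddleFocusCycle.tangencyPoint (C : SaddleFocusCycle r f) : M := C.chQ.symm ptYtil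

/-- `b` is a `C^r` bump function on the line adapted to the radius `ρ`. -/
structure IsBump (r : ℕ) (ρ : ℝ) (b : ℝ → ℝ) : Prop where
  contDiff : ContDiff ℝ r b
  eq_zero : ∀ x, ρ ≤ |x| → b x = 0
  mem_Ioo : ∀ x, ρ / 2 < |x| → |x| < ρ → b x ∈ Ioo (0 : ℝ) 1
  eq_one : ∀ x, |x| ≤ ρ / 2 → b x = 1

/-- The translation-like perturbation of the identity of `ℝ³` near `z₀`, in the direction `v`. -/
def translationLike (b : ℝ → ℝ) (z₀ v : E3) (w : E3) : E3 :=
  w + (b ((w - z₀) 0) * b ((w - z₀) 1) * b ((w - z₀) 2)) • v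

/-- The closed cube of centre `z₀` and half-side `ρ`. -/
def box (z₀ : E3) (ρ : ℝ) : Set E3 := {w | ∀ i, |(w - z₀) i| ≤ ρ}

/-- The neighbourhoods of `P`, `Q`, `Xtil`, `Ytil` that carry the perturbation. -/
def SaddleFocusCycle.V (C : SaddleFocusCycle r f) (ρ : ℝ) : Fin 4 → Set M :=
  ![C.chP.symm '' Metric.closedBall 0 ρ, C.chQ.symm '' Metric.closedBall 0 ρ,
    C.chP.symm '' box ptXtil ρ, C.chQ.symm '' box ptYtil ρ]

open Classical in
/-- The perturbation of the identity of `M` with parameter `υ = (μ, ν, α, β)`,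
`μ, ν ∈ ℝ³`, `α, β ∈ ℝ`: a rotation-like perturbation of parameter `α` at `P` and of parameter `β`
at `Q`, a translation-like perturbation of parameter `ν` at `Xtil` and of parameter `μ` at `Ytil`,
and the identity elsewhere. -/
def SaddleFocusCycle.Γ (C : SaddleFocusCycle r f) (ρ : ℝ) (b : ℝ → ℝ) (υ : E8) (p : M) : M :=
  if p ∈ C.V ρ 0 then C.chP.symm (rotX (υ 6 * b ‖C.chP p‖) (C.chP p))
  else if p ∈ C.V ρ 1 then C.chQ.symm (rotY (υ 7 * b ‖C.chQ p‖) (C.chQ p))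
  else if p ∈ C.V ρ 2 then
    C.chP.symm (translationLike b ptXtil !₂[υ 3, υ 4, υ 5] (C.chP p))
  else if p ∈ C.V ρ 3 then
    C.chQ.symm (translationLike b ptYtil !₂[υ 0, υ 1, υ 2] (C.chQ p))
  else p

/-- `F` is an eight-parameter unfolding family of the cycle: a family of `C^r` diffeomorphisms,
jointly `C^r` in the parameter and the point, with `F 0 = f`, and of the form `Γ_υ ∘ f` for all
parameters near zero. -/
structure IsUnfoldingFamily (C : SaddleFocusCycle r f) (F : E8 → M ≃ₘ^r⟮𝓡 3, 𝓡 3⟯ M) : Prop where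
  zero : F 0 = f
  contMDiff : ContMDiff (𝓘(ℝ, E8).prod (𝓡 3)) (𝓡 3) r (fun q : E8 × M => F q.1 q.2)
  local_form : ∃ ρ ∈ Ioo (0 : ℝ) 1, ∃ b : ℝ → ℝ, IsBump r ρ b ∧
    Pairwise (fun i j => Disjoint (C.V ρ i) (C.V ρ j)) ∧
    ∃ ε > 0, ∀ υ : E8, (∀ i, υ i ∈ Icc (-ε) ε) → ∀ p, F υ p = C.Γ ρ b υ (f p)

end Cycle

/-- The endomorphism `E_{ξ,μ,ς}` of `ℝ³`. -/
def endoE (ξ μ : ℝ) (s : Fin 5 → ℝ) (w : E3) : E3 :=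
  !₂[ξ * w 0 + s 0 * w 1,
    μ + s 1 * w 1 ^ 2 + s 2 * w 0 ^ 2 + s 3 * (w 0 * w 1),
    s 4 * w 1]

/-- The vector `ς`, as a function of the transition coefficients and of `ξ`. -/
def varsigma (β₂ : ℝ) (a : Fin 3 → ℝ) (b : Fin 4 → ℝ) (c : Fin 3 → ℝ) (ξ : ℝ) : Fin 5 → ℝ :=
  ![β₂ * (a 1 + a 2) / √2,
    β₂ ^ 2 * (b 1 + b 2 + b 3) / 2,
    ξ ^ 2 * ((b 1 + b 2 - b 3) / (a 2 - a 1) ^ 2),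
    ξ * √2 * (β₂ * (b 2 - b 1) / (a 2 - a 1)),
    β₂ * (c 1 + c 2) / √2]

/-- Convergence in the `C^r` topology on compact subsets of `ℝ³`. The maps `g k` need only be of
class `C^r` near a given compact set for `k` large. -/
def TendstoCr (r : ℕ) (g : ℕ → E3 → E3) (G : E3 → E3) : Prop :=
  ∀ K : Set E3, IsCompact K →
    (∀ᶠ k in atTop, ∀ w ∈ K, ContDiffAt ℝ r (g k) w) ∧
    ∀ i ≤ r, TendstoUniformlyOn (fun k => iteratedFDeriv ℝ i (g k)) (iteratedFDeriv ℝ i G) atTop K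

/-- The domain `ℝ × [-π,π]²` of the parameter maps. -/
def paramDomain : Set (ℝ × ℝ × ℝ) :=
  univ ×ˢ Icc (-Real.pi) Real.pi ×ˢ Icc (-Real.pi) Real.pi

end HetCycle

end

open HetCycle

/-!
The return map near the cycle is computed explicitly. An orbit that starts near the tangency point
`Ytil` makes `2 * n` returns near `Q`, goes over to `P` along the heteroclinic orbit of `X`, makes
`2 * m` returns near `P` and comes back along the orbit of `Y`. During a passage every return is
the linear normal form followed by a rotation whose angle depends on the norm only. Rotations
preserve norms and commute with the normal forms, so the whole passage is a power of the linear map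
followed by one rotation, of an angle which is the rate `α` or `β` times an accumulated weight
(`iterate_passage`, `rotSum`). The two transitions are given by the hypotheses, up to a translation
by the parameters.

For this description the orbit has to meet the supports of the perturbations at the intended times
only. The distinguished orbits are disjoint where they have to be: `P` and `Q` lie on different
orbits, since a return map at `P` has a contracted real eigenvector and one at `Q` has none
(`iterate_P_ne_Q`), and `Xtil` and `Ytil` are not periodic. Supports of a small size `ρ` therefore
do not interfere (`eventually_passage`, `eventually_transition_QP`, `eventually_transition_PQ`).
The family itself exists for all parameters, because the translation vectors can be cut off away
from zero (`exists_unfoldingFamily`).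

The coordinates near `Ytil` are rescaled by `δ = (σ_P ^ (2m) * σ_Q ^ (2n))⁻¹` in the directions `x`
and `z` and by `δ ^ 2` in the direction `y`. In them the return map splits into four stages, each
of which converges with its derivatives up to order `r`, locally uniformly (`JetTendsto`).

* Within each passage all but boundedly many returns happen where the rotation is rigid, so the
  accumulated weight tends to infinity, while its dependence on the point converges
  (`exists_jetTendsto_rotSum`). Hence there are rates `α`, `β` tending to zero for which the
  reference orbits turn by exactly an eighth near `P` and a quarter near `Q` (`exists_rate`), and
  the dependence of the angle on the point disappears in the limit (`JetTendsto.rotSum_blowup`).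
* The transition from `Q` to `P` is magnified to its derivative at `X` (`JetTendsto.blowup`). The
  remainder of the transition from `P` to `Q` vanishes in the limit, in the first and third
  components to first order and in the second to second order (`JetTendsto.blowup_sq`). There, the
  first order contribution `b₁ x` is killed by the contraction at `P`, and the quadratic terms
  survive.
* The numbers of returns are such that `σ_P ^ (2m) * λ_Q ^ (2n)` tends to a prescribed positive
  limit. They exist because `log |λ_Q| / log |σ_P|` is irrational, and for them the spectral
  condition says that `λ_P ^ (2m) / δ ^ 2` tends to zero (`exists_resonant_times`). The choice
  `√2 ξ / (γ₃ (a₃ - a₂))` of the limit, which is positive by the sign condition, gives the map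
  `E_{ξ,μ,ς}` (`SaddleFocusCycle.Resonant.jet_renorm`).

Finally, the parametrisation of a neighbourhood has to be defined on all of `ℝ³`, whereas the chart
at `Q` is bounded. The rescaled coordinates are therefore composed with a diffeomorphism of `ℝ³`
onto an ellipsoid which is close to the identity on compact sets (`shrink`,
`exists_parametrization`), and this does not change the limit.
-/

noncomputable section

namespace HetCycle

/-! ### Convergence of jets along a sequence of maps -/

section Jets

variable {ι E F G : Type*} [NormedAddCommGroup E] [NormedSpace ℝ E]
  [NormedAddCommGroup F] [NormedSpace ℝ F] [NormedAddCommGroup G] [NormedSpace ℝ G]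
  {r : ℕ} {l : Filter ι} {x : E}

/-- Locally uniform `C^r` convergence at the point `x` of the maps `g k` to `g₀` along the filter
`l`: the derivatives of order at most `r` of `g k` at `y` tend to those of `g₀` at `x` as `k`
follows `l` and `y` tends to `x`, jointly. -/
structure JetTendsto (r : ℕ) (l : Filter ι) (g : ι → E → F) (g₀ : E → F) (x : E) : Prop where
  eventually_contDiffAt : ∀ᶠ p in l ×ˢ 𝓝 x, ContDiffAt ℝ r (g p.1) p.2
  contDiffAt : ContDiffAt ℝ r g₀ x
  tendsto_iteratedFDeriv : ∀ i ≤ r, Tendsto (fun p : ι × E => iteratedFDeriv ℝ i (g p.1) p.2)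
    (l ×ˢ 𝓝 x) (𝓝 (iteratedFDeriv ℝ i g₀ x))

theorem natCast_ne_infty (n : ℕ) : (n : WithTop ℕ∞) ≠ ∞ := by simp

theorem eventually_prod_eventually_nhds {E : Type*} [TopologicalSpace E] {x : E}
    {P : ι × E → Prop} (h : ∀ᶠ p in l ×ˢ 𝓝 x, P p) :
    ∀ᶠ p in l ×ˢ 𝓝 x, ∀ᶠ y in 𝓝 p.2, P (p.1, y) := by
  obtain ⟨pa, ha, pb, hb, hab⟩ := eventually_prod_iff.1 h
  refine eventually_prod_iff.2 ⟨pa, ha, _, eventually_eventually_nhds.2 hb, fun hx y hy => ?_⟩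
  exact hy.mono fun z hz => hab hx hz

namespace JetTendsto

theorem tendsto {g : ι → E → F} {g₀ : E → F} (h : JetTendsto r l g g₀ x) :
    Tendsto (fun p : ι × E => g p.1 p.2) (l ×ˢ 𝓝 x) (𝓝 (g₀ x)) := by
  have := h.tendsto_iteratedFDeriv 0 (Nat.zero_le _)
  have h2 := (continuousMultilinearCurryFin0 ℝ E F).continuous.tendsto _ |>.comp this
  simpa [Function.comp_def, iteratedFDeriv_zero_eq_comp] using h2

theorem congr {g g' : ι → E → F} {g₀ : E → F} (h : JetTendsto r l g g₀ x)
    (hev : ∀ᶠ p in l ×ˢ 𝓝 x, g' p.1 p.2 = g p.1 p.2) : JetTendsto r l g' g₀ x := by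
  have hev' : ∀ᶠ p in l ×ˢ 𝓝 x, g' p.1 =ᶠ[𝓝 p.2] g p.1 := eventually_prod_eventually_nhds hev
  refine ⟨?_, h.contDiffAt, fun i hi => ?_⟩
  · filter_upwards [hev', h.eventually_contDiffAt] with p hp hq using hq.congr_of_eventuallyEq hp
  · refine (h.tendsto_iteratedFDeriv i hi).congr' ?_
    filter_upwards [hev'] with p hp using (hp.iteratedFDeriv ℝ i).eq_of_nhds.symm

theorem congr_limit {g : ι → E → F} {g₀ g₁ : E → F} (h : JetTendsto r l g g₀ x)
    (hev : g₁ =ᶠ[𝓝 x] g₀) : JetTendsto r l g g₁ x := by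
  refine ⟨h.eventually_contDiffAt, h.contDiffAt.congr_of_eventuallyEq hev, fun i hi => ?_⟩
  rw [(hev.iteratedFDeriv ℝ i).eq_of_nhds]
  exact h.tendsto_iteratedFDeriv i hi

theorem comp_tendsto {ι' : Type*} {l' : Filter ι'} {g : ι → E → F} {g₀ : E → F}
    (h : JetTendsto r l g g₀ x) {φ : ι' → ι} (hφ : Tendsto φ l' l) :
    JetTendsto r l' (fun k => g (φ k)) g₀ x := by
  have hp : Tendsto (fun p : ι' × E => (φ p.1, p.2)) (l' ×ˢ 𝓝 x) (l ×ˢ 𝓝 x) :=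
    (hφ.comp tendsto_fst).prodMk tendsto_snd
  exact ⟨hp.eventually h.eventually_contDiffAt, h.contDiffAt,
    fun i hi => (h.tendsto_iteratedFDeriv i hi).comp hp⟩

theorem of_contDiffAt {g : E → F} (h : ContDiffAt ℝ r g x) :
    JetTendsto r l (fun _ => g) g x := by
  refine ⟨?_, h, fun i hi => ?_⟩
  · exact tendsto_snd.eventually (h.eventually (by simp))
  · exact (h.continuousAt_iteratedFDeriv (by exact_mod_cast hi)).tendsto.comp tendsto_snd

theorem const {c : ι → F} {c₀ : F} (h : Tendsto c l (𝓝 c₀)) :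
    JetTendsto r l (fun k _ => c k) (fun _ : E => c₀) x := by
  refine ⟨Eventually.of_forall fun _ => contDiffAt_const, contDiffAt_const, fun i _ => ?_⟩
  rcases Nat.eq_zero_or_pos i with rfl | hi
  · simp only [iteratedFDeriv_zero_eq_comp, Function.comp_def]
    exact ((continuousMultilinearCurryFin0 ℝ E F).symm.continuous.tendsto _).comp
      (h.comp tendsto_fst)
  · simp only [iteratedFDeriv_const_of_ne hi.ne']
    exact tendsto_const_nhds

theorem comp {h : ι → F → G} {h₀ : F → G} {g : ι → E → F} {g₀ : E → F}
    (hh : JetTendsto r l h h₀ (g₀ x)) (hg : JetTendsto r l g g₀ x) :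
    JetTendsto r l (fun k y => h k (g k y)) (fun y => h₀ (g₀ y)) x := by
  have hp : Tendsto (fun p : ι × E => (p.1, g p.1 p.2)) (l ×ˢ 𝓝 x) (l ×ˢ 𝓝 (g₀ x)) :=
    tendsto_fst.prodMk hg.tendsto
  refine ⟨?_, hh.contDiffAt.comp x hg.contDiffAt, fun i hi => ?_⟩
  · filter_upwards [hp.eventually hh.eventually_contDiffAt, hg.eventually_contDiffAt] with p h1 h2
    exact h1.comp p.2 h2
  · have hir : (i : WithTop ℕ∞) ≤ r := by exact_mod_cast hi
    have key : iteratedFDeriv ℝ i (fun y => h₀ (g₀ y)) x = _ :=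
      iteratedFDeriv_comp hh.contDiffAt hg.contDiffAt hir
    rw [key]
    have hev : ∀ᶠ p in l ×ˢ 𝓝 x, iteratedFDeriv ℝ i (fun y => h p.1 (g p.1 y)) p.2 =
        (ftaylorSeries ℝ (h p.1) (g p.1 p.2)).taylorComp (ftaylorSeries ℝ (g p.1) p.2) i := by
      filter_upwards [hp.eventually hh.eventually_contDiffAt, hg.eventually_contDiffAt] with p h1 h2
      exact iteratedFDeriv_comp h1 h2 hir
    refine Tendsto.congr' (hev.mono fun _ h => h.symm) ?_
    simp only [FormalMultilinearSeries.taylorComp]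
    refine tendsto_finsetSum _ fun c _ => ?_
    have h1 := (hh.tendsto_iteratedFDeriv c.length (c.length_le.trans hi)).comp hp
    have h2 : Tendsto (fun p : ι × E => fun j : Fin c.length =>
        iteratedFDeriv ℝ (c.partSize j) (g p.1) p.2) (l ×ˢ 𝓝 x)
        (𝓝 fun j => iteratedFDeriv ℝ (c.partSize j) g₀ x) :=
      tendsto_pi_nhds.2 fun j => hg.tendsto_iteratedFDeriv _ ((c.partSize_le j).trans hi)
    exact ((c.compAlongOrderedFinpartitionL ℝ E F G).continuous_uncurry_of_multilinear.tendsto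
      (_, _)).comp (h1.prodMk_nhds h2)

theorem prodMk {g : ι → E → F} {g₀ : E → F} {h : ι → E → G} {h₀ : E → G}
    (hg : JetTendsto r l g g₀ x) (hh : JetTendsto r l h h₀ x) :
    JetTendsto r l (fun k y => (g k y, h k y)) (fun y => (g₀ y, h₀ y)) x := by
  refine ⟨?_, hg.contDiffAt.prodMk hh.contDiffAt, fun i hi => ?_⟩
  · filter_upwards [hg.eventually_contDiffAt, hh.eventually_contDiffAt] with p h1 h2
    exact h1.prodMk h2
  · have hir : (i : WithTop ℕ∞) ≤ r := by exact_mod_cast hi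
    rw [iteratedFDeriv_prodMk hg.contDiffAt hh.contDiffAt hir]
    have hev : ∀ᶠ p in l ×ˢ 𝓝 x, iteratedFDeriv ℝ i (fun y => (g p.1 y, h p.1 y)) p.2 =
        (iteratedFDeriv ℝ i (g p.1) p.2).prod (iteratedFDeriv ℝ i (h p.1) p.2) := by
      filter_upwards [hg.eventually_contDiffAt, hh.eventually_contDiffAt] with p h1 h2
      exact iteratedFDeriv_prodMk h1 h2 hir
    refine Tendsto.congr' (hev.mono fun _ h => h.symm) ?_
    exact ((ContinuousMultilinearMap.prodL ℝ (fun _ : Fin i => E) F G).continuous.tendsto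
      (_, _)).comp ((hg.tendsto_iteratedFDeriv i hi).prodMk_nhds (hh.tendsto_iteratedFDeriv i hi))

theorem comp_contDiffAt {h : F → G} {g : ι → E → F} {g₀ : E → F}
    (hh : ContDiffAt ℝ r h (g₀ x)) (hg : JetTendsto r l g g₀ x) :
    JetTendsto r l (fun k y => h (g k y)) (fun y => h (g₀ y)) x :=
  comp (of_contDiffAt hh) hg

theorem add {g h : ι → E → F} {g₀ h₀ : E → F}
    (hg : JetTendsto r l g g₀ x) (hh : JetTendsto r l h h₀ x) :
    JetTendsto r l (fun k y => g k y + h k y) (fun y => g₀ y + h₀ y) x :=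
  comp_contDiffAt (h := fun p : F × F => p.1 + p.2) contDiff_add.contDiffAt (hg.prodMk hh)

theorem mul {g h : ι → E → ℝ} {g₀ h₀ : E → ℝ}
    (hg : JetTendsto r l g g₀ x) (hh : JetTendsto r l h h₀ x) :
    JetTendsto r l (fun k y => g k y * h k y) (fun y => g₀ y * h₀ y) x :=
  comp_contDiffAt (h := fun p : ℝ × ℝ => p.1 * p.2) contDiff_mul.contDiffAt (hg.prodMk hh)

theorem sq {g : ι → E → ℝ} {g₀ : E → ℝ} (h : JetTendsto r l g g₀ x) :
    JetTendsto r l (fun k y => g k y ^ 2) (fun y => g₀ y ^ 2) x := by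
  simpa only [pow_two] using h.mul h

theorem smul {g : ι → E → ℝ} {h : ι → E → F} {g₀ : E → ℝ} {h₀ : E → F}
    (hg : JetTendsto r l g g₀ x) (hh : JetTendsto r l h h₀ x) :
    JetTendsto r l (fun k y => g k y • h k y) (fun y => g₀ y • h₀ y) x :=
  comp_contDiffAt (h := fun p : ℝ × F => p.1 • p.2) contDiff_smul.contDiffAt (hg.prodMk hh)

theorem sum {α : Type*} (s : Finset α) {g : α → ι → E → F} {g₀ : α → E → F}
    (h : ∀ a ∈ s, JetTendsto r l (g a) (g₀ a) x) :
    JetTendsto r l (fun k y => ∑ a ∈ s, g a k y) (fun y => ∑ a ∈ s, g₀ a y) x := by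
  classical
  induction s using Finset.induction_on with
  | empty => simpa using const (c := fun _ : ι => (0 : F)) tendsto_const_nhds
  | insert a s ha ih =>
    simp only [Finset.sum_insert ha]
    exact (h a (Finset.mem_insert_self _ _)).add (ih fun b hb => h b (Finset.mem_insert_of_mem hb))

theorem fderiv {g : ι → E → F} {g₀ : E → F} (h : JetTendsto (r + 1) l g g₀ x) :
    JetTendsto r l (fun k => fderiv ℝ (g k)) (fderiv ℝ g₀) x := by
  refine ⟨?_, h.contDiffAt.fderiv_right (by simp), fun i hi => ?_⟩
  · filter_upwards [h.eventually_contDiffAt] with p hp using hp.fderiv_right (by simp)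
  · have := h.tendsto_iteratedFDeriv (i + 1) (by omega)
    simp only [iteratedFDeriv_succ_eq_comp_right, Function.comp_apply] at this
    have h2 := ((continuousMultilinearCurryRightEquiv' ℝ i E F).continuous.tendsto _).comp this
    simpa [Function.comp_def] using h2

/-- Jet convergence of order `r + 1` is convergence of the values and jet convergence of order `r`
of the derivatives: the tool for inductions on `r`. -/
theorem of_fderiv {g : ι → E → F} {g₀ : E → F}
    (hc : ∀ᶠ p in l ×ˢ 𝓝 x, ContDiffAt ℝ (r + 1 : ℕ) (g p.1) p.2)
    (hc₀ : ContDiffAt ℝ (r + 1 : ℕ) g₀ x)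
    (ht : Tendsto (fun p : ι × E => g p.1 p.2) (l ×ˢ 𝓝 x) (𝓝 (g₀ x)))
    (h : JetTendsto r l (fun k => _root_.fderiv ℝ (g k)) (_root_.fderiv ℝ g₀) x) :
    JetTendsto (r + 1) l g g₀ x := by
  refine ⟨hc, hc₀, fun i hi => ?_⟩
  rcases i with _ | i
  · simp only [iteratedFDeriv_zero_eq_comp, Function.comp_def]
    exact ((continuousMultilinearCurryFin0 ℝ E F).symm.continuous.tendsto _).comp ht
  · simp only [iteratedFDeriv_succ_eq_comp_right, Function.comp_apply]
    exact ((continuousMultilinearCurryRightEquiv' ℝ i E F).symm.continuous.tendsto _).comp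
      (h.tendsto_iteratedFDeriv i (by omega))

theorem affine {p : ι → E} {p₀ : E} {δ : ι → ℝ} (hp : Tendsto p l (𝓝 p₀))
    (hδ : Tendsto δ l (𝓝 0)) : JetTendsto r l (fun k u => p k + δ k • u) (fun _ : E => p₀) x := by
  simpa using (const hp).add ((const hδ).smul (of_contDiffAt (contDiffAt_id (x := x))))

/-- Magnification of maps at a point by factors `1/δ` tending to infinity converges to the
derivative of the limit. -/
theorem blowup (hr : r ≠ 0) {h : ι → E → F} {h₀ : E → F} {p : ι → E} {p₀ : E} {δ : ι → ℝ}
    (hh : JetTendsto r l h h₀ p₀) (hp : Tendsto p l (𝓝 p₀)) (hδ : Tendsto δ l (𝓝 0))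
    (hδ0 : ∀ᶠ k in l, δ k ≠ 0) :
    JetTendsto r l (fun k u => (δ k)⁻¹ • (h k (p k + δ k • u) - h k (p k)))
      (fun u => _root_.fderiv ℝ h₀ p₀ u) x := by
  obtain ⟨r, rfl⟩ := Nat.exists_eq_add_one_of_ne_zero hr
  have haff : Tendsto (fun q : ι × E => (q.1, p q.1 + δ q.1 • q.2)) (l ×ˢ 𝓝 x) (l ×ˢ 𝓝 p₀) :=
    tendsto_fst.prodMk (affine (r := 0) hp hδ).tendsto
  have hcd := haff.eventually hh.eventually_contDiffAt
  have hne : ∀ᶠ q in l ×ˢ 𝓝 x, δ q.1 ≠ 0 := tendsto_fst.eventually hδ0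
  refine of_fderiv ?_ (ContinuousLinearMap.contDiff _).contDiffAt ?_ ?_
  · filter_upwards [hcd] with q hq
    refine contDiffAt_const.smul (ContDiffAt.sub ?_ contDiffAt_const)
    exact ContDiffAt.comp q.2 hq (by fun_prop)
  · -- the mean value inequality on a ball where the derivatives are close to that of the limit
    rw [Metric.tendsto_nhds]
    intro ε hε
    have hD := (hh.fderiv).tendsto
    rw [Metric.tendsto_nhds] at hD
    set e : ℝ := ε / (2 * (‖x‖ + 1)) with he
    have hx1 : 0 < ‖x‖ + 1 := by positivity
    have he0 : 0 < e := by positivity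
    obtain ⟨pa, ha, pb, hb, hab⟩ := eventually_prod_iff.1 ((hD e he0).and hh.eventually_contDiffAt)
    obtain ⟨η, hη, hball⟩ := Metric.eventually_nhds_iff_ball.1 hb
    have h1 : ∀ᶠ q in l ×ˢ 𝓝 x, p q.1 ∈ Metric.ball p₀ η :=
      tendsto_fst.eventually (hp.eventually (Metric.ball_mem_nhds _ hη))
    have h2 : ∀ᶠ q in l ×ˢ 𝓝 x, p q.1 + δ q.1 • q.2 ∈ Metric.ball p₀ η :=
      (affine (r := 0) hp hδ).tendsto.eventually (Metric.ball_mem_nhds _ hη)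
    have h3 : ∀ᶠ q in l ×ˢ 𝓝 x, ‖q.2‖ < ‖x‖ + 1 :=
      tendsto_snd.eventually ((continuous_norm.tendsto x).eventually (gt_mem_nhds (by linarith)))
    have h4 : ∀ᶠ q : ι × E in l ×ˢ 𝓝 x,
        dist (_root_.fderiv ℝ h₀ p₀ q.2) (_root_.fderiv ℝ h₀ p₀ x) < ε / 2 :=
      tendsto_snd.eventually (((_root_.fderiv ℝ h₀ p₀).continuous.tendsto x).eventually
        (Metric.ball_mem_nhds _ (by positivity)))
    filter_upwards [h1, h2, h3, h4, hne, tendsto_fst.eventually ha] with q h1 h2 h3 h4 h5 h6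
    have hmv := (convex_ball p₀ η).norm_image_sub_le_of_norm_hasFDerivWithin_le'
      (f := h q.1) (f' := _root_.fderiv ℝ (h q.1)) (φ := _root_.fderiv ℝ h₀ p₀) (C := e)
      (fun y hy => (((hab h6 (hball y hy)).2.differentiableAt
        (by simp)).hasFDerivAt).hasFDerivWithinAt)
      (fun y hy => by
        have := (hab h6 (hball y hy)).1
        rw [dist_eq_norm] at this
        exact this.le) h1 h2
    have h7 : dist ((δ q.1)⁻¹ • (h q.1 (p q.1 + δ q.1 • q.2) - h q.1 (p q.1)))
        (_root_.fderiv ℝ h₀ p₀ q.2) ≤ e * ‖q.2‖ := by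
      rw [dist_eq_norm]
      have hδp : 0 < ‖δ q.1‖ := norm_pos_iff.2 h5
      refine le_of_mul_le_mul_left ?_ hδp
      rw [← norm_smul, smul_sub, smul_inv_smul₀ h5, ← map_smul]
      calc _ ≤ _ := by simpa using hmv
        _ = _ := by rw [norm_smul]; ring
    have h8 : e * ‖q.2‖ ≤ ε / 2 := by
      calc e * ‖q.2‖ ≤ e * (‖x‖ + 1) := by gcongr
        _ = ε / 2 := by rw [he]; field_simp
    calc _ ≤ _ := dist_triangle _ (_root_.fderiv ℝ h₀ p₀ q.2) _
      _ < ε := by linarith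
  -- the factor `1/δ` cancels in the derivative of the magnified map, which is that of `h k` itself
  · have h1 : JetTendsto r l (fun k u => _root_.fderiv ℝ (h k) (p k + δ k • u))
        (fun _ => _root_.fderiv ℝ h₀ p₀) x :=
      comp (h := fun k => _root_.fderiv ℝ (h k)) (h₀ := _root_.fderiv ℝ h₀) hh.fderiv
        (affine hp hδ)
    have h0 : (fun u : E => _root_.fderiv ℝ (fun u => _root_.fderiv ℝ h₀ p₀ u) u) =
        fun _ => _root_.fderiv ℝ h₀ p₀ := by
      ext1 u; exact (_root_.fderiv ℝ h₀ p₀).fderiv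
    refine (h1.congr ?_).congr_limit (Eventually.of_forall fun u => congrFun h0 u)
    filter_upwards [hcd, hne] with q hq hq0
    have hd : HasFDerivAt (h q.1) (_root_.fderiv ℝ (h q.1) (p q.1 + δ q.1 • q.2))
        (p q.1 + δ q.1 • q.2) := (hq.differentiableAt (by simp)).hasFDerivAt
    have ha : HasFDerivAt (fun u : E => p q.1 + δ q.1 • u)
        (δ q.1 • ContinuousLinearMap.id ℝ E) q.2 :=
      ((hasFDerivAt_id q.2).const_smul (δ q.1)).const_add (p q.1)
    have := (((hd.comp q.2 ha).sub_const (h q.1 (p q.1))).const_smul (δ q.1)⁻¹).fderiv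
    refine Eq.trans this ?_
    ext v
    simp [hq0]

/-- Magnification with the quadratic factor `1/δ²` of a map with vanishing first jet converges to
half of its second derivative. -/
theorem blowup_sq (hr : 2 ≤ r) {h : E → F} {δ : ι → ℝ} (hh : ContDiffAt ℝ r h 0) (h0 : h 0 = 0)
    (h1 : _root_.fderiv ℝ h 0 = 0) (hδ : Tendsto δ l (𝓝 0)) (hδ0 : ∀ᶠ k in l, δ k ≠ 0) :
    JetTendsto r l (fun k u => (δ k ^ 2)⁻¹ • h (δ k • u))
      (fun u => (2⁻¹ : ℝ) • _root_.fderiv ℝ (_root_.fderiv ℝ h) 0 u u) x := by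
  obtain ⟨r, rfl⟩ := Nat.exists_eq_add_of_le' hr
  set B := _root_.fderiv ℝ (_root_.fderiv ℝ h) 0 with hB
  -- symmetry makes `B v` the derivative of `B u u / 2` at `v`
  have hsymm : ∀ u v, B u v = B v u := by
    have := hh.isSymmSndFDerivAt (by
      rw [minSmoothness_of_isRCLikeNormedField]; push_cast; exact le_add_self)
    exact fun u v => this.eq u v
  have hhd : ContDiffAt ℝ (r + 1 : ℕ) (_root_.fderiv ℝ h) 0 := hh.fderiv_right (by
    push_cast; rw [add_assoc]; norm_num)
  have hne : ∀ᶠ q in l ×ˢ 𝓝 x, δ q.1 ≠ 0 := tendsto_fst.eventually hδ0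
  have haff : Tendsto (fun q : ι × E => δ q.1 • q.2) (l ×ˢ 𝓝 x) (𝓝 0) := by
    simpa using (affine (r := 0) (x := x) (tendsto_const_nhds (x := (0 : E)) (f := l)) hδ).tendsto
  have hcd := haff.eventually (hh.eventually (natCast_ne_infty _))
  have hQ : ∀ v, HasFDerivAt (fun u => (2⁻¹ : ℝ) • B u u) (B v) v := by
    intro v
    have := ((B.hasFDerivAt (x := v)).clm_apply (hasFDerivAt_id v)).const_smul (2⁻¹ : ℝ)
    refine this.congr_fderiv ?_
    ext u
    simp only [id_eq, _root_.smul_apply, _root_.add_apply,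
      ContinuousLinearMap.comp_apply, ContinuousLinearMap.coe_id',
      ContinuousLinearMap.flip_apply, hsymm u v, ← two_smul ℝ]
    rw [smul_smul]; norm_num
  have hQc : ContDiff ℝ (r + 2 : ℕ) (fun u => (2⁻¹ : ℝ) • B u u) := by fun_prop
  refine of_fderiv ?_ hQc.contDiffAt ?_ ?_
  · filter_upwards [hcd] with q hq
    exact contDiffAt_const.smul (ContDiffAt.comp q.2 hq (by fun_prop))
  · -- the mean value inequality applied to `h v - B v v / 2`, whose derivative is `o(v)`
    rw [Metric.tendsto_nhds]
    intro ε hε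
    set e : ℝ := ε / (2 * (‖x‖ + 1) ^ 2) with he
    have he0 : 0 < e := by positivity
    have hlit := ((hhd.differentiableAt (by simp)).hasFDerivAt).isLittleO.def he0
    simp only [h1, sub_zero, ← hB] at hlit
    obtain ⟨η, hη, hball⟩ := Metric.eventually_nhds_iff_ball.1
      (hlit.and (hh.eventually (natCast_ne_infty _)))
    have h2 : ∀ᶠ q in l ×ˢ 𝓝 x, δ q.1 • q.2 ∈ Metric.ball (0 : E) η :=
      haff.eventually (Metric.ball_mem_nhds _ hη)
    have h3 : ∀ᶠ q in l ×ˢ 𝓝 x, ‖q.2‖ < ‖x‖ + 1 :=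
      tendsto_snd.eventually ((continuous_norm.tendsto x).eventually (gt_mem_nhds (by linarith)))
    have h4 : ∀ᶠ q : ι × E in l ×ˢ 𝓝 x,
        dist ((2⁻¹ : ℝ) • B q.2 q.2) ((2⁻¹ : ℝ) • B x x) < ε / 2 :=
      tendsto_snd.eventually ((hQc.continuous.tendsto x).eventually
        (Metric.ball_mem_nhds _ (by positivity)))
    filter_upwards [h2, h3, h4, hne] with q h2 h3 h4 h5
    set v := δ q.1 • q.2 with hv
    have hsub : Metric.closedBall (0 : E) ‖v‖ ⊆ Metric.ball 0 η :=
      Metric.closedBall_subset_ball (by simpa using h2)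
    have hmv := (convex_closedBall (0 : E) ‖v‖).norm_image_sub_le_of_norm_hasFDerivWithin_le
      (f := fun u => h u - (2⁻¹ : ℝ) • B u u)
      (f' := fun u => _root_.fderiv ℝ h u - B u) (C := e * ‖v‖) (x := 0) (y := v)
      (fun y hy => ((((hball y (hsub hy)).2.differentiableAt
        (by simp)).hasFDerivAt).sub (hQ y)).hasFDerivWithinAt)
      (fun y hy => (hball y (hsub hy)).1.trans (by
        have : ‖y‖ ≤ ‖v‖ := by simpa using hy
        gcongr)) (by simp) (by simp)
    have h7 : dist ((δ q.1 ^ 2)⁻¹ • h v) ((2⁻¹ : ℝ) • B q.2 q.2) ≤ e * ‖q.2‖ ^ 2 := by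
      rw [dist_eq_norm]
      have hδp : 0 < ‖δ q.1 ^ 2‖ := norm_pos_iff.2 (by positivity)
      refine le_of_mul_le_mul_left ?_ hδp
      rw [← norm_smul, smul_sub, smul_inv_smul₀ (by positivity)]
      have : (δ q.1 ^ 2) • (2⁻¹ : ℝ) • B q.2 q.2 = (2⁻¹ : ℝ) • B v v := by
        simp only [hv, map_smul, _root_.smul_apply, smul_smul]; congr 1; ring
      rw [this]
      calc _ ≤ _ := by simpa [h0] using hmv
        _ = _ := by rw [hv, norm_smul, norm_pow]; ring
    have h8 : e * ‖q.2‖ ^ 2 ≤ ε / 2 := by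
      calc e * ‖q.2‖ ^ 2 ≤ e * (‖x‖ + 1) ^ 2 := by gcongr
        _ = ε / 2 := by rw [he]; field_simp
    calc _ ≤ _ := dist_triangle _ ((2⁻¹ : ℝ) • B q.2 q.2) _
      _ < ε := by linarith
  -- the derivative of the magnified map is the magnification of the derivative by `1/δ`
  · have hb := blowup r.succ_ne_zero (x := x) (h := fun _ : ι => _root_.fderiv ℝ h)
      (of_contDiffAt hhd) (tendsto_const_nhds (x := (0 : E)) (f := l)) hδ hδ0
    refine (hb.congr ?_).congr_limit (Eventually.of_forall fun u => ?_)
    · filter_upwards [hcd, hne] with q hq hq0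
      have hd : HasFDerivAt h (_root_.fderiv ℝ h (δ q.1 • q.2)) (δ q.1 • q.2) :=
        (hq.differentiableAt (by simp)).hasFDerivAt
      have ha : HasFDerivAt (fun u : E => δ q.1 • u)
          (δ q.1 • ContinuousLinearMap.id ℝ E) q.2 := (hasFDerivAt_id q.2).const_smul (δ q.1)
      refine Eq.trans ((hd.comp q.2 ha).const_smul (δ q.1 ^ 2)⁻¹).fderiv ?_
      ext v
      simp [h1, smul_smul]
      congr 1
      field_simp
    · exact (hQ u).fderiv

end JetTendsto

/-- What holds eventually, locally uniformly, holds eventually uniformly on compact sets. -/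
theorem eventually_forall_mem_of_isCompact {E : Type*} [TopologicalSpace E] {K : Set E}
    (hK : IsCompact K) {P : ι × E → Prop} (hP : ∀ x, ∀ᶠ p in l ×ˢ 𝓝 x, P p) :
    ∀ᶠ k in l, ∀ w ∈ K, P (k, w) := by
  refine hK.induction_on (p := fun s => ∀ᶠ k in l, ∀ w ∈ s, P (k, w)) (by simp)
    (fun s t hst ht => ht.mono fun k hk w hw => hk w (hst hw))
    (fun s t hs ht => by
      filter_upwards [hs, ht] with k h1 h2 w hw using hw.elim (h1 w) (h2 w)) ?_
  intro x _
  obtain ⟨pa, ha, pb, hb, hab⟩ := eventually_prod_iff.1 (hP x)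
  exact ⟨{y | pb y}, mem_nhdsWithin_of_mem_nhds hb, ha.mono fun k hk w hw => hab hk hw⟩

/-- Jet convergence at every point is convergence in the `C^r` topology on compact sets. -/
theorem tendstoCr_of_jetTendsto {g : ℕ → E3 → E3} {g₀ : E3 → E3}
    (h : ∀ x, JetTendsto r atTop g g₀ x) : TendstoCr r g g₀ := by
  intro K hK
  refine ⟨eventually_forall_mem_of_isCompact hK fun x => (h x).eventually_contDiffAt,
    fun i hi => ?_⟩
  rw [Metric.tendstoUniformlyOn_iff]
  intro ε hε
  refine eventually_forall_mem_of_isCompact hK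
    (P := fun p => dist (iteratedFDeriv ℝ i g₀ p.2) (iteratedFDeriv ℝ i (g p.1) p.2) < ε)
    fun x => ?_
  have h1 := (h x).tendsto_iteratedFDeriv i hi
  have h2 : Tendsto (fun p : ℕ × E3 => iteratedFDeriv ℝ i g₀ p.2) (atTop ×ˢ 𝓝 x)
      (𝓝 (iteratedFDeriv ℝ i g₀ x)) :=
    ((h x).contDiffAt.continuousAt_iteratedFDeriv (by exact_mod_cast hi)).tendsto.comp tendsto_snd
  have h3 := h2.dist h1
  rw [dist_self] at h3
  exact h3.eventually (gt_mem_nhds hε)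

end Jets

/-! ### Resonant times of passage -/

/-- The differences `m - n θ` with large natural numbers `m` and `n` are dense if `θ` is irrational
and positive. -/
theorem exists_tendsto_natCast_sub_mul {θ : ℝ} (hθ : Irrational θ) (h0 : 0 < θ) (c : ℝ) :
    ∃ m n : ℕ → ℕ, Tendsto m atTop atTop ∧ Tendsto n atTop atTop ∧
      Tendsto (fun k => (m k : ℝ) - n k * θ) atTop (𝓝 c) := by
  have hd : DenseRange (fun n : ℤ => n • ((θ : ℝ) : UnitAddCircle)) :=
    AddCircle.denseRange_zsmul_coe_iff.2 (by simpa using hθ)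
  have hcl := (mapClusterPt_atTop_nsmul_tfae ((-c : ℝ) : UnitAddCircle)
    ((θ : ℝ) : UnitAddCircle)).out 0 3 |>.2 (hd _)
  have hex : ∀ k : ℕ, ∃ n : ℕ, k ≤ n ∧ ∃ j : ℤ, |(j : ℝ) - n * θ - c| < 1 / ((k : ℝ) + 1) := by
    intro k
    have hk : (0 : ℝ) < 1 / ((k : ℝ) + 1) := by positivity
    have := (hcl.frequently (Metric.ball_mem_nhds _ hk)).and_eventually (eventually_ge_atTop k)
    obtain ⟨n, hn, hkn⟩ := this.exists
    -- the distance of `n θ + c` to the nearest integer is its norm in the circle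
    refine ⟨n, hkn, round (n * θ + c), ?_⟩
    rw [dist_eq_norm] at hn
    have h2 : n • ((θ : ℝ) : UnitAddCircle) - ((-c : ℝ) : UnitAddCircle) =
        ((n * θ + c : ℝ) : UnitAddCircle) := by
      simp
    rw [h2, UnitAddCircle.norm_eq, abs_sub_comm] at hn
    simpa [sub_sub] using hn
  choose n hkn j hj using hex
  have hn : Tendsto n atTop atTop := tendsto_atTop_mono hkn tendsto_id
  have hlim : Tendsto (fun k => (j k : ℝ) - n k * θ) atTop (𝓝 c) := by
    rw [tendsto_iff_dist_tendsto_zero]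
    exact squeeze_zero (fun _ => dist_nonneg) (fun k => by rw [Real.dist_eq]; exact (hj k).le)
      tendsto_one_div_add_atTop_nhds_zero_nat
  have hjr : Tendsto (fun k => (j k : ℝ)) atTop atTop := by
    have h1 : Tendsto (fun k => (n k : ℝ) * θ) atTop atTop :=
      (tendsto_natCast_atTop_atTop.comp hn).atTop_mul_const h0
    simpa using hlim.add_atTop h1
  have hjz : Tendsto j atTop atTop := tendsto_intCast_atTop_iff.1 hjr
  have hm : Tendsto (fun k => (j k).toNat) atTop atTop := by
    refine tendsto_atTop.2 fun b => ?_
    filter_upwards [tendsto_atTop.1 hjz b] with k hk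
    omega
  refine ⟨_, n, hm, hn, hlim.congr' ?_⟩
  filter_upwards [tendsto_atTop.1 hjz 0] with k hk
  have : (((j k).toNat : ℤ) : ℝ) = (j k : ℝ) := by rw [Int.toNat_of_nonneg hk]
  rw [← this]; push_cast; ring

/-- Even times of passage near the two saddles for which the expansion at `P` balances the
contraction at `Q`. By the spectral condition the contraction at `P` dominates the square of the
product of the expansions. -/
theorem exists_resonant_times {lamP sigP lamQ sigQ s : ℝ} (hlP : 0 < |lamP|)
    (hsP : 1 < |sigP|) (hlQ : 0 < |lamQ|) (hlQ1 : |lamQ| < 1) (hsQ : 1 < |sigQ|)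
    (hspec : |(|(|lamP| ^ (1 / 2 : ℝ) * sigP)|) ^ (Real.log |lamQ⁻¹| / Real.log |sigP|) * sigQ| < 1)
    (hirr : Irrational (Real.log |lamQ| / Real.log |sigP|)) (hs : 0 < s) :
    ∃ m n : ℕ → ℕ, Tendsto m atTop atTop ∧ Tendsto n atTop atTop ∧
      Tendsto (fun k => sigP ^ (2 * m k) * lamQ ^ (2 * n k)) atTop (𝓝 s) ∧
      Tendsto (fun k => lamP ^ (2 * m k) * (sigP ^ (2 * m k) * sigQ ^ (2 * n k)) ^ 2) atTop
        (𝓝 0) := by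
  set a := Real.log |sigP| with ha
  set b := Real.log |lamQ| with hb
  set p := Real.log |lamP| with hp
  set q := Real.log |sigQ| with hq
  have ha0 : 0 < a := Real.log_pos hsP
  have hb0 : b < 0 := Real.log_neg hlQ hlQ1
  have hθ : Irrational (-(b / a)) := hirr.neg
  obtain ⟨m, n, hm, hn, hmn⟩ := exists_tendsto_natCast_sub_mul hθ
    (by rw [← neg_div]; exact div_pos (neg_pos.2 hb0) ha0) (Real.log s / (2 * a))
  have hlin : Tendsto (fun k => 2 * (m k : ℝ) * a + 2 * (n k : ℝ) * b) atTop (𝓝 (Real.log s)) := by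
    have := hmn.mul_const (2 * a)
    rw [div_mul_cancel₀ _ (by positivity)] at this
    refine this.congr fun k => ?_
    field_simp
    ring
  have hpow : ∀ (x : ℝ) (i : ℕ), 0 < |x| → x ^ (2 * i) = Real.exp (2 * i * Real.log |x|) := by
    intro x i hx
    rw [pow_mul, ← sq_abs, ← pow_mul, ← Real.exp_log hx, ← Real.exp_nat_mul, Real.log_exp]
    push_cast; rfl
  have hsP0 : 0 < |sigP| := by linarith
  have hsQ0 : 0 < |sigQ| := by linarith
  refine ⟨m, n, hm, hn, ?_, ?_⟩
  · have := (Real.continuous_exp.tendsto _).comp hlin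
    rw [Real.exp_log hs] at this
    refine this.congr fun k => ?_
    rw [hpow _ _ hsP0, hpow _ _ hlQ, ← Real.exp_add]
    rfl
  -- the spectral condition, in logarithms
  · have hneg : -2 * b * (p + 2 * a) / a + 4 * q < 0 := by
      have hκ : 0 < |(|lamP| ^ (1 / 2 : ℝ) * sigP)| := by
        rw [abs_pos]
        exact mul_ne_zero (Real.rpow_pos_of_pos hlP _).ne' (abs_pos.1 hsP0)
      have hpos : 0 < |(|(|lamP| ^ (1 / 2 : ℝ) * sigP)|) ^
          (Real.log |lamQ⁻¹| / Real.log |sigP|) * sigQ| := by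
        rw [abs_pos]
        exact mul_ne_zero (Real.rpow_pos_of_pos hκ _).ne' (abs_pos.1 hsQ0)
      have h1 := Real.log_neg hpos hspec
      rw [abs_mul, Real.log_mul (by rw [abs_ne_zero]; exact (Real.rpow_pos_of_pos hκ _).ne')
        hsQ0.ne', abs_of_pos (Real.rpow_pos_of_pos hκ _), Real.log_rpow hκ, abs_mul,
        Real.log_mul (by rw [abs_ne_zero]; exact (Real.rpow_pos_of_pos hlP _).ne') hsP0.ne',
        abs_of_pos (Real.rpow_pos_of_pos hlP _), Real.log_rpow hlP, abs_inv, Real.log_inv,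
        ← ha, ← hb, ← hp, ← hq] at h1
      have : -2 * b * (p + 2 * a) / a + 4 * q = 4 * (-b / a * (1 / 2 * p + a) + q) := by
        field_simp; ring
      rw [this]; linarith
    -- elimination of `m` by means of the convergent combination `2 m a + 2 n b`
    have hlog : Tendsto (fun k => (2 * (m k : ℝ) * a + 2 * (n k : ℝ) * b) * ((p + 2 * a) / a) +
        n k * (-2 * b * (p + 2 * a) / a + 4 * q)) atTop atBot :=
      (hlin.mul_const _).add_atBot
        ((tendsto_natCast_atTop_atTop.comp hn).atTop_mul_const_of_neg hneg)
    refine (Real.tendsto_exp_atBot.comp hlog).congr fun k => ?_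
    rw [hpow _ _ hsP0, hpow _ _ hlP, hpow _ _ hsQ0, ← Real.exp_add, ← Real.exp_nat_mul,
      ← Real.exp_add, Function.comp_apply]
    congr 1
    rw [← ha, ← hp, ← hq]
    field_simp
    push_cast
    ring

/-! ### Linear normal forms and rotations -/

theorem linP_linP (a b s t φ ψ : ℝ) (w : E3) :
    linP a s φ (linP b t ψ w) = linP (a * b) (s * t) (φ + ψ) w := by
  ext i
  fin_cases i <;> simp [linP, mul_add, Real.cos_add, Real.sin_add] <;> ring

theorem linQ_linQ (a b s t φ ψ : ℝ) (w : E3) :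
    linQ a s φ (linQ b t ψ w) = linQ (a * b) (s * t) (φ + ψ) w := by
  ext i
  fin_cases i <;> simp [linQ, mul_add, Real.cos_add, Real.sin_add] <;> ring

theorem linP_one_zero (w : E3) : linP 1 1 0 w = w := by
  ext i; fin_cases i <;> simp [linP]

theorem linQ_one_zero (w : E3) : linQ 1 1 0 w = w := by
  ext i; fin_cases i <;> simp [linQ]

theorem linP_iterate (a s φ : ℝ) (n : ℕ) (w : E3) :
    (linP a s φ)^[n] w = linP (a ^ n) (s ^ n) (n * φ) w := by
  induction n with
  | zero => simp [linP_one_zero]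
  | succ n ih => rw [Function.iterate_succ_apply', ih, linP_linP]; push_cast; congr 1 <;> ring

theorem linQ_iterate (a s φ : ℝ) (n : ℕ) (w : E3) :
    (linQ a s φ)^[n] w = linQ (a ^ n) (s ^ n) (n * φ) w := by
  induction n with
  | zero => simp [linQ_one_zero]
  | succ n ih => rw [Function.iterate_succ_apply', ih, linQ_linQ]; push_cast; congr 1 <;> ring

theorem norm_linP_sq (a s φ : ℝ) (w : E3) :
    ‖linP a s φ w‖ ^ 2 = a ^ 2 * w 0 ^ 2 + s ^ 2 * (w 1 ^ 2 + w 2 ^ 2) := by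
  rw [EuclideanSpace.norm_sq_eq, Fin.sum_univ_three]
  simp only [linP, Real.norm_eq_abs, sq_abs, PiLp.toLp_apply, Matrix.cons_val_zero,
    Matrix.cons_val_one, Matrix.cons_val]
  linear_combination (s ^ 2 * (w 1 ^ 2 + w 2 ^ 2)) * Real.cos_sq_add_sin_sq (2 * Real.pi * φ)

theorem norm_linQ_sq (a s φ : ℝ) (w : E3) :
    ‖linQ a s φ w‖ ^ 2 = a ^ 2 * (w 0 ^ 2 + w 2 ^ 2) + s ^ 2 * w 1 ^ 2 := by
  rw [EuclideanSpace.norm_sq_eq, Fin.sum_univ_three]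
  simp only [linQ, Real.norm_eq_abs, sq_abs, PiLp.toLp_apply, Matrix.cons_val_zero,
    Matrix.cons_val_one, Matrix.cons_val]
  linear_combination (a ^ 2 * (w 0 ^ 2 + w 2 ^ 2)) * Real.cos_sq_add_sin_sq (2 * Real.pi * φ)

theorem norm_rotX (t : ℝ) (w : E3) : ‖rotX t w‖ = ‖w‖ := by
  refine (sq_eq_sq₀ (norm_nonneg _) (norm_nonneg _)).1 ?_
  rw [rotX, norm_linP_sq, EuclideanSpace.norm_sq_eq, Fin.sum_univ_three]
  simp only [Real.norm_eq_abs, sq_abs]; ring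

theorem norm_rotY (t : ℝ) (w : E3) : ‖rotY t w‖ = ‖w‖ := by
  refine (sq_eq_sq₀ (norm_nonneg _) (norm_nonneg _)).1 ?_
  rw [rotY, norm_linQ_sq, EuclideanSpace.norm_sq_eq, Fin.sum_univ_three]
  simp only [Real.norm_eq_abs, sq_abs]; ring

theorem contDiff_coord {n : WithTop ℕ∞} (i : Fin 3) : ContDiff ℝ n (fun w : E3 => w i) :=
  contDiff_euclidean.1 contDiff_id i

theorem contDiff_rotX {X : Type*} [NormedAddCommGroup X] [NormedSpace ℝ X] {n : WithTop ℕ∞}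
    {t : X → ℝ} {w : X → E3} (ht : ContDiff ℝ n t) (hw : ContDiff ℝ n w) :
    ContDiff ℝ n (fun x => rotX (t x) (w x)) := by
  have h := fun i => (contDiff_coord i).comp hw
  simp only [Function.comp_def] at h
  refine contDiff_euclidean.2 fun i => ?_
  have h0 := h 0
  have h1 := h 1
  have h2 := h 2
  have hs : ContDiff ℝ n fun x => Real.sin (2 * Real.pi * t x) :=
    Real.contDiff_sin.comp (contDiff_const.mul ht)
  have hc : ContDiff ℝ n fun x => Real.cos (2 * Real.pi * t x) :=
    Real.contDiff_cos.comp (contDiff_const.mul ht)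
  fin_cases i <;> simp [rotX, linP] <;> fun_prop

theorem contDiff_rotY {X : Type*} [NormedAddCommGroup X] [NormedSpace ℝ X] {n : WithTop ℕ∞}
    {t : X → ℝ} {w : X → E3} (ht : ContDiff ℝ n t) (hw : ContDiff ℝ n w) :
    ContDiff ℝ n (fun x => rotY (t x) (w x)) := by
  have h := fun i => (contDiff_coord i).comp hw
  simp only [Function.comp_def] at h
  refine contDiff_euclidean.2 fun i => ?_
  have h0 := h 0
  have h1 := h 1
  have h2 := h 2
  have hs : ContDiff ℝ n fun x => Real.sin (2 * Real.pi * t x) :=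
    Real.contDiff_sin.comp (contDiff_const.mul ht)
  have hc : ContDiff ℝ n fun x => Real.cos (2 * Real.pi * t x) :=
    Real.contDiff_cos.comp (contDiff_const.mul ht)
  fin_cases i <;> simp [rotY, linQ] <;> fun_prop

/-! ### Bump functions and perturbations of the identity of the chart domain -/

/-- A smooth function of the square of the distance, equal to one up to `ρ² / 4` and to zero
from `ρ²` on. -/
def bumpSq (ρ t : ℝ) : ℝ := Real.smoothTransition ((ρ ^ 2 - t) / (3 / 4 * ρ ^ 2))

/-- The bump function on the line; being a smooth function of `x²`, it gives a smooth
function `bump ρ ‖w‖` on Euclidean space. -/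
def bump (ρ x : ℝ) : ℝ := bumpSq ρ (x ^ 2)

theorem contDiff_bumpSq (ρ : ℝ) {n : ℕ∞} : ContDiff ℝ n (bumpSq ρ) :=
  Real.smoothTransition.contDiff.comp (by fun_prop)

theorem bumpSq_eq_one {ρ t : ℝ} (hρ : 0 < ρ) (ht : t ≤ ρ ^ 2 / 4) : bumpSq ρ t = 1 := by
  refine Real.smoothTransition.one_of_one_le ?_
  rw [le_div_iff₀ (by positivity)]; linarith

theorem bumpSq_eq_zero {ρ t : ℝ} (hρ : 0 < ρ) (ht : ρ ^ 2 ≤ t) : bumpSq ρ t = 0 := by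
  refine Real.smoothTransition.zero_of_nonpos ?_
  exact div_nonpos_of_nonpos_of_nonneg (by linarith) (by positivity)

theorem bump_eq_zero {ρ x : ℝ} (hρ : 0 < ρ) (hx : ρ ≤ |x|) : bump ρ x = 0 := by
  refine bumpSq_eq_zero hρ ?_
  rw [← sq_abs x]; gcongr

theorem bump_eq_one {ρ x : ℝ} (hρ : 0 < ρ) (hx : |x| ≤ ρ / 2) : bump ρ x = 1 := by
  refine bumpSq_eq_one hρ ?_
  calc x ^ 2 = |x| ^ 2 := (sq_abs x).symm
    _ ≤ (ρ / 2) ^ 2 := by gcongr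
    _ = _ := by ring

theorem isBump_bump (r : ℕ) {ρ : ℝ} (hρ : 0 < ρ) : IsBump r ρ (bump ρ) where
  contDiff := by
    have := (contDiff_bumpSq ρ (n := r)).comp
      (contDiff_id.pow 2 : ContDiff ℝ _ fun x : ℝ => id x ^ 2)
    exact this
  eq_zero x hx := bump_eq_zero hρ hx
  eq_one x hx := bump_eq_one hρ hx
  mem_Ioo x h1 h2 := by
    have h3 : x ^ 2 < ρ ^ 2 := by
      rw [← sq_abs x]; gcongr
    have h4 : (ρ / 2) ^ 2 < x ^ 2 := by
      rw [← sq_abs x]; gcongr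
    refine ⟨Real.smoothTransition.pos_of_pos (div_pos (by linarith) (by positivity)),
      Real.smoothTransition.lt_one_of_lt_one ?_⟩
    rw [div_lt_one (by positivity)]; linarith

theorem contDiff_bump_norm (ρ : ℝ) {n : ℕ∞} : ContDiff ℝ n (fun w : E3 => bump ρ ‖w‖) :=
  (contDiff_bumpSq ρ).comp (contDiff_norm_sq ℝ)

theorem isCompact_box (z₀ : E3) (ρ : ℝ) : IsCompact (box z₀ ρ) := by
  have : box z₀ ρ = (EuclideanSpace.equiv (Fin 3) ℝ).toHomeomorph ⁻¹'
      (univ.pi fun i => Metric.closedBall (z₀ i) ρ) := by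
    ext w
    simp [box, Real.dist_eq, EuclideanSpace.equiv]
  rw [this]
  exact (Homeomorph.isCompact_preimage _).2 (isCompact_univ_pi fun i => isCompact_closedBall _ _)

theorem translationLike_eq_self {r : ℕ} {ρ : ℝ} {b : ℝ → ℝ} (hb : IsBump r ρ b) {z₀ w : E3} (v : E3)
    (hw : w ∉ box z₀ ρ) : translationLike b z₀ v w = w := by
  simp only [box, mem_ofPred_eq, not_forall, not_le] at hw
  obtain ⟨i, hi⟩ := hw
  have h0 : b ((w - z₀) i) = 0 := hb.eq_zero _ hi.le
  have : b ((w - z₀) 0) * b ((w - z₀) 1) * b ((w - z₀) 2) = 0 := by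
    fin_cases i <;> simp_all
  rw [translationLike, this, zero_smul, add_zero]

theorem contDiff_translationLike {r : ℕ} {ρ : ℝ} {b : ℝ → ℝ} (hb : IsBump r ρ b) (z₀ : E3)
    {X : Type*} [NormedAddCommGroup X] [NormedSpace ℝ X] {v w : X → E3} (hv : ContDiff ℝ r v)
    (hw : ContDiff ℝ r w) : ContDiff ℝ r (fun x => translationLike b z₀ (v x) (w x)) := by
  have h : ∀ i, ContDiff ℝ r fun x => b ((w x - z₀) i) := fun i =>
    hb.contDiff.comp ((contDiff_coord i).comp (hw.sub contDiff_const))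
  exact hw.add ((((h 0).mul (h 1)).mul (h 2)).smul hv)

/-- A translation-like perturbation with a short translation vector is a `C^r` diffeomorphism of
the space, being a Lipschitz-small perturbation of the identity. -/
theorem exists_inverse_translationLike {r : ℕ} (hr : r ≠ 0) {ρ : ℝ} {b : ℝ → ℝ}
    (hb : IsBump r ρ b) (z₀ : E3) :
    ∃ ε > 0, ∀ v : E3, ‖v‖ ≤ ε → ∃ g : E3 → E3, ContDiff ℝ r g ∧
      Function.LeftInverse g (translationLike b z₀ v) ∧
      Function.RightInverse g (translationLike b z₀ v) := by
  set B : E3 → ℝ := fun w => b ((w - z₀) 0) * b ((w - z₀) 1) * b ((w - z₀) 2) with hB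
  have h : ∀ i, ContDiff ℝ r fun w : E3 => b ((w - z₀) i) := fun i =>
    hb.contDiff.comp ((contDiff_coord i).comp (contDiff_id.sub contDiff_const))
  have hBc : ContDiff ℝ r B := ((h 0).mul (h 1)).mul (h 2)
  have hsupp : HasCompactSupport B := by
    refine HasCompactSupport.intro (isCompact_box z₀ ρ) fun w hw => ?_
    have := translationLike_eq_self hb (z₀ := z₀) (w := w) (EuclideanSpace.single 0 1) hw
    rw [translationLike, add_eq_left, smul_eq_zero] at this
    exact this.resolve_right (by
      intro h0
      have := congrArg (fun w : E3 => w 0) h0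
      simp at this)
  obtain ⟨L, hL⟩ := hBc.lipschitzWith_of_hasCompactSupport hsupp (by exact_mod_cast hr)
  refine ⟨1 / (2 * ((L : ℝ) + 1)), by positivity, fun v hv => ?_⟩
  have hLv : (L : ℝ) * ‖v‖ ≤ 1 / 2 := by
    have h1 : (L : ℝ) * ‖v‖ ≤ (L + 1) * (1 / (2 * ((L : ℝ) + 1))) := by
      gcongr; linarith
    have h2 : ((L : ℝ) + 1) * (1 / (2 * ((L : ℝ) + 1))) = 1 / 2 := by
      have : (L : ℝ) + 1 ≠ 0 := by positivity
      field_simp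
    linarith
  -- the deviation from the identity is a contraction, of constant `1 / 2`
  set ψ : E3 → E3 := fun w => B w • v with hψ
  have hψL : LipschitzWith (1 / 2) ψ := by
    refine LipschitzWith.of_dist_le_mul fun x y => ?_
    rw [dist_eq_norm, hψ, ← sub_smul, norm_smul, ← dist_eq_norm]
    calc dist (B x) (B y) * ‖v‖ ≤ L * dist x y * ‖v‖ := by
          gcongr; exact hL.dist_le_mul x y
      _ = (L * ‖v‖) * dist x y := by ring
      _ ≤ _ := by
          gcongr
          simpa using hLv
  have happ : ApproximatesLinearOn (translationLike b z₀ v)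
      ((ContinuousLinearEquiv.refl ℝ E3 : E3 ≃L[ℝ] E3) : E3 →L[ℝ] E3) univ (1 / 2) := by
    intro x _ y _
    have := hψL.dist_le_mul x y
    rw [dist_eq_norm, dist_eq_norm] at this
    have h1 : x + B x • v - (y + B y • v) - (x - y) = ψ x - ψ y := by
      simp only [hψ]; abel
    exact (congrArg norm h1).trans_le this
  have hc : Subsingleton E3 ∨ (1 / 2 : NNReal) <
      ‖((ContinuousLinearEquiv.refl ℝ E3 : E3 ≃L[ℝ] E3).symm : E3 →L[ℝ] E3)‖₊⁻¹ := by
    right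
    have : ‖((ContinuousLinearEquiv.refl ℝ E3 : E3 ≃L[ℝ] E3).symm : E3 →L[ℝ] E3)‖₊ = 1 := by
      rw [ContinuousLinearEquiv.refl_symm, ContinuousLinearEquiv.coe_refl]
      exact NNReal.eq ContinuousLinearMap.norm_id
    rw [this, inv_one, div_lt_one (by norm_num)]
    norm_num
  set e := happ.toHomeomorph _ hc with he
  have hcd : ContDiff ℝ r (translationLike b z₀ v) :=
    contDiff_translationLike hb z₀ contDiff_const contDiff_id
  have hψd : Differentiable ℝ ψ := (hBc.differentiable (by exact_mod_cast hr)).smul_const v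
  have hn : ∀ a, ‖-(fderiv ℝ ψ a)‖ < 1 := by
    intro a
    rw [norm_neg]
    have := norm_fderiv_le_of_lipschitz ℝ hψL (x₀ := a)
    refine this.trans_lt ?_
    rw [NNReal.coe_div]
    norm_num
  refine ⟨e.symm, e.contDiff_symm (f₀' := fun a => ContinuousLinearEquiv.unitsEquiv ℝ E3
    (Units.oneSub _ (hn a))) (fun a => ?_) hcd, fun w => e.symm_apply_apply w,
    fun w => e.apply_symm_apply w⟩
  have := (hasFDerivAt_id (𝕜 := ℝ) a).add (hψd a).hasFDerivAt
  refine this.congr_fderiv ?_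
  ext1 u
  change u + fderiv ℝ ψ a u = u - (-(fderiv ℝ ψ a)) u
  rw [_root_.neg_apply, sub_neg_eq_add]

/-! ### The unfolding family -/

section Unfolding

variable {M : Type*} [TopologicalSpace M]

open Classical in
/-- The self-map of `M` that is `g` in the chart `ch` on the compact set `K`, and the identity
elsewhere. -/
def chartExtend (ch : OpenPartialHomeomorph M E3) (K : Set E3) (g : E3 → E3) (p : M) : M :=
  if p ∈ ch.symm '' K then ch.symm (g (ch p)) else p

theorem chartExtend_of_notMem {ch : OpenPartialHomeomorph M E3} {K : Set E3} {g : E3 → E3} {p : M}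
    (hp : p ∉ ch.symm '' K) : chartExtend ch K g p = p := if_neg hp

theorem chartExtend_mem {ch : OpenPartialHomeomorph M E3} {K : Set E3} {g : E3 → E3}
    (hKt : K ⊆ ch.target) (hmap : ∀ w ∈ K, g w ∈ K) {p : M} (hp : p ∈ ch.symm '' K) :
    chartExtend ch K g p ∈ ch.symm '' K := by
  rw [chartExtend, if_pos hp]
  obtain ⟨w, hw, rfl⟩ := hp
  rw [ch.right_inv (hKt hw)]
  exact mem_image_of_mem _ (hmap w hw)

theorem chartExtend_eq {ch : OpenPartialHomeomorph M E3} {K : Set E3} {g : E3 → E3}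
    (hfix : ∀ w ∉ K, g w = w) {p : M} (hp : p ∈ ch.source) :
    chartExtend ch K g p = ch.symm (g (ch p)) := by
  by_cases h : p ∈ ch.symm '' K
  · exact if_pos h
  · rw [chartExtend_of_notMem h, hfix, ch.left_inv hp]
    exact fun h' => h ⟨_, h', ch.left_inv hp⟩

theorem chartExtend_leftInverse {ch : OpenPartialHomeomorph M E3} {K : Set E3} {g g' : E3 → E3}
    (hKt : K ⊆ ch.target) (hmap : ∀ w ∈ K, g w ∈ K) (hinv : Function.LeftInverse g' g) :
    Function.LeftInverse (chartExtend ch K g') (chartExtend ch K g) := by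
  intro p
  by_cases h : p ∈ ch.symm '' K
  · rw [chartExtend, if_pos (chartExtend_mem hKt hmap h), chartExtend, if_pos h]
    obtain ⟨w, hw, rfl⟩ := h
    rw [ch.right_inv (hKt hw), ch.right_inv (hKt (hmap w hw)), hinv]
  · rw [chartExtend_of_notMem h, chartExtend_of_notMem h]

theorem isCompact_image_symm {ch : OpenPartialHomeomorph M E3} {K : Set E3} (hK : IsCompact K)
    (hKt : K ⊆ ch.target) : IsCompact (ch.symm '' K) :=
  hK.image_of_continuousOn (ch.continuousOn_symm.mono hKt)

variable [ChartedSpace E3 M] [T2Space M] {r : ℕ}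

/-- The extension of a family of maps of the chart domain is jointly of class `C^r` in the parameter
and the point if the maps move points of a fixed compact set only. -/
theorem contMDiff_chartExtend {X : Type*} [NormedAddCommGroup X] [NormedSpace ℝ X]
    {ch : OpenPartialHomeomorph M E3} (hch : ch ∈ IsManifold.maximalAtlas (𝓡 3) r M)
    {K : Set E3} (hK : IsCompact K) (hKt : K ⊆ ch.target) {g : X → E3 → E3}
    (hg : ContDiff ℝ r (fun q : X × E3 => g q.1 q.2)) (hfix : ∀ v, ∀ w ∉ K, g v w = w)
    (hmap : ∀ v, ∀ w ∈ K, g v w ∈ K) :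
    ContMDiff (𝓘(ℝ, X).prod (𝓡 3)) (𝓡 3) r
      (fun q : X × M => chartExtend ch K (g q.1) q.2) := by
  rintro ⟨v, p⟩
  by_cases hp : p ∈ ch.source
  · have h1 : ContMDiffAt (𝓘(ℝ, X).prod (𝓡 3)) (𝓡 3) r (fun q : X × M => ch q.2) (v, p) :=
      (contMDiffAt_of_mem_maximalAtlas hch hp).comp (v, p) contMDiffAt_snd
    have h2 : ContMDiffAt (𝓘(ℝ, X).prod (𝓡 3)) 𝓘(ℝ, X × E3) r
        (fun q : X × M => (q.1, ch q.2)) (v, p) := contMDiffAt_fst.prodMk_space h1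
    have h3 : ContMDiffAt (𝓘(ℝ, X).prod (𝓡 3)) (𝓡 3) r
        (fun q : X × M => g q.1 (ch q.2)) (v, p) :=
      (hg.contMDiff.contMDiffAt (x := (v, ch p))).comp (v, p) h2
    have ht : g v (ch p) ∈ ch.target := by
      by_cases hk : ch p ∈ K
      · exact hKt (hmap v _ hk)
      · rw [hfix v _ hk]; exact ch.map_source hp
    have h4 : ContMDiffAt (𝓘(ℝ, X).prod (𝓡 3)) (𝓡 3) r
        (fun q : X × M => ch.symm (g q.1 (ch q.2))) (v, p) :=
      (contMDiffAt_symm_of_mem_maximalAtlas hch ht).comp (v, p) h3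
    refine h4.congr_of_eventuallyEq ?_
    have : ∀ᶠ q : X × M in 𝓝 (v, p), q.2 ∈ ch.source :=
      continuousAt_snd.eventually (ch.open_source.mem_nhds hp)
    filter_upwards [this] with q hq using chartExtend_eq (hfix q.1) hq
  · have hn : p ∉ ch.symm '' K := by
      rintro ⟨w, hw, rfl⟩
      exact hp (ch.map_target (hKt hw))
    refine (contMDiffAt_snd (I := 𝓘(ℝ, X)) (J := 𝓡 3) (n := r)
      (p := (v, p))).congr_of_eventuallyEq ?_
    have : ∀ᶠ q : X × M in 𝓝 (v, p), q.2 ∈ (ch.symm '' K)ᶜ :=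
      continuousAt_snd.eventually
        ((isCompact_image_symm hK hKt).isClosed.isOpen_compl.mem_nhds hn)
    filter_upwards [this] with q hq using chartExtend_of_notMem hq

theorem exists_diffeomorph_chartExtend {ch : OpenPartialHomeomorph M E3}
    (hch : ch ∈ IsManifold.maximalAtlas (𝓡 3) r M)
    {K : Set E3} (hK : IsCompact K) (hKt : K ⊆ ch.target) {g g' : E3 → E3}
    (hg : ContDiff ℝ r g) (hg' : ContDiff ℝ r g') (hfix : ∀ w ∉ K, g w = w)
    (hl : Function.LeftInverse g' g) (hr : Function.RightInverse g' g) :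
    ∃ D : M ≃ₘ^r⟮𝓡 3, 𝓡 3⟯ M, ∀ p, D p = chartExtend ch K g p := by
  have hfix' : ∀ w ∉ K, g' w = w := fun w hw => by
    conv_lhs => rw [← hfix w hw]
    exact hl w
  have hmap : ∀ w ∈ K, g w ∈ K := fun w hw => by
    by_contra h
    have h1 := hl (g w)
    rw [hfix _ h, hl] at h1
    rw [← h1] at h
    exact h hw
  have hmap' : ∀ w ∈ K, g' w ∈ K := fun w hw => by
    by_contra h
    have h1 := hr (g' w)
    rw [hfix' _ h, hr] at h1
    rw [← h1] at h
    exact h hw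
  have hs : ∀ h : E3 → E3, ContDiff ℝ r h → (∀ w ∉ K, h w = w) → (∀ w ∈ K, h w ∈ K) →
      ContMDiff (𝓡 3) (𝓡 3) r (chartExtend ch K h) := fun h h1 h2 h3 =>
    (contMDiff_chartExtend (X := ℝ) hch hK hKt (g := fun _ => h) (h1.comp contDiff_snd)
      (fun _ => h2) (fun _ => h3)).comp ((contMDiff_const (c := (0 : ℝ))).prodMk contMDiff_id)
  exact ⟨⟨⟨chartExtend ch K g, chartExtend ch K g', chartExtend_leftInverse hKt hmap hl,
    chartExtend_leftInverse hKt hmap' hr⟩, hs g hg hfix hmap, hs g' hg' hfix' hmap'⟩, fun p => rfl⟩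

namespace SaddleFocusCycle

variable {f : M ≃ₘ^r⟮𝓡 3, 𝓡 3⟯ M}

theorem closedBall_subset_cube {ρ : ℝ} (hρ : ρ < 10) : Metric.closedBall (0 : E3) ρ ⊆ cube := by
  intro w hw i
  rw [mem_closedBall_zero_iff] at hw
  have := (PiLp.norm_apply_le w i).trans hw
  rw [Real.norm_eq_abs, abs_le] at this
  constructor <;> linarith

theorem box_subset_cube {z : E3} {ρ : ℝ} (hz : ∀ i, |z i| ≤ 1) (hρ : ρ < 9) : box z ρ ⊆ cube := by
  intro w hw i
  have h1 := hw i
  have h2 := hz i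
  rw [PiLp.sub_apply, abs_le] at h1
  rw [abs_le] at h2
  constructor <;> linarith

theorem abs_ptXtil_le (i : Fin 3) : |ptXtil i| ≤ 1 := by fin_cases i <;> simp [ptXtil]

theorem abs_ptYtil_le (i : Fin 3) : |ptYtil i| ≤ 1 := by fin_cases i <;> simp [ptYtil]

/-- The four local perturbations with disjoint supports can be realised by a family of
diffeomorphisms defined for all parameters: the translation vectors are cut off away from zero. -/
theorem exists_unfoldingFamily (C : SaddleFocusCycle r f) (hr : r ≠ 0) {ρ : ℝ}
    (hρ : ρ ∈ Ioo (0 : ℝ) 1) (hV : Pairwise fun i j => Disjoint (C.V ρ i) (C.V ρ j)) :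
    ∃ F : E8 → M ≃ₘ^r⟮𝓡 3, 𝓡 3⟯ M, IsUnfoldingFamily C F ∧
      ∃ ε > 0, ∀ υ : E8, (∀ i, υ i ∈ Icc (-ε) ε) → ∀ p, F υ p = C.Γ ρ (bump ρ) υ (f p) := by
  obtain ⟨hρ0, hρ1⟩ := hρ
  have hb := isBump_bump r hρ0
  obtain ⟨ε₁, hε₁, hX⟩ := exists_inverse_translationLike hr hb ptXtil
  obtain ⟨ε₂, hε₂, hY⟩ := exists_inverse_translationLike hr hb ptYtil
  set e := min ε₁ ε₂ with he
  have he0 : 0 < e := lt_min hε₁ hε₂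
  -- the cut-off keeps the translation vectors no longer than `e`, so that all perturbations are
  -- invertible
  let χ : ContDiffBump (0 : E8) := ⟨e / 2, e, by positivity, by linarith⟩
  let ν : E8 → E3 := fun υ => χ υ • !₂[υ 3, υ 4, υ 5]
  let κ : E8 → E3 := fun υ => χ υ • !₂[υ 0, υ 1, υ 2]
  have hcoord : ∀ i, ContDiff ℝ r fun υ : E8 => υ i := contDiff_euclidean.1 contDiff_id
  have hν : ContDiff ℝ r ν := χ.contDiff.smul (contDiff_euclidean.2 fun i => by
    fin_cases i
    · exact hcoord 3
    · exact hcoord 4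
    · exact hcoord 5)
  have hκ : ContDiff ℝ r κ := χ.contDiff.smul (contDiff_euclidean.2 fun i => by
    fin_cases i
    · exact hcoord 0
    · exact hcoord 1
    · exact hcoord 2)
  have hshort : ∀ (υ : E8) (v : E3), ‖v‖ ≤ ‖υ‖ → ‖χ υ • v‖ ≤ e := by
    intro υ v hv
    by_cases h : ‖υ‖ < e
    · rw [norm_smul, Real.norm_eq_abs, abs_of_nonneg χ.nonneg]
      calc χ υ * ‖v‖ ≤ 1 * ‖υ‖ := by gcongr; exact χ.le_one
        _ ≤ e := by linarith
    · rw [χ.zero_of_le_dist (by simpa using h), zero_smul, norm_zero]; exact he0.le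
  have hnν : ∀ υ, ‖ν υ‖ ≤ ε₁ := fun υ => (hshort υ _ (by
    refine (sq_le_sq₀ (norm_nonneg _) (norm_nonneg _)).1 ?_
    rw [EuclideanSpace.norm_sq_eq, EuclideanSpace.norm_sq_eq, Fin.sum_univ_three,
      Fin.sum_univ_eight]
    simp only [Matrix.cons_val_zero, Matrix.cons_val_one, Matrix.cons_val]
    linarith [sq_nonneg ‖υ 0‖, sq_nonneg ‖υ 1‖, sq_nonneg ‖υ 2‖, sq_nonneg ‖υ 6‖,
      sq_nonneg ‖υ 7‖])).trans (min_le_left _ _)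
  have hnκ : ∀ υ, ‖κ υ‖ ≤ ε₂ := fun υ => (hshort υ _ (by
    refine (sq_le_sq₀ (norm_nonneg _) (norm_nonneg _)).1 ?_
    rw [EuclideanSpace.norm_sq_eq, EuclideanSpace.norm_sq_eq, Fin.sum_univ_three,
      Fin.sum_univ_eight]
    simp only [Matrix.cons_val_zero, Matrix.cons_val_one, Matrix.cons_val]
    linarith [sq_nonneg ‖υ 3‖, sq_nonneg ‖υ 4‖, sq_nonneg ‖υ 5‖, sq_nonneg ‖υ 6‖,
      sq_nonneg ‖υ 7‖])).trans (min_le_right _ _)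
  -- the four perturbations in the charts
  let g₀ : E8 → E3 → E3 := fun υ w => rotX (υ 6 * bump ρ ‖w‖) w
  let g₁ : E8 → E3 → E3 := fun υ w => rotY (υ 7 * bump ρ ‖w‖) w
  let g₂ : E8 → E3 → E3 := fun υ w => translationLike (bump ρ) ptXtil (ν υ) w
  let g₃ : E8 → E3 → E3 := fun υ w => translationLike (bump ρ) ptYtil (κ υ) w
  have hbn : ContDiff ℝ r fun w : E3 => bump ρ ‖w‖ := contDiff_bump_norm ρ (n := r)
  have hg₀ : ContDiff ℝ r fun q : E8 × E3 => g₀ q.1 q.2 :=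
    contDiff_rotX (((hcoord 6).comp contDiff_fst).mul (hbn.comp contDiff_snd)) contDiff_snd
  have hg₁ : ContDiff ℝ r fun q : E8 × E3 => g₁ q.1 q.2 :=
    contDiff_rotY (((hcoord 7).comp contDiff_fst).mul (hbn.comp contDiff_snd)) contDiff_snd
  have hg₂ : ContDiff ℝ r fun q : E8 × E3 => g₂ q.1 q.2 :=
    contDiff_translationLike hb _ (hν.comp contDiff_fst) contDiff_snd
  have hg₃ : ContDiff ℝ r fun q : E8 × E3 => g₃ q.1 q.2 :=
    contDiff_translationLike hb _ (hκ.comp contDiff_fst) contDiff_snd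
  have hbz : ∀ w : E3, w ∉ Metric.closedBall (0 : E3) ρ → bump ρ ‖w‖ = 0 := fun w hw =>
    bump_eq_zero hρ0 (by rw [abs_norm]; simpa using (not_le.1 (by simpa using hw)).le)
  have hf₀ : ∀ υ, ∀ w ∉ Metric.closedBall (0 : E3) ρ, g₀ υ w = w := fun υ w hw => by
    simp only [g₀, hbz w hw, mul_zero]; exact linP_one_zero w
  have hf₁ : ∀ υ, ∀ w ∉ Metric.closedBall (0 : E3) ρ, g₁ υ w = w := fun υ w hw => by
    simp only [g₁, hbz w hw, mul_zero]; exact linQ_one_zero w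
  have hf₂ : ∀ υ, ∀ w ∉ box ptXtil ρ, g₂ υ w = w := fun υ w hw => translationLike_eq_self hb _ hw
  have hf₃ : ∀ υ, ∀ w ∉ box ptYtil ρ, g₃ υ w = w := fun υ w hw => translationLike_eq_self hb _ hw
  -- rotations preserve the norm on which their angle depends, so the opposite rate inverts them
  have hi₀ : ∀ υ w, g₀ (-υ) (g₀ υ w) = w := fun υ w => by
    simp only [g₀, norm_rotX]
    rw [rotX, rotX, linP_linP]
    simp [linP_one_zero]
  have hi₁ : ∀ υ w, g₁ (-υ) (g₁ υ w) = w := fun υ w => by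
    simp only [g₁, norm_rotY]
    rw [rotY, rotY, linQ_linQ]
    simp [linQ_one_zero]
  have hK₀ := isCompact_closedBall (0 : E3) ρ
  have hT₀ : Metric.closedBall (0 : E3) ρ ⊆ C.chP.target :=
    (closedBall_subset_cube (by linarith)).trans C.cube_P
  have hT₁ : Metric.closedBall (0 : E3) ρ ⊆ C.chQ.target :=
    (closedBall_subset_cube (by linarith)).trans C.cube_Q
  have hT₂ : box ptXtil ρ ⊆ C.chP.target :=
    (box_subset_cube abs_ptXtil_le (by linarith)).trans C.cube_P
  have hT₃ : box ptYtil ρ ⊆ C.chQ.target :=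
    (box_subset_cube abs_ptYtil_le (by linarith)).trans C.cube_Q
  have hslice : ∀ {g : E8 → E3 → E3}, ContDiff ℝ r (fun q : E8 × E3 => g q.1 q.2) →
      ∀ υ, ContDiff ℝ r (g υ) := fun h υ => h.comp (contDiff_const.prodMk contDiff_id)
  have hm₀ : ∀ υ, ∀ w ∈ Metric.closedBall (0 : E3) ρ, g₀ υ w ∈ Metric.closedBall (0 : E3) ρ :=
    fun υ w hw => by simpa [g₀, norm_rotX] using hw
  have hm₁ : ∀ υ, ∀ w ∈ Metric.closedBall (0 : E3) ρ, g₁ υ w ∈ Metric.closedBall (0 : E3) ρ :=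
    fun υ w hw => by simpa [g₁, norm_rotY] using hw
  have hmaps : ∀ {g g' : E3 → E3} {K : Set E3}, (∀ w ∉ K, g w = w) → Function.LeftInverse g' g →
      ∀ w ∈ K, g w ∈ K := by
    intro g g' K hfix hl w hw
    by_contra h
    have h1 := hl (g w)
    rw [hfix _ h, hl] at h1
    exact h (h1 ▸ hw)
  choose iX hiX hiXl hiXr using fun υ => hX (ν υ) (hnν υ)
  choose iY hiY hiYl hiYr using fun υ => hY (κ υ) (hnκ υ)
  have hm₂ : ∀ υ, ∀ w ∈ box ptXtil ρ, g₂ υ w ∈ box ptXtil ρ := fun υ => hmaps (hf₂ υ) (hiXl υ)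
  have hm₃ : ∀ υ, ∀ w ∈ box ptYtil ρ, g₃ υ w ∈ box ptYtil ρ := fun υ => hmaps (hf₃ υ) (hiYl υ)
  have hc₀ := contMDiff_chartExtend C.chP_mem hK₀ hT₀ hg₀ hf₀ hm₀
  have hc₁ := contMDiff_chartExtend C.chQ_mem hK₀ hT₁ hg₁ hf₁ hm₁
  have hc₂ := contMDiff_chartExtend C.chP_mem (isCompact_box _ _) hT₂ hg₂ hf₂ hm₂
  have hc₃ := contMDiff_chartExtend C.chQ_mem (isCompact_box _ _) hT₃ hg₃ hf₃ hm₃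
  choose D₀ hD₀ using fun υ => exists_diffeomorph_chartExtend C.chP_mem hK₀ hT₀
    (hslice hg₀ υ) (hslice hg₀ (-υ)) (hf₀ υ) (hi₀ υ) (fun w => by simpa using hi₀ (-υ) w)
  choose D₁ hD₁ using fun υ => exists_diffeomorph_chartExtend C.chQ_mem hK₀ hT₁
    (hslice hg₁ υ) (hslice hg₁ (-υ)) (hf₁ υ) (hi₁ υ) (fun w => by simpa using hi₁ (-υ) w)
  choose D₂ hD₂ using fun υ => exists_diffeomorph_chartExtend C.chP_mem (isCompact_box _ _) hT₂
    (hslice hg₂ υ) (hiX υ) (hf₂ υ) (hiXl υ) (hiXr υ)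
  choose D₃ hD₃ using fun υ => exists_diffeomorph_chartExtend C.chQ_mem (isCompact_box _ _) hT₃
    (hslice hg₃ υ) (hiY υ) (hf₃ υ) (hiYl υ) (hiYr υ)
  let F : E8 → M ≃ₘ^r⟮𝓡 3, 𝓡 3⟯ M := fun υ =>
    f.trans ((D₃ υ).trans ((D₂ υ).trans ((D₁ υ).trans (D₀ υ))))
  have hF : ∀ υ p, F υ p = chartExtend C.chP (Metric.closedBall 0 ρ) (g₀ υ)
      (chartExtend C.chQ (Metric.closedBall 0 ρ) (g₁ υ) (chartExtend C.chP (box ptXtil ρ) (g₂ υ)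
        (chartExtend C.chQ (box ptYtil ρ) (g₃ υ) (f p)))) := by
    intro υ p
    rw [← hD₀, ← hD₁, ← hD₂, ← hD₃]
    rfl
  -- for small parameters the cut-off is one; at most one of the factors moves a given point, the
  -- supports being disjoint and invariant
  have hlocal : ∀ υ : E8, (∀ i, υ i ∈ Icc (-(e / 8)) (e / 8)) → ∀ p,
      F υ p = C.Γ ρ (bump ρ) υ (f p) := by
    intro υ hυ p
    have hχ : χ υ = 1 := by
      refine χ.one_of_mem_closedBall ?_
      rw [mem_closedBall_zero_iff]
      refine (sq_le_sq₀ (norm_nonneg _) (by positivity)).1 ?_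
      rw [EuclideanSpace.norm_sq_eq]
      calc ∑ i, ‖υ i‖ ^ 2 ≤ ∑ _i : Fin 8, (e / 8) ^ 2 := by
            refine Finset.sum_le_sum fun i _ => ?_
            have : ‖υ i‖ ≤ e / 8 := abs_le.2 (hυ i)
            gcongr
        _ = 8 * (e / 8) ^ 2 := by simp
        _ ≤ (e / 2) ^ 2 := by nlinarith [sq_nonneg e]
    have hνυ : ν υ = !₂[υ 3, υ 4, υ 5] := by simp only [ν, hχ, one_smul]
    have hκυ : κ υ = !₂[υ 0, υ 1, υ 2] := by simp only [κ, hχ, one_smul]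
    rw [hF, Γ]
    generalize f p = q
    have hd : ∀ {i j : Fin 4}, i ≠ j → q ∈ C.V ρ i → ∀ x ∈ C.V ρ i, x ∉ C.V ρ j :=
      fun hij _ x hx hx' => disjoint_left.1 (hV hij) hx hx'
    have hself : ∀ i : Fin 4, q ∈ C.V ρ i → ∀ j, j ≠ i → q ∉ C.V ρ j :=
      fun i hi j hj => hd (Ne.symm hj) hi q hi
    split_ifs with h0 h1 h2 h3
    · rw [chartExtend_of_notMem (K := box ptYtil ρ) (hself 0 h0 3 (by decide)),
        chartExtend_of_notMem (K := box ptXtil ρ) (hself 0 h0 2 (by decide)),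
        chartExtend_of_notMem (ch := C.chQ) (hself 0 h0 1 (by decide))]
      exact if_pos h0
    · rw [chartExtend_of_notMem (K := box ptYtil ρ) (hself 1 h1 3 (by decide)),
        chartExtend_of_notMem (K := box ptXtil ρ) (hself 1 h1 2 (by decide)),
        chartExtend_of_notMem (ch := C.chP)
          (hd (i := 1) (j := 0) (by decide) h1 _ (chartExtend_mem hT₁ (hm₁ υ) h1))]
      exact if_pos h1
    · have hm := chartExtend_mem hT₂ (hm₂ υ) h2
      rw [chartExtend_of_notMem (K := box ptYtil ρ) (hself 2 h2 3 (by decide)),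
        chartExtend_of_notMem (ch := C.chQ) (hd (i := 2) (j := 1) (by decide) h2 _ hm),
        chartExtend_of_notMem (ch := C.chP) (hd (i := 2) (j := 0) (by decide) h2 _ hm), ← hνυ]
      exact if_pos h2
    · have hm := chartExtend_mem hT₃ (hm₃ υ) h3
      rw [chartExtend_of_notMem (K := box ptXtil ρ) (hd (i := 3) (j := 2) (by decide) h3 _ hm),
        chartExtend_of_notMem (ch := C.chQ) (hd (i := 3) (j := 1) (by decide) h3 _ hm),
        chartExtend_of_notMem (ch := C.chP) (hd (i := 3) (j := 0) (by decide) h3 _ hm), ← hκυ]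
      exact if_pos h3
    · rw [chartExtend_of_notMem (K := box ptYtil ρ) h3,
        chartExtend_of_notMem (K := box ptXtil ρ) h2,
        chartExtend_of_notMem (ch := C.chQ) h1, chartExtend_of_notMem (ch := C.chP) h0]
  refine ⟨F, ⟨?_, ?_, ρ, ⟨hρ0, hρ1⟩, bump ρ, hb, hV, e / 8, by positivity, hlocal⟩,
    e / 8, by positivity, hlocal⟩
  · ext p
    rw [hlocal 0 (fun i => by simp; positivity), Γ]
    generalize f p = q
    split_ifs with h0 h1 h2 h3
    · obtain ⟨w, hw, rfl⟩ := h0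
      rw [C.chP.right_inv (hT₀ hw)]
      simp [rotX, linP_one_zero]
    · obtain ⟨w, hw, rfl⟩ := h1
      rw [C.chQ.right_inv (hT₁ hw)]
      simp [rotY, linQ_one_zero]
    · obtain ⟨w, hw, rfl⟩ := h2
      rw [C.chP.right_inv (hT₂ hw)]
      congr 1
      ext i
      fin_cases i <;> simp [translationLike]
    · obtain ⟨w, hw, rfl⟩ := h3
      rw [C.chQ.right_inv (hT₃ hw)]
      congr 1
      ext i
      fin_cases i <;> simp [translationLike]
    · rfl
  · have hfst : ContMDiff (𝓘(ℝ, E8).prod (𝓡 3)) 𝓘(ℝ, E8) r (fun q : E8 × M => q.1) :=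
      contMDiff_fst
    have hfp : ContMDiff (𝓘(ℝ, E8).prod (𝓡 3)) (𝓡 3) r (fun q : E8 × M => f q.2) :=
      f.contMDiff.comp contMDiff_snd
    have := hc₀.comp (hfst.prodMk (hc₁.comp (hfst.prodMk (hc₂.comp (hfst.prodMk
      (hc₃.comp (hfst.prodMk hfp)))))))
    refine this.congr fun q => ?_
    rw [hF]
    rfl

end SaddleFocusCycle

end Unfolding

/-! ### The orbits of the cycle do not interfere -/

section Orbits

variable {M : Type*} [TopologicalSpace M]

theorem iterate_chart_symm {f : M → M} {ch : OpenPartialHomeomorph M E3} {per : ℕ} {L : E3 → E3}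
    (hL : ∀ w ∈ cube, L w ∈ cube → f^[per] (ch.symm w) = ch.symm (L w)) {w : E3} (n : ℕ)
    (hw : ∀ j ≤ n, L^[j] w ∈ cube) : f^[per * n] (ch.symm w) = ch.symm (L^[n] w) := by
  induction n with
  | zero => rfl
  | succ n ih =>
    rw [Nat.mul_succ, add_comm, Function.iterate_add_apply, ih fun j hj => hw j (by omega),
      hL _ (hw n (by omega)), Function.iterate_succ_apply']
    rw [← Function.iterate_succ_apply' (f := L)]
    exact hw _ le_rfl

theorem tendsto_iterate_chart_symm {f : M → M} {ch : OpenPartialHomeomorph M E3} {per : ℕ}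
    {L : E3 → E3} (hL : ∀ w ∈ cube, L w ∈ cube → f^[per] (ch.symm w) = ch.symm (L w))
    (h0 : (0 : E3) ∈ ch.target) {w : E3} (hw : ∀ j, L^[j] w ∈ cube)
    (hlim : Tendsto (fun j => L^[j] w) atTop (𝓝 0)) :
    Tendsto (fun j => f^[per * j] (ch.symm w)) atTop (𝓝 (ch.symm 0)) := by
  refine ((ch.continuousAt_symm h0).tendsto.comp hlim).congr fun j => ?_
  exact (iterate_chart_symm hL j fun i _ => hw i).symm

theorem mem_cube_of_norm_le {w : E3} {c : ℝ} (hc : c < 10) (hw : ‖w‖ ≤ c) : w ∈ cube :=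
  SaddleFocusCycle.closedBall_subset_cube hc (mem_closedBall_zero_iff.2 hw)

theorem isOpen_cube : IsOpen cube := by
  have : cube = ⋂ i, {w : E3 | w i ∈ Ioo (-10 : ℝ) 10} := by
    ext w; simp [cube]
  rw [this]
  exact isOpen_iInter_of_finite fun i =>
    isOpen_Ioo.preimage (contDiff_coord (n := 0) i).continuous

theorem zero_mem_cube : (0 : E3) ∈ cube := fun i => by simp

theorem continuous_linP (a s φ : ℝ) : Continuous (linP a s φ) := by
  have h := fun i => (contDiff_coord (n := 0) i).continuous
  refine (PiLp.continuous_toLp 2 _).comp (continuous_pi fun i => ?_)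
  have h0 := h 0
  have h1 := h 1
  have h2 := h 2
  fin_cases i <;> simp <;> fun_prop

theorem continuous_linQ (a s φ : ℝ) : Continuous (linQ a s φ) := by
  have h := fun i => (contDiff_coord (n := 0) i).continuous
  refine (PiLp.continuous_toLp 2 _).comp (continuous_pi fun i => ?_)
  have h0 := h 0
  have h1 := h 1
  have h2 := h 2
  fin_cases i <;> simp <;> fun_prop

theorem linP_zero (a s φ : ℝ) : linP a s φ 0 = 0 := by
  ext i; fin_cases i <;> simp [linP]

theorem linQ_zero (a s φ : ℝ) : linQ a s φ 0 = 0 := by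
  ext i; fin_cases i <;> simp [linQ]

namespace SaddleFocusCycle

variable [ChartedSpace E3 M] {r : ℕ} {f : M ≃ₘ^r⟮𝓡 3, 𝓡 3⟯ M} (C : SaddleFocusCycle r f)

theorem chP_symm_zero : C.chP.symm 0 = C.P := by rw [← C.chP_P, C.chP.left_inv C.P_mem]

theorem chQ_symm_zero : C.chQ.symm 0 = C.Q := by rw [← C.chQ_Q, C.chQ.left_inv C.Q_mem]

theorem iterate_perP : f^[C.perP] C.P = C.P := by
  rw [← C.minimalPeriod_P]; exact Function.iterate_minimalPeriod

theorem iterate_perQ : f^[C.perQ] C.Q = C.Q := by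
  rw [← C.minimalPeriod_Q]; exact Function.iterate_minimalPeriod

theorem contMDiff_iterate (n : ℕ) : ContMDiff (𝓡 3) (𝓡 3) r (f^[n]) := f.contMDiff.iterate n

theorem continuous_iterate (n : ℕ) : Continuous (f^[n]) := f.continuous.iterate n

/-- The saddles lie on different orbits: in charts a contracted real eigenvector of the return map
at `P` would be mapped to an eigenvector of the return map at `Q` for the same eigenvalue, but the
latter has a single real eigenvalue, which is expanding. -/
theorem iterate_P_ne_Q (hr : r ≠ 0) (i : ℕ) : f^[i] C.P ≠ C.Q := by
  intro h
  have hper : C.perP = C.perQ := by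
    rw [← C.minimalPeriod_P, ← C.minimalPeriod_Q, ← h]
    refine (Function.minimalPeriod_apply_iterate ?_ i).symm
    exact ⟨C.perP, C.perP_pos, C.iterate_perP⟩
  have hsymm : ∀ p, f.symm^[i] (f^[i] p) = p := fun p =>
    Function.LeftInverse.iterate (fun x => f.symm_apply_apply x) i p
  have h0P : (0 : E3) ∈ C.chP.target := C.cube_P zero_mem_cube
  have h0Q : (0 : E3) ∈ C.chQ.target := C.cube_Q zero_mem_cube
  -- the iterate that maps `P` to `Q`, in charts, and its inverse
  set g : E3 → E3 := fun w => C.chQ (f^[i] (C.chP.symm w)) with hg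
  set g' : E3 → E3 := fun w => C.chP (f.symm^[i] (C.chQ.symm w)) with hg'
  have hg0 : g 0 = 0 := by simp only [hg, C.chP_symm_zero, h, C.chQ_Q]
  have hfsP : f.symm^[i] C.Q = C.P := by rw [← h, hsymm]
  have hgd : DifferentiableAt ℝ g 0 := by
    have h1 : ContMDiffAt (𝓡 3) (𝓡 3) r g 0 := by
      refine ContMDiffAt.comp 0 (contMDiffAt_of_mem_maximalAtlas C.chQ_mem ?_)
        (((contMDiff_iterate i).contMDiffAt).comp 0
          (contMDiffAt_symm_of_mem_maximalAtlas C.chP_mem h0P))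
      simpa only [Function.comp_apply, C.chP_symm_zero, h] using C.Q_mem
    exact (contMDiffAt_iff_contDiffAt.1 h1).differentiableAt (by exact_mod_cast hr)
  have hgd' : DifferentiableAt ℝ g' 0 := by
    have h1 : ContMDiffAt (𝓡 3) (𝓡 3) r g' 0 := by
      refine ContMDiffAt.comp 0 (contMDiffAt_of_mem_maximalAtlas C.chP_mem ?_)
        (((contMDiff_iterate (f := f.symm) i).contMDiffAt).comp 0
          (contMDiffAt_symm_of_mem_maximalAtlas C.chQ_mem h0Q))
      simpa only [Function.comp_apply, C.chQ_symm_zero, hfsP] using C.P_mem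
    exact (contMDiffAt_iff_contDiffAt.1 h1).differentiableAt (by exact_mod_cast hr)
  have hcP := C.chP.continuousAt_symm h0P
  have hcI : ContinuousAt (fun w => f^[i] (C.chP.symm w)) 0 :=
    (continuous_iterate i).continuousAt.comp hcP
  have hsrc : ∀ᶠ w in 𝓝 (0 : E3), f^[i] (C.chP.symm w) ∈ C.chQ.source := by
    refine hcI.eventually (C.chQ.open_source.mem_nhds ?_)
    simp only [C.chP_symm_zero, h]; exact C.Q_mem
  have hinv : ∀ᶠ w in 𝓝 (0 : E3), g' (g w) = w := by
    filter_upwards [hsrc, C.chP.open_target.mem_nhds h0P] with w h1 h2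
    simp only [hg, hg', C.chQ.left_inv h1, hsymm, C.chP.right_inv h2]
  have hcube := isOpen_cube.mem_nhds zero_mem_cube
  -- since the periods agree, `g` conjugates the normal forms near the origin
  have hconj : ∀ᶠ w in 𝓝 (0 : E3), g (linP C.lamP C.sigP C.phiP w) =
      linQ C.lamQ C.sigQ C.phiQ (g w) := by
    have hA : ∀ᶠ w in 𝓝 (0 : E3), linP C.lamP C.sigP C.phiP w ∈ cube :=
      (continuous_linP _ _ _).continuousAt.eventually (by rw [linP_zero]; exact hcube)
    have hgc : ∀ᶠ w in 𝓝 (0 : E3), g w ∈ cube :=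
      hgd.continuousAt.eventually (by rw [hg0]; exact hcube)
    have hB : ∀ᶠ w in 𝓝 (0 : E3), linQ C.lamQ C.sigQ C.phiQ (g w) ∈ cube :=
      ((continuous_linQ _ _ _).continuousAt.comp hgd.continuousAt).eventually (by
        simp only [Function.comp_apply]; rw [hg0, linQ_zero]; exact hcube)
    filter_upwards [hsrc, hA, hgc, hB, hcube] with w h1 h2 h3 h4 h5
    have e1 := C.linear_P w h5 h2
    have e2 := C.linear_Q (g w) h3 h4
    simp only [hg] at e2 ⊢
    rw [C.chQ.left_inv h1, ← hper, ← Function.iterate_add_apply, add_comm,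
      Function.iterate_add_apply, e1] at e2
    rw [e2, C.chQ.right_inv (C.cube_Q h4)]
  -- the image of the eigenvector along the first axis
  set e : E3 := !₂[1, 0, 0] with he
  set v := fderiv ℝ g 0 e with hv
  have hline : ∀ c : ℝ, HasDerivAt (fun t : ℝ => g (t • c • e)) (c • v) 0 := by
    intro c
    have h1 : HasDerivAt (fun t : ℝ => t • c • e) (c • e) 0 := by
      simpa using (hasDerivAt_id (0 : ℝ)).smul_const (c • e)
    have h2 : HasFDerivAt g (fderiv ℝ g 0) ((0 : ℝ) • c • e) := by
      rw [zero_smul]; exact hgd.hasFDerivAt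
    exact (h2.comp_hasDerivAt (0 : ℝ) h1).congr_deriv (map_smul (fderiv ℝ g 0) c e)
  have htend : Tendsto (fun t : ℝ => t • e) (𝓝 0) (𝓝 0) := by
    have : Continuous fun t : ℝ => t • e := by fun_prop
    simpa using this.tendsto 0
  -- the derivative of `g` is injective, `g'` being a differentiable left inverse
  have hv0 : v ≠ 0 := by
    intro hv0
    have h1 : HasDerivAt (fun t : ℝ => g' (g (t • e))) (fderiv ℝ g' 0 v) 0 := by
      have h2 : HasFDerivAt g' (fderiv ℝ g' 0) (g ((0 : ℝ) • e)) := by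
        rw [zero_smul, hg0]; exact hgd'.hasFDerivAt
      have h3 := hline 1
      simp only [one_smul] at h3
      exact h2.comp_hasDerivAt (0 : ℝ) h3
    have h4 : HasDerivAt (fun t : ℝ => t • e) e 0 := by
      simpa using (hasDerivAt_id (0 : ℝ)).smul_const e
    have hev : (fun t : ℝ => g' (g (t • e))) =ᶠ[𝓝 0] fun t => t • e := htend.eventually hinv
    have h5 := (h4.congr_of_eventuallyEq hev).unique h1
    rw [hv0, map_zero] at h5
    have := congrArg (fun w : E3 => w 0) h5
    simp [he] at this
  have hcoord : ∀ (c : ℝ) (j : Fin 3),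
      HasDerivAt (fun t : ℝ => g (t • c • e) j) (c * v j) 0 := by
    intro c j
    exact ((EuclideanSpace.proj (𝕜 := ℝ) j).hasFDerivAt.comp_hasDerivAt (0 : ℝ)
      (hline c)).congr_deriv (by simp)
  have heig : ∀ t : ℝ, linP C.lamP C.sigP C.phiP (t • e) = t • C.lamP • e := by
    intro t; ext j; fin_cases j <;> simp [linP, he, mul_comm]
  have hconj' : ∀ᶠ t in 𝓝 (0 : ℝ), g (t • C.lamP • e) = linQ C.lamQ C.sigQ C.phiQ (g (t • e)) := by
    filter_upwards [htend.eventually hconj] with t ht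
    rw [← ht, heig]
  have hc1 : ∀ j, HasDerivAt (fun t : ℝ => g (t • e) j) (v j) 0 := fun j => by
    simpa using hcoord 1 j
  have e1 : C.lamP * v 1 = C.sigQ * v 1 := by
    refine (hcoord C.lamP 1).unique (((hc1 1).const_mul C.sigQ).congr_of_eventuallyEq ?_)
    filter_upwards [hconj'] with t ht
    rw [ht]; simp [linQ]
  have e0 : C.lamP * v 0 = C.lamQ * (Real.cos (2 * Real.pi * C.phiQ) * v 0 -
      Real.sin (2 * Real.pi * C.phiQ) * v 2) := by
    refine (hcoord C.lamP 0).unique (((((hc1 0).const_mul _).sub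
      ((hc1 2).const_mul _)).const_mul C.lamQ).congr_of_eventuallyEq ?_)
    filter_upwards [hconj'] with t ht
    rw [ht]; simp [linQ]
  have e2 : C.lamP * v 2 = C.lamQ * (Real.sin (2 * Real.pi * C.phiQ) * v 0 +
      Real.cos (2 * Real.pi * C.phiQ) * v 2) := by
    refine (hcoord C.lamP 2).unique (((((hc1 0).const_mul _).add
      ((hc1 2).const_mul _)).const_mul C.lamQ).congr_of_eventuallyEq ?_)
    filter_upwards [hconj'] with t ht
    rw [ht]; simp [linQ]
  have hv1 : v 1 = 0 := by
    by_contra h1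
    have := mul_right_cancel₀ h1 e1
    have h2 := C.lamP_lt
    rw [this] at h2
    exact absurd C.sigQ_gt (not_lt.2 h2.le)
  -- the rotation at `Q` has no real eigenvalue, since the sine of its angle does not vanish
  have hsum : v 0 ^ 2 + v 2 ^ 2 = 0 := by
    have h1 : C.lamQ * Real.sin (2 * Real.pi * C.phiQ) * (v 0 ^ 2 + v 2 ^ 2) = 0 := by
      linear_combination v 2 * e0 - v 0 * e2
    exact (mul_eq_zero.1 h1).resolve_left (mul_ne_zero (abs_pos.1 C.lamQ_ne) C.nonreal_Q)
  have hv00 : v 0 = 0 := by nlinarith [sq_nonneg (v 0), sq_nonneg (v 2)]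
  have hv02 : v 2 = 0 := by nlinarith [sq_nonneg (v 0), sq_nonneg (v 2)]
  refine hv0 ?_
  ext j
  fin_cases j
  · exact hv00
  · exact hv1
  · exact hv02

end SaddleFocusCycle

end Orbits

/-- If an orbit through `x` contains a periodic point, then `x` is periodic. -/
theorem periodic_of_iterate_eq {M : Type*} {g : M → M} (hg : Function.Injective g) {x z : M}
    {i n : ℕ} (h : g^[i] x = z) (hz : g^[n] z = z) : g^[n] x = x := by
  refine hg.iterate i ?_
  rw [← Function.iterate_add_apply, add_comm, Function.iterate_add_apply, h, hz]

theorem iterate_eq_of_periodic {M : Type*} {g : M → M} {x z : M} {i n : ℕ}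
    (h : g^[i] x = z) (hx : g^[n] x = x) : g^[n] z = z := by
  rw [← h, ← Function.iterate_add_apply, add_comm, Function.iterate_add_apply, hx]

section Orbits

variable {M : Type*} [TopologicalSpace M]

namespace SaddleFocusCycle

variable [ChartedSpace E3 M] {r : ℕ} {f : M ≃ₘ^r⟮𝓡 3, 𝓡 3⟯ M} (C : SaddleFocusCycle r f)

/-- The first point of the orbit of the heteroclinic point `X` in the domain of the chart at `P`. -/
def heteroPoint : M := C.chP.symm ptXtil

/-- The centres of the supports of the four perturbations. -/
def center : Fin 4 → M := ![C.P, C.Q, C.heteroPoint, C.tangencyPoint]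

theorem iterate_N₁ : f^[C.N₁] (C.chQ.symm ptX) = C.heteroPoint := by
  have := C.transition_QP.self_of_nhds
  simp only [C.Htil_zero, PiLp.zero_apply, mul_zero, add_zero] at this
  exact this

theorem iterate_N₂ : f^[C.N₂] (C.chP.symm ptY) = C.tangencyPoint := by
  have := C.transition_PQ.self_of_nhds
  simp only [C.H_zero, PiLp.zero_apply, mul_zero, add_zero, zero_pow two_ne_zero] at this
  exact this

theorem norm_sq_eq_three (w : E3) : ‖w‖ ^ 2 = w 0 ^ 2 + w 1 ^ 2 + w 2 ^ 2 := by
  rw [EuclideanSpace.norm_sq_eq, Fin.sum_univ_three]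
  simp only [Real.norm_eq_abs, sq_abs]

theorem norm_iterate_linP_ptXtil (j : ℕ) :
    ‖(linP C.lamP C.sigP C.phiP)^[j] ptXtil‖ = |C.lamP| ^ j := by
  refine (sq_eq_sq₀ (norm_nonneg _) (by positivity)).1 ?_
  rw [linP_iterate, norm_linP_sq]
  simp [ptXtil, pow_right_comm _ j 2]

theorem norm_iterate_linQ_ptYtil (j : ℕ) :
    ‖(linQ C.lamQ C.sigQ C.phiQ)^[j] ptYtil‖ = |C.lamQ| ^ j * √2 := by
  refine (sq_eq_sq₀ (norm_nonneg _) (by positivity)).1 ?_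
  rw [linQ_iterate, norm_linQ_sq, mul_pow, Real.sq_sqrt (by norm_num)]
  simp only [ptYtil, pow_right_comm _ j 2, sq_abs, PiLp.toLp_apply, Matrix.cons_val_zero,
    Matrix.cons_val_one, Matrix.cons_val]
  norm_num

theorem tendsto_iterate_linP_ptXtil :
    Tendsto (fun j => (linP C.lamP C.sigP C.phiP)^[j] ptXtil) atTop (𝓝 0) := by
  rw [tendsto_zero_iff_norm_tendsto_zero]
  simp only [norm_iterate_linP_ptXtil]
  exact tendsto_pow_atTop_nhds_zero_of_lt_one (abs_nonneg _) C.lamP_lt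

theorem tendsto_iterate_linQ_ptYtil :
    Tendsto (fun j => (linQ C.lamQ C.sigQ C.phiQ)^[j] ptYtil) atTop (𝓝 0) := by
  rw [tendsto_zero_iff_norm_tendsto_zero]
  simp only [norm_iterate_linQ_ptYtil]
  simpa using (tendsto_pow_atTop_nhds_zero_of_lt_one (abs_nonneg _) C.lamQ_lt).mul_const (√2)

theorem iterate_linP_ptXtil_mem_cube (j : ℕ) : (linP C.lamP C.sigP C.phiP)^[j] ptXtil ∈ cube :=
  mem_cube_of_norm_le (c := 1) (by norm_num) (by
    rw [norm_iterate_linP_ptXtil]; exact pow_le_one₀ (abs_nonneg _) C.lamP_lt.le)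

theorem iterate_linQ_ptYtil_mem_cube (j : ℕ) : (linQ C.lamQ C.sigQ C.phiQ)^[j] ptYtil ∈ cube :=
  mem_cube_of_norm_le (c := 1 * 2) (by norm_num) (by
    rw [norm_iterate_linQ_ptYtil]
    gcongr
    · exact pow_le_one₀ (abs_nonneg _) C.lamQ_lt.le
    · rw [Real.sqrt_le_left (by norm_num)]; norm_num)

theorem ptXtil_mem_cube : ptXtil ∈ cube := fun i => by
  fin_cases i <;> simp [ptXtil]; norm_num

theorem ptYtil_mem_cube : ptYtil ∈ cube := fun i => by
  fin_cases i <;> simp [ptYtil] <;> norm_num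

theorem ptX_mem_cube : ptX ∈ cube := fun i => by fin_cases i <;> simp [ptX]; norm_num

theorem ptY_mem_cube : ptY ∈ cube := fun i => by fin_cases i <;> simp [ptY] <;> norm_num

theorem tendsto_iterate_heteroPoint :
    Tendsto (fun j => f^[C.perP * j] C.heteroPoint) atTop (𝓝 C.P) := by
  rw [← C.chP_symm_zero]
  exact tendsto_iterate_chart_symm C.linear_P (C.cube_P zero_mem_cube)
    C.iterate_linP_ptXtil_mem_cube C.tendsto_iterate_linP_ptXtil

theorem tendsto_iterate_tangencyPoint :
    Tendsto (fun j => f^[C.perQ * j] C.tangencyPoint) atTop (𝓝 C.Q) := by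
  rw [← C.chQ_symm_zero]
  exact tendsto_iterate_chart_symm C.linear_Q (C.cube_Q zero_mem_cube)
    C.iterate_linQ_ptYtil_mem_cube C.tendsto_iterate_linQ_ptYtil

theorem heteroPoint_ne_P : C.heteroPoint ≠ C.P := by
  intro h
  rw [← C.chP_symm_zero] at h
  have := C.chP.symm.injOn (C.cube_P ptXtil_mem_cube) (C.cube_P zero_mem_cube) h
  simpa [ptXtil] using congrArg (fun w : E3 => w 0) this

theorem tangencyPoint_ne_Q : C.tangencyPoint ≠ C.Q := by
  intro h
  rw [← C.chQ_symm_zero] at h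
  have := C.chQ.symm.injOn (C.cube_Q ptYtil_mem_cube) (C.cube_Q zero_mem_cube) h
  simpa [ptYtil] using congrArg (fun w : E3 => w 0) this

theorem isPeriodicPt_Q (j : ℕ) : f^[C.perQ * j] C.Q = C.Q :=
  Function.IsPeriodicPt.mul_const (f := f) (m := C.perQ) C.iterate_perQ j

variable [T2Space M]

/-- A point whose orbit tends to a point other than itself is not periodic. -/
theorem iterate_ne_self_of_tendsto {x y : M} {per : ℕ}
    (hlim : Tendsto (fun j => f^[per * j] x) atTop (𝓝 y)) (hxy : x ≠ y) {i : ℕ} (hi : 0 < i) :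
    f^[i] x ≠ x := by
  intro h
  have h1 : Tendsto (fun j => f^[per * (i * j)] x) atTop (𝓝 y) :=
    hlim.comp (tendsto_id.const_mul_atTop' hi)
  have h2 : ∀ j, f^[per * (i * j)] x = x := fun j => by
    rw [show per * (i * j) = i * (per * j) by ring]
    exact Function.IsPeriodicPt.mul_const (f := f) (m := i) h _
  simp only [h2] at h1
  exact hxy (tendsto_nhds_unique tendsto_const_nhds h1)

theorem iterate_heteroPoint_ne_self {i : ℕ} (hi : 0 < i) : f^[i] C.heteroPoint ≠ C.heteroPoint :=
  iterate_ne_self_of_tendsto C.tendsto_iterate_heteroPoint C.heteroPoint_ne_P hi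

theorem iterate_tangencyPoint_ne_self {i : ℕ} (hi : 0 < i) :
    f^[i] C.tangencyPoint ≠ C.tangencyPoint :=
  iterate_ne_self_of_tendsto C.tendsto_iterate_tangencyPoint C.tangencyPoint_ne_Q hi

omit [T2Space M] in
theorem iterate_Q_ne_P (hr : r ≠ 0) (i : ℕ) : f^[i] C.Q ≠ C.P := by
  intro h
  refine C.iterate_P_ne_Q hr (C.perQ * i - i) ?_
  rw [← h, ← Function.iterate_add_apply, Nat.sub_add_cancel (Nat.le_mul_of_pos_left _ C.perQ_pos)]
  exact C.isPeriodicPt_Q i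

theorem iterate_heteroPoint_ne_tangencyPoint (hr : r ≠ 0) (i : ℕ) :
    f^[i] C.heteroPoint ≠ C.tangencyPoint := by
  intro h
  have h1 : Tendsto (fun j => f^[i] (f^[C.perP * (C.perQ * j)] C.heteroPoint)) atTop
      (𝓝 (f^[i] C.P)) :=
    ((continuous_iterate i).tendsto _).comp
      (C.tendsto_iterate_heteroPoint.comp (tendsto_id.const_mul_atTop' C.perQ_pos))
  have h2 : Tendsto (fun j => f^[C.perQ * (C.perP * j)] C.tangencyPoint) atTop (𝓝 C.Q) :=
    C.tendsto_iterate_tangencyPoint.comp (tendsto_id.const_mul_atTop' C.perP_pos)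
  refine C.iterate_P_ne_Q hr i (tendsto_nhds_unique (h1.congr fun j => ?_) h2)
  rw [← h, ← Function.iterate_add_apply, ← Function.iterate_add_apply,
    show i + C.perP * (C.perQ * j) = C.perQ * (C.perP * j) + i by ring]

theorem iterate_tangencyPoint_ne_heteroPoint (hr : r ≠ 0) (i : ℕ) :
    f^[i] C.tangencyPoint ≠ C.heteroPoint := by
  intro h
  have h1 : Tendsto (fun j => f^[i] (f^[C.perQ * (C.perP * j)] C.tangencyPoint)) atTop
      (𝓝 (f^[i] C.Q)) :=
    ((continuous_iterate i).tendsto _).comp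
      (C.tendsto_iterate_tangencyPoint.comp (tendsto_id.const_mul_atTop' C.perP_pos))
  have h2 : Tendsto (fun j => f^[C.perP * (C.perQ * j)] C.heteroPoint) atTop (𝓝 C.P) :=
    C.tendsto_iterate_heteroPoint.comp (tendsto_id.const_mul_atTop' C.perQ_pos)
  refine C.iterate_Q_ne_P hr i (tendsto_nhds_unique (h1.congr fun j => ?_) h2)
  rw [← h, ← Function.iterate_add_apply, ← Function.iterate_add_apply,
    show i + C.perQ * (C.perP * j) = C.perP * (C.perQ * j) + i by ring]

theorem iterate_heteroPoint_ne_center (hr : r ≠ 0) {i : ℕ} (hi : 0 < i) (j : Fin 4) :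
    f^[i] C.heteroPoint ≠ C.center j := by
  fin_cases j
  · exact fun h => C.iterate_heteroPoint_ne_self C.perP_pos
      (periodic_of_iterate_eq f.injective h C.iterate_perP)
  · exact fun h => C.iterate_heteroPoint_ne_self C.perQ_pos
      (periodic_of_iterate_eq f.injective h C.iterate_perQ)
  · exact C.iterate_heteroPoint_ne_self hi
  · exact C.iterate_heteroPoint_ne_tangencyPoint hr i

theorem iterate_tangencyPoint_ne_center (hr : r ≠ 0) {i : ℕ} (hi : 0 < i) (j : Fin 4) :
    f^[i] C.tangencyPoint ≠ C.center j := by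
  fin_cases j
  · exact fun h => C.iterate_tangencyPoint_ne_self C.perP_pos
      (periodic_of_iterate_eq f.injective h C.iterate_perP)
  · exact fun h => C.iterate_tangencyPoint_ne_self C.perQ_pos
      (periodic_of_iterate_eq f.injective h C.iterate_perQ)
  · exact C.iterate_tangencyPoint_ne_heteroPoint hr i
  · exact C.iterate_tangencyPoint_ne_self hi

theorem ne_center_of_iterate_eq_heteroPoint (hr : r ≠ 0) {x : M} {i : ℕ} (hi : 0 < i)
    (hx : f^[i] x = C.heteroPoint) (j : Fin 4) : x ≠ C.center j := by
  fin_cases j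
  · rintro rfl
    exact C.iterate_heteroPoint_ne_self C.perP_pos (iterate_eq_of_periodic hx C.iterate_perP)
  · rintro rfl
    exact C.iterate_heteroPoint_ne_self C.perQ_pos (iterate_eq_of_periodic hx C.iterate_perQ)
  · rintro rfl
    exact C.iterate_heteroPoint_ne_self hi hx
  · rintro rfl
    exact C.iterate_tangencyPoint_ne_heteroPoint hr i hx

theorem ne_center_of_iterate_eq_tangencyPoint (hr : r ≠ 0) {x : M} {i : ℕ} (hi : 0 < i)
    (hx : f^[i] x = C.tangencyPoint) (j : Fin 4) : x ≠ C.center j := by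
  fin_cases j
  · rintro rfl
    exact C.iterate_tangencyPoint_ne_self C.perP_pos (iterate_eq_of_periodic hx C.iterate_perP)
  · rintro rfl
    exact C.iterate_tangencyPoint_ne_self C.perQ_pos (iterate_eq_of_periodic hx C.iterate_perQ)
  · rintro rfl
    exact C.iterate_heteroPoint_ne_tangencyPoint hr i hx
  · rintro rfl
    exact C.iterate_tangencyPoint_ne_self hi hx

theorem iterate_P_ne_center (hr : r ≠ 0) (i : ℕ) {j : Fin 4} (hj : j ≠ 0) :
    f^[i] C.P ≠ C.center j := by
  have hper : f^[C.perP] (f^[i] C.P) = f^[i] C.P := by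
    rw [← Function.iterate_add_apply, add_comm, Function.iterate_add_apply, C.iterate_perP]
  fin_cases j
  · exact absurd rfl hj
  · exact C.iterate_P_ne_Q hr i
  · exact fun h => C.iterate_heteroPoint_ne_self C.perP_pos
      (by rwa [show f^[i] C.P = C.heteroPoint from h] at hper)
  · exact fun h => C.iterate_tangencyPoint_ne_self C.perP_pos
      (by rwa [show f^[i] C.P = C.tangencyPoint from h] at hper)

theorem iterate_Q_ne_center (hr : r ≠ 0) (i : ℕ) {j : Fin 4} (hj : j ≠ 1) :
    f^[i] C.Q ≠ C.center j := by
  have hper : f^[C.perQ] (f^[i] C.Q) = f^[i] C.Q := by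
    rw [← Function.iterate_add_apply, add_comm, Function.iterate_add_apply, C.iterate_perQ]
  fin_cases j
  · exact C.iterate_Q_ne_P hr i
  · exact absurd rfl hj
  · exact fun h => C.iterate_heteroPoint_ne_self C.perQ_pos
      (by rwa [show f^[i] C.Q = C.heteroPoint from h] at hper)
  · exact fun h => C.iterate_tangencyPoint_ne_self C.perQ_pos
      (by rwa [show f^[i] C.Q = C.tangencyPoint from h] at hper)

omit [T2Space M] in
theorem iterate_P_ne_P {i : ℕ} (hi : 0 < i) (hi' : i < C.perP) : f^[i] C.P ≠ C.P := by
  intro h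
  have := Function.IsPeriodicPt.minimalPeriod_le hi h
  rw [C.minimalPeriod_P] at this
  omega

omit [T2Space M] in
theorem iterate_Q_ne_Q {i : ℕ} (hi : 0 < i) (hi' : i < C.perQ) : f^[i] C.Q ≠ C.Q := by
  intro h
  have := Function.IsPeriodicPt.minimalPeriod_le hi h
  rw [C.minimalPeriod_Q] at this
  omega

theorem center_injective (hr : r ≠ 0) : Function.Injective C.center := by
  have h0 := fun j hj => C.iterate_P_ne_center hr 0 (j := j) hj
  have h1 := fun j hj => C.iterate_Q_ne_center hr 0 (j := j) hj
  have h2 := C.iterate_heteroPoint_ne_tangencyPoint hr 0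
  simp only [Function.iterate_zero, id_eq] at h0 h1 h2
  intro i j hij
  by_contra hne
  fin_cases i <;> fin_cases j <;> first
    | exact hne rfl
    | exact h0 _ (by decide) hij
    | exact h0 _ (by decide) hij.symm
    | exact h1 _ (by decide) hij
    | exact h1 _ (by decide) hij.symm
    | exact h2 hij
    | exact h2 hij.symm

end SaddleFocusCycle

end Orbits

/-! ### Passages of perturbed orbits near the saddles -/

section Passage

variable {M : Type*} [TopologicalSpace M]

/-- The return map of `f` in the chart `ch` is linear at `w`, and the orbit of `w` up to its return
meets none of the sets `V i`, except possibly `V i₀` at the time of the return. -/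
def IsolatedStep (V : Fin 4 → Set M) (f : M → M) (ch : OpenPartialHomeomorph M E3) (per : ℕ)
    (L : E3 → E3) (i₀ : Fin 4) (w : E3) : Prop :=
  w ∈ cube ∧ L w ∈ cube ∧ (∀ s, 0 < s → s < per → ∀ i, f^[s] (ch.symm w) ∉ V i) ∧
    ∀ i ≠ i₀, ch.symm (L w) ∉ V i

theorem iterate_eq_of_forall_eq {M : Type*} {F f : M → M} {n : ℕ} {x : M}
    (h : ∀ s < n, F (f^[s] x) = f (f^[s] x)) : F^[n] x = f^[n] x := by
  induction n with
  | zero => rfl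
  | succ n ih =>
    rw [Function.iterate_succ_apply', ih fun s hs => h s (by omega), h n (by omega),
      Function.iterate_succ_apply']

/-- Passage near a saddle. Each return of the perturbed map is the linear map `L` followed by a
rotation whose angle depends on the norm only. Rotations commute with `L` and preserve norms, so the
rotations add up. The first `J` and the last `J` returns are not perturbed and stay close to the
orbits of reference; in between the orbit stays in the ball of radius `r₀`. -/
theorem iterate_passage {F : M → M} {ch : OpenPartialHomeomorph M E3} {per : ℕ} {L L' : E3 → E3}
    {R : ℝ → E3 → E3} {good : E3 → Prop} {t ρ r₀ : ℝ} {J n : ℕ} (hρ : 0 < ρ)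
    (hRL : ∀ s w, L (R s w) = R s (L w)) (hR : ∀ s s' w, R s (R s' w) = R (s + s') w)
    (hR0 : ∀ w, R 0 w = w) (hRn : ∀ s w, ‖R s w‖ = ‖w‖) (hL' : ∀ w, L' (L w) = w)
    (hstep : ∀ w, good w → F^[per] (ch.symm w) = ch.symm (R (t * bump ρ ‖L w‖) (L w)))
    (hball : ∀ w, ‖w‖ < r₀ → good w) {w e : E3}
    (hin : ∀ j < J, good (L^[j] w) ∧ ρ ≤ ‖L^[j + 1] w‖)
    (hout : ∀ j < J, good (L'^[j + 1] e) ∧ ρ ≤ ‖L'^[j] e‖)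
    (hmid : ∀ j, J ≤ j → j + J ≤ n → ‖L^[j] w‖ < r₀)
    (he : e = R (t * ∑ i ∈ Finset.range n, bump ρ ‖L^[i + 1] w‖) (L^[n] w)) :
    F^[per * n] (ch.symm w) = ch.symm e := by
  have hRLn : ∀ (k : ℕ) s u, L^[k] (R s u) = R s (L^[k] u) := by
    intro k s u
    induction k with
    | zero => rfl
    | succ k ih => rw [Function.iterate_succ_apply', ih, hRL, Function.iterate_succ_apply']
  have hL'n : ∀ (k : ℕ) s u, L'^[k] (R s (L^[k] u)) = R s u := by
    intro k s u
    rw [← hRLn]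
    exact Function.LeftInverse.iterate (f := L) (g := L') hL' k _
  set S : ℕ → ℝ := fun j => ∑ i ∈ Finset.range j, bump ρ ‖L^[i + 1] w‖ with hS
  have hbz : ∀ u : E3, ρ ≤ ‖u‖ → bump ρ ‖u‖ = 0 := fun u hu =>
    bump_eq_zero hρ (by rwa [abs_norm])
  -- the passage seen from its end: the backward orbit of `e` carries the total rotation
  have hback : ∀ j ≤ n, L'^[n - j] e = R (t * S n) (L^[j] w) := by
    intro j hj
    rw [he, ← hL'n (n - j) _ (L^[j] w), ← Function.iterate_add_apply L, Nat.sub_add_cancel hj]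
  have hgood : ∀ j < n, good (R (t * S j) (L^[j] w)) := by
    intro j hj
    rcases lt_or_ge j J with h | h
    · have h0 : S j = 0 := Finset.sum_eq_zero fun i hi =>
        hbz _ (hin i (by have := Finset.mem_range.1 hi; omega)).2
      rw [h0, mul_zero, hR0]
      exact (hin j h).1
    · rcases le_or_gt (j + J) n with h' | h'
      · exact hball _ (by rw [hRn]; exact hmid j h h')
      -- near the end the rotation is complete
      · have h0 : S n = S j := by
          refine (Finset.sum_subset (Finset.range_subset_range.2 hj.le) fun i hi hij => ?_).symm
          simp only [Finset.mem_range, not_lt] at hi hij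
          have h1 := (hout (n - (i + 1)) (by omega)).2
          rw [hback (i + 1) (by omega), hRn] at h1
          exact hbz _ h1
        have h1 := (hout (n - j - 1) (by omega)).1
        rwa [Nat.sub_add_cancel (by omega), hback j hj.le, h0] at h1
  have key : ∀ j ≤ n, F^[per * j] (ch.symm w) = ch.symm (R (t * S j) (L^[j] w)) := by
    intro j hj
    induction j with
    | zero => simp [hS, hR0]
    | succ j ih =>
      rw [Nat.mul_succ, add_comm, Function.iterate_add_apply, ih (by omega),
        hstep _ (hgood j (by omega)), hRL, hRn, hR, ← Function.iterate_succ_apply' L]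
      congr 2
      simp only [hS, Finset.sum_range_succ]
      ring
  rw [key n le_rfl, he]

namespace SaddleFocusCycle

variable [ChartedSpace E3 M] {r : ℕ} {f : M ≃ₘ^r⟮𝓡 3, 𝓡 3⟯ M} (C : SaddleFocusCycle r f)

theorem eventually_V_subset (i : Fin 4) {U : Set M} (hU : U ∈ 𝓝 (C.center i)) :
    ∀ᶠ ρ in 𝓝[>] (0 : ℝ), C.V ρ i ⊆ U := by
  have hball : ∀ (ch : OpenPartialHomeomorph M E3), (0 : E3) ∈ ch.target → U ∈ 𝓝 (ch.symm 0) →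
      ∀ᶠ ρ in 𝓝[>] (0 : ℝ), ch.symm '' Metric.closedBall 0 ρ ⊆ U := by
    intro ch h0 hU
    obtain ⟨η, hη, hb⟩ := Metric.nhds_basis_closedBall.mem_iff.1
      ((ch.continuousAt_symm h0).preimage_mem_nhds hU)
    filter_upwards [nhdsWithin_le_nhds (Iio_mem_nhds hη)] with ρ hρ
    rw [image_subset_iff]
    exact (Metric.closedBall_subset_closedBall (le_of_lt hρ)).trans hb
  have hbox : ∀ (ch : OpenPartialHomeomorph M E3) (z : E3), z ∈ ch.target → U ∈ 𝓝 (ch.symm z) →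
      ∀ᶠ ρ in 𝓝[>] (0 : ℝ), ch.symm '' box z ρ ⊆ U := by
    intro ch z h0 hU
    obtain ⟨η, hη, hb⟩ := Metric.nhds_basis_closedBall.mem_iff.1
      ((ch.continuousAt_symm h0).preimage_mem_nhds hU)
    filter_upwards [nhdsWithin_le_nhds (Iio_mem_nhds (show (0 : ℝ) < η / 2 by positivity)),
      self_mem_nhdsWithin] with ρ hρ hρ0
    rw [image_subset_iff]
    refine Subset.trans (fun w hw => ?_) hb
    rw [Metric.mem_closedBall, dist_eq_norm]
    refine (sq_le_sq₀ (norm_nonneg _) hη.le).1 ?_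
    rw [norm_sq_eq_three]
    have hsq : ∀ j, ((w - z) j) ^ 2 ≤ ρ ^ 2 := fun j => by
      rw [← sq_abs]
      exact pow_le_pow_left₀ (abs_nonneg _) (hw j) 2
    have h1 : ρ ^ 2 ≤ (η / 2) ^ 2 := pow_le_pow_left₀ (le_of_lt hρ0) (le_of_lt hρ) 2
    nlinarith [hsq 0, hsq 1, hsq 2]
  fin_cases i
  · exact hball C.chP (C.cube_P zero_mem_cube) (by rw [C.chP_symm_zero]; exact hU)
  · exact hball C.chQ (C.cube_Q zero_mem_cube) (by rw [C.chQ_symm_zero]; exact hU)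
  · exact hbox C.chP _ (C.cube_P ptXtil_mem_cube) hU
  · exact hbox C.chQ _ (C.cube_Q ptYtil_mem_cube) hU

variable [T2Space M]

theorem eventually_notMem_V {x : M} {i : Fin 4} (hx : x ≠ C.center i) :
    ∀ᶠ q in 𝓝[>] (0 : ℝ) ×ˢ 𝓝 x, q.2 ∉ C.V q.1 i := by
  obtain ⟨U, U', hU, hU', hd⟩ := t2_separation_nhds hx
  filter_upwards [(C.eventually_V_subset i hU').prod_mk hU] with q hq h
  exact disjoint_left.1 hd hq.2 (hq.1 h)

theorem eventually_pairwise_disjoint_V (hr : r ≠ 0) :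
    ∀ᶠ ρ in 𝓝[>] (0 : ℝ), Pairwise fun i j => Disjoint (C.V ρ i) (C.V ρ j) := by
  have h : ∀ i j : Fin 4, i ≠ j → ∀ᶠ ρ in 𝓝[>] (0 : ℝ), Disjoint (C.V ρ i) (C.V ρ j) := by
    intro i j hij
    obtain ⟨U, U', hU, hU', hd⟩ := t2_separation_nhds ((C.center_injective hr).ne hij)
    filter_upwards [C.eventually_V_subset i hU, C.eventually_V_subset j hU'] with ρ h1 h2
    exact hd.mono h1 h2
  have h2 : ∀ᶠ ρ in 𝓝[>] (0 : ℝ), ∀ i j : Fin 4, i ≠ j → Disjoint (C.V ρ i) (C.V ρ j) := by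
    simp only [eventually_all]
    exact h
  exact h2.mono fun ρ hρ i j => hρ i j

theorem eventually_isolatedStep {ch : OpenPartialHomeomorph M E3} {per : ℕ} {L : E3 → E3}
    {i₀ : Fin 4} {z : E3} (hch : cube ⊆ ch.target) (hL : Continuous L) (hz : z ∈ cube)
    (hLz : L z ∈ cube) (h1 : ∀ s, 0 < s → s < per → ∀ i, f^[s] (ch.symm z) ≠ C.center i)
    (h2 : ∀ i ≠ i₀, ch.symm (L z) ≠ C.center i) :
    ∀ᶠ q in 𝓝[>] (0 : ℝ) ×ˢ 𝓝 z, IsolatedStep (C.V q.1) f ch per L i₀ q.2 := by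
  have hc : ∀ s, ContinuousAt (fun w => f^[s] (ch.symm w)) z := fun s =>
    (continuous_iterate s).continuousAt.comp (ch.continuousAt_symm (hch hz))
  have hcL : ContinuousAt (fun w => ch.symm (L w)) z :=
    (ch.continuousAt_symm (hch hLz)).comp hL.continuousAt
  have e1 : ∀ᶠ q in 𝓝[>] (0 : ℝ) ×ˢ 𝓝 z, q.2 ∈ cube :=
    tendsto_snd.eventually (isOpen_cube.mem_nhds hz)
  have e2 : ∀ᶠ q in 𝓝[>] (0 : ℝ) ×ˢ 𝓝 z, L q.2 ∈ cube :=
    (hL.continuousAt.tendsto.comp tendsto_snd).eventually (isOpen_cube.mem_nhds hLz)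
  have e3 : ∀ᶠ q in 𝓝[>] (0 : ℝ) ×ˢ 𝓝 z,
      ∀ s ∈ Finset.Ioo 0 per, ∀ i, f^[s] (ch.symm q.2) ∉ C.V q.1 i := by
    simp only [Finset.eventually_all, eventually_all]
    intro s hs i
    rw [Finset.mem_Ioo] at hs
    have : Tendsto (fun q : ℝ × E3 => (q.1, f^[s] (ch.symm q.2))) (𝓝[>] (0 : ℝ) ×ˢ 𝓝 z)
        (𝓝[>] (0 : ℝ) ×ˢ 𝓝 (f^[s] (ch.symm z))) :=
      tendsto_fst.prodMk ((hc s).tendsto.comp tendsto_snd)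
    exact this.eventually (C.eventually_notMem_V (h1 s hs.1 hs.2 i))
  have e4 : ∀ᶠ q in 𝓝[>] (0 : ℝ) ×ˢ 𝓝 z, ∀ i, i ≠ i₀ → ch.symm (L q.2) ∉ C.V q.1 i := by
    simp only [eventually_all]
    intro i hi
    have : Tendsto (fun q : ℝ × E3 => (q.1, ch.symm (L q.2))) (𝓝[>] (0 : ℝ) ×ˢ 𝓝 z)
        (𝓝[>] (0 : ℝ) ×ˢ 𝓝 (ch.symm (L z))) :=
      tendsto_fst.prodMk (hcL.tendsto.comp tendsto_snd)
    exact this.eventually (C.eventually_notMem_V (h2 i hi))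
  filter_upwards [e1, e2, e3, e4] with q h1 h2 h3 h4
  exact ⟨h1, h2, fun s hs hs' i => h3 s (Finset.mem_Ioo.2 ⟨hs, hs'⟩) i, h4⟩

/-! ### Values of the perturbation -/

variable {ρ : ℝ} {b : ℝ → ℝ} {υ : E8}

omit [T2Space M] in
theorem Γ_of_notMem {q : M} (hq : ∀ i, q ∉ C.V ρ i) : C.Γ ρ b υ q = q := by
  rw [Γ, if_neg (hq 0), if_neg (hq 1), if_neg (hq 2), if_neg (hq 3)]

omit [T2Space M] in
theorem Γ_chP_symm (hρ : 0 < ρ) {u : E3} (hu : u ∈ cube) (hq : ∀ i ≠ 0, C.chP.symm u ∉ C.V ρ i) :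
    C.Γ ρ (bump ρ) υ (C.chP.symm u) = C.chP.symm (rotX (υ 6 * bump ρ ‖u‖) u) := by
  by_cases h : C.chP.symm u ∈ C.V ρ 0
  · rw [Γ, if_pos h, C.chP.right_inv (C.cube_P hu)]
  · rw [Γ, if_neg h, if_neg (hq 1 (by decide)), if_neg (hq 2 (by decide)),
      if_neg (hq 3 (by decide)), bump_eq_zero hρ, mul_zero, rotX, linP_one_zero]
    rw [abs_norm]
    by_contra hlt
    exact h (mem_image_of_mem _ (mem_closedBall_zero_iff.2 (not_le.1 hlt).le))

omit [T2Space M] in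
theorem Γ_chQ_symm (hρ : 0 < ρ) {u : E3} (hu : u ∈ cube) (hq : ∀ i ≠ 1, C.chQ.symm u ∉ C.V ρ i) :
    C.Γ ρ (bump ρ) υ (C.chQ.symm u) = C.chQ.symm (rotY (υ 7 * bump ρ ‖u‖) u) := by
  by_cases h : C.chQ.symm u ∈ C.V ρ 1
  · rw [Γ, if_neg (hq 0 (by decide)), if_pos h, C.chQ.right_inv (C.cube_Q hu)]
  · rw [Γ, if_neg h, if_neg (hq 0 (by decide)), if_neg (hq 2 (by decide)),
      if_neg (hq 3 (by decide)), bump_eq_zero hρ, mul_zero, rotY, linQ_one_zero]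
    rw [abs_norm]
    by_contra hlt
    exact h (mem_image_of_mem _ (mem_closedBall_zero_iff.2 (not_le.1 hlt).le))

omit [T2Space M] in
theorem translationLike_eq_add (hρ : 0 < ρ) {z v w : E3} (hw : w ∈ box z (ρ / 2)) :
    translationLike (bump ρ) z v w = w + v := by
  rw [translationLike, bump_eq_one hρ (hw 0), bump_eq_one hρ (hw 1), bump_eq_one hρ (hw 2)]
  simp

omit [T2Space M] in
theorem box_mono {z : E3} {ρ ρ' : ℝ} (h : ρ ≤ ρ') : box z ρ ⊆ box z ρ' :=
  fun _ hw i => (hw i).trans h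

omit [T2Space M] in
theorem Γ_near_heteroPoint (hρ : 0 < ρ) (hρ1 : ρ < 1)
    (hV : Pairwise fun i j => Disjoint (C.V ρ i) (C.V ρ j)) {u : E3} (hu : u ∈ box ptXtil (ρ / 2)) :
    C.Γ ρ (bump ρ) υ (C.chP.symm u) = C.chP.symm (u + !₂[υ 3, υ 4, υ 5]) := by
  have hu' : u ∈ box ptXtil ρ := box_mono (by linarith) hu
  have h2 : C.chP.symm u ∈ C.V ρ 2 := mem_image_of_mem _ hu'
  have hc : u ∈ cube := box_subset_cube abs_ptXtil_le (by linarith) hu'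
  rw [Γ, if_neg fun h => disjoint_left.1 (hV (show (0 : Fin 4) ≠ 2 by decide)) h h2,
    if_neg fun h => disjoint_left.1 (hV (show (1 : Fin 4) ≠ 2 by decide)) h h2, if_pos h2,
    C.chP.right_inv (C.cube_P hc), translationLike_eq_add hρ hu]

omit [T2Space M] in
theorem Γ_near_tangencyPoint (hρ : 0 < ρ) (hρ1 : ρ < 1)
    (hV : Pairwise fun i j => Disjoint (C.V ρ i) (C.V ρ j)) {u : E3} (hu : u ∈ box ptYtil (ρ / 2)) :
    C.Γ ρ (bump ρ) υ (C.chQ.symm u) = C.chQ.symm (u + !₂[υ 0, υ 1, υ 2]) := by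
  have hu' : u ∈ box ptYtil ρ := box_mono (by linarith) hu
  have h3 : C.chQ.symm u ∈ C.V ρ 3 := mem_image_of_mem _ hu'
  have hc : u ∈ cube := box_subset_cube abs_ptYtil_le (by linarith) hu'
  rw [Γ, if_neg fun h => disjoint_left.1 (hV (show (0 : Fin 4) ≠ 3 by decide)) h h3,
    if_neg fun h => disjoint_left.1 (hV (show (1 : Fin 4) ≠ 3 by decide)) h h3,
    if_neg fun h => disjoint_left.1 (hV (show (2 : Fin 4) ≠ 3 by decide)) h h3, if_pos h3,
    C.chQ.right_inv (C.cube_Q hc), translationLike_eq_add hρ hu]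

end SaddleFocusCycle

end Passage

section Passage

variable {M : Type*} [TopologicalSpace M]

namespace SaddleFocusCycle

variable [ChartedSpace E3 M] {r : ℕ} {f : M ≃ₘ^r⟮𝓡 3, 𝓡 3⟯ M} (C : SaddleFocusCycle r f)
  {ρ : ℝ} {υ : E8} {F : M → M}

theorem iterate_of_isolated (hF : ∀ p, F p = C.Γ ρ (bump ρ) υ (f p)) {n : ℕ} {x : M}
    (h : ∀ s, 0 < s → s ≤ n → ∀ i, f^[s] x ∉ C.V ρ i) : F^[n] x = f^[n] x := by
  refine iterate_eq_of_forall_eq fun s hs => ?_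
  rw [hF, ← Function.iterate_succ_apply' f]
  exact C.Γ_of_notMem (h (s + 1) (by omega) (by omega))

theorem iterate_of_isolated' (hF : ∀ p, F p = C.Γ ρ (bump ρ) υ (f p)) {n : ℕ} (hn : 0 < n) {x : M}
    (h : ∀ s, 0 < s → s < n → ∀ i, f^[s] x ∉ C.V ρ i) :
    F^[n] x = C.Γ ρ (bump ρ) υ (f^[n] x) := by
  obtain ⟨n, rfl⟩ := Nat.exists_eq_succ_of_ne_zero hn.ne'
  rw [Function.iterate_succ_apply', C.iterate_of_isolated hF fun s h1 h2 => h s h1 (by omega), hF,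
    Function.iterate_succ_apply']

theorem step_P (hρ : 0 < ρ) (hF : ∀ p, F p = C.Γ ρ (bump ρ) υ (f p)) {w : E3}
    (hw : IsolatedStep (C.V ρ) f C.chP C.perP (linP C.lamP C.sigP C.phiP) 0 w) :
    F^[C.perP] (C.chP.symm w) = C.chP.symm (rotX (υ 6 * bump ρ ‖linP C.lamP C.sigP C.phiP w‖)
      (linP C.lamP C.sigP C.phiP w)) := by
  obtain ⟨h1, h2, h3, h4⟩ := hw
  rw [C.iterate_of_isolated' hF C.perP_pos h3, C.linear_P w h1 h2, C.Γ_chP_symm hρ h2 h4]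

theorem step_Q (hρ : 0 < ρ) (hF : ∀ p, F p = C.Γ ρ (bump ρ) υ (f p)) {w : E3}
    (hw : IsolatedStep (C.V ρ) f C.chQ C.perQ (linQ C.lamQ C.sigQ C.phiQ) 1 w) :
    F^[C.perQ] (C.chQ.symm w) = C.chQ.symm (rotY (υ 7 * bump ρ ‖linQ C.lamQ C.sigQ C.phiQ w‖)
      (linQ C.lamQ C.sigQ C.phiQ w)) := by
  obtain ⟨h1, h2, h3, h4⟩ := hw
  rw [C.iterate_of_isolated' hF C.perQ_pos h3, C.linear_Q w h1 h2, C.Γ_chQ_symm hρ h2 h4]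

variable [T2Space M]

/-- Passage near a saddle from a neighbourhood of `zin` to a neighbourhood of `zout`, for every
sufficiently small support radius `ρ`: the perturbed orbit is explicit, for any number of returns
and any small parameter. -/
theorem eventually_passage {ch : OpenPartialHomeomorph M E3} {per : ℕ} {L L' : E3 → E3}
    {R : ℝ → E3 → E3} {i₀ : Fin 4} {k : Fin 8} {zin zout : E3} (hch : cube ⊆ ch.target)
    (hper : 0 < per)
    (hLc : Continuous L) (hLc' : Continuous L') (hL0 : L 0 = 0)
    (hLL' : ∀ w, L (L' w) = w) (hL'L : ∀ w, L' (L w) = w)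
    (hRL : ∀ s w, L (R s w) = R s (L w)) (hR : ∀ s s' w, R s (R s' w) = R (s + s') w)
    (hR0 : ∀ w, R 0 w = w) (hRn : ∀ s w, ‖R s w‖ = ‖w‖)
    (hlin : ∀ w ∈ cube, L w ∈ cube → f^[per] (ch.symm w) = ch.symm (L w))
    (hin : ∀ j, L^[j] zin ∈ cube) (hout : ∀ j, L'^[j] zout ∈ cube)
    (hin0 : zin ≠ 0) (hout0 : zout ≠ 0)
    (hc0 : ∀ s, 0 < s → s < per → ∀ i, f^[s] (ch.symm 0) ≠ C.center i)
    (hc0' : ∀ i ≠ i₀, ch.symm 0 ≠ C.center i)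
    (hcin : ∀ s, 0 < s → ∀ i, f^[s] (ch.symm zin) ≠ C.center i)
    (hcout : ∀ x s, f^[s] x = ch.symm zout → ∀ i, x ≠ C.center i)
    (hstep : ∀ ρ > 0, ∀ (F : M → M) (υ : E8), (∀ p, F p = C.Γ ρ (bump ρ) υ (f p)) → ∀ w,
      IsolatedStep (C.V ρ) f ch per L i₀ w →
        F^[per] (ch.symm w) = ch.symm (R (υ k * bump ρ ‖L w‖) (L w)))
    (hmid : ∀ r₀ > 0, ∃ J, ∀ᶠ q in 𝓝 zin ×ˢ 𝓝 zout, ∀ (n : ℕ) (t : ℝ),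
      q.2 = R t (L^[n] q.1) → ∀ j, J ≤ j → j + J ≤ n → ‖L^[j] q.1‖ < r₀) :
    ∀ᶠ ρ in 𝓝[>] (0 : ℝ), ∀ᶠ q in 𝓝 zin ×ˢ 𝓝 zout, ∀ (F : M → M) (υ : E8),
      (∀ p, F p = C.Γ ρ (bump ρ) υ (f p)) → ∀ n : ℕ,
        q.2 = R (υ k * ∑ i ∈ Finset.range n, bump ρ ‖L^[i + 1] q.1‖) (L^[n] q.1) →
          F^[per * n] (ch.symm q.1) = ch.symm q.2 := by
  have hL'0 : L' 0 = 0 := by rw [← hL0, hL'L, hL0]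
  have hL'n : ∀ j w, L'^[j] (L^[j] w) = w := fun j =>
    Function.LeftInverse.iterate (f := L) (g := L') hL'L j
  have hLn : ∀ j w, L^[j] (L'^[j] w) = w := fun j =>
    Function.LeftInverse.iterate (f := L') (g := L) hLL' j
  have hn0 : ∀ j, L^[j] zin ≠ 0 := fun j h => hin0 (by
    rw [← hL'n j zin, h, Function.iterate_fixed hL'0])
  have hn0' : ∀ j, L'^[j] zout ≠ 0 := fun j h => hout0 (by
    rw [← hLn j zout, h, Function.iterate_fixed hL0])
  have hfin : ∀ j, f^[per * j] (ch.symm zin) = ch.symm (L^[j] zin) := fun j =>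
    iterate_chart_symm hlin j fun i _ => hin i
  have hsucc : ∀ j, L (L'^[j + 1] zout) = L'^[j] zout := fun j => by
    rw [Function.iterate_succ_apply', hLL']
  have hfout : ∀ j, f^[per * j] (ch.symm (L'^[j] zout)) = ch.symm zout := by
    intro j
    induction j with
    | zero => rfl
    | succ j ih =>
      rw [Nat.mul_succ, Function.iterate_add_apply, hlin _ (hout _) (by rw [hsucc]; exact hout j),
        hsucc, ih]
  -- the ball around the saddle
  have h0 : ∀ᶠ q in 𝓝[>] (0 : ℝ) ×ˢ 𝓝 (0 : E3), IsolatedStep (C.V q.1) f ch per L i₀ q.2 :=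
    C.eventually_isolatedStep hch hLc zero_mem_cube (by rw [hL0]; exact zero_mem_cube) hc0
      (by rw [hL0]; exact hc0')
  obtain ⟨pa, ha, pb, hb, hab⟩ := eventually_prod_iff.1 h0
  obtain ⟨r₀, hr₀, hball⟩ := Metric.eventually_nhds_iff_ball.1 hb
  obtain ⟨J, hJ⟩ := hmid r₀ hr₀
  -- the points of the orbits of reference outside the ball
  have hgin : ∀ᶠ ρ in 𝓝[>] (0 : ℝ), ∀ j ∈ Finset.range J, ∀ᶠ w in 𝓝 zin,
      IsolatedStep (C.V ρ) f ch per L i₀ (L^[j] w) ∧ ρ ≤ ‖L^[j + 1] w‖ := by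
    rw [Finset.eventually_all]
    intro j _
    have h1 := (C.eventually_isolatedStep (i₀ := i₀) (per := per) hch hLc (hin j)
      (by rw [← Function.iterate_succ_apply' L]; exact hin _)
      (fun s hs _ i => by
        rw [← hfin, ← Function.iterate_add_apply]; exact hcin _ (by omega) i)
      (fun i _ => by
        rw [← Function.iterate_succ_apply' L, ← hfin]
        exact hcin _ (Nat.mul_pos hper (by omega)) i)).curry
    have hpos : 0 < ‖L^[j + 1] zin‖ := norm_pos_iff.2 (hn0 _)
    filter_upwards [h1, nhdsWithin_le_nhds (Iio_mem_nhds hpos)] with ρ h2 h3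
    have h4 : ∀ᶠ w in 𝓝 zin, ρ < ‖L^[j + 1] w‖ :=
      ((hLc.iterate (j + 1)).norm.continuousAt).eventually (lt_mem_nhds h3)
    filter_upwards [(hLc.iterate j).continuousAt.eventually h2, h4] with w h5 h6
    exact ⟨h5, h6.le⟩
  have hgout : ∀ᶠ ρ in 𝓝[>] (0 : ℝ), ∀ j ∈ Finset.range J, ∀ᶠ w in 𝓝 zout,
      IsolatedStep (C.V ρ) f ch per L i₀ (L'^[j + 1] w) ∧ ρ ≤ ‖L'^[j] w‖ := by
    rw [Finset.eventually_all]
    intro j _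
    have h1 := (C.eventually_isolatedStep (i₀ := i₀) (per := per) hch hLc (hout (j + 1))
      (by rw [hsucc]; exact hout _)
      (fun s hs hs' i => by
        refine hcout _ (per * (j + 1) - s) ?_ i
        rw [← Function.iterate_add_apply, Nat.sub_add_cancel, hfout]
        exact hs'.le.trans (Nat.le_mul_of_pos_right _ (by omega)))
      (fun i _ => by
        rw [hsucc]
        exact hcout _ _ (hfout j) i)).curry
    have hpos : 0 < ‖L'^[j] zout‖ := norm_pos_iff.2 (hn0' _)
    filter_upwards [h1, nhdsWithin_le_nhds (Iio_mem_nhds hpos)] with ρ h2 h3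
    have h4 : ∀ᶠ w in 𝓝 zout, ρ < ‖L'^[j] w‖ :=
      ((hLc'.iterate j).norm.continuousAt).eventually (lt_mem_nhds h3)
    filter_upwards [(hLc'.iterate (j + 1)).continuousAt.eventually h2, h4] with w h5 h6
    exact ⟨h5, h6.le⟩
  -- `J` does not depend on `ρ`, so only finitely many smallness conditions on `ρ` remain
  filter_upwards [ha, hgin, hgout, self_mem_nhdsWithin] with ρ h1 h2 h3 hρ
  rw [← Finset.eventually_all] at h2 h3
  filter_upwards [h2.prod_mk h3, hJ] with q h4 h5 F υ hF n he
  exact iterate_passage (good := IsolatedStep (C.V ρ) f ch per L i₀) hρ hRL hR hR0 hRn hL'L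
    (hstep ρ hρ F υ hF) (fun w hw => hab h1 (hball w (mem_ball_zero_iff.2 hw)))
    (fun j hj => h4.1 j (Finset.mem_range.2 hj)) (fun j hj => h4.2 j (Finset.mem_range.2 hj))
    (h5 n _ he) he

omit [T2Space M] in
theorem exists_pow_sq_lt {a : ℝ} (ha : |a| < 1) {ε : ℝ} (hε : 0 < ε) :
    ∃ J : ℕ, ∀ j, J ≤ j → (a ^ j) ^ 2 < ε := by
  have h : Tendsto (fun j : ℕ => (a ^ j) ^ 2) atTop (𝓝 0) := by
    simpa using (tendsto_pow_atTop_nhds_zero_of_abs_lt_one ha).pow 2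
  exact eventually_atTop.1 (h.eventually (gt_mem_nhds hε))

omit [T2Space M] in
/-- Away from the ends of a passage of `n` returns, the contracted part is small because of the
first returns and the expanded part because of the last ones. -/
theorem exists_middle_bound {lam sig : ℝ} (hl : |lam| < 1) (hs : 1 < |sig|) {r₀ : ℝ}
    (hr₀ : 0 < r₀) : ∃ J : ℕ, ∀ (n j : ℕ) (u v : ℝ), J ≤ j → j + J ≤ n → 0 ≤ u → u ≤ 4 →
      (sig ^ n) ^ 2 * v ≤ 4 → (lam ^ j) ^ 2 * u + (sig ^ j) ^ 2 * v < r₀ ^ 2 := by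
  have hs0 : sig ≠ 0 := abs_pos.1 (by linarith)
  obtain ⟨J₁, h1⟩ := exists_pow_sq_lt hl (ε := r₀ ^ 2 / 8) (by positivity)
  obtain ⟨J₂, h2⟩ := exists_pow_sq_lt (a := sig⁻¹) (by rw [abs_inv]; exact inv_lt_one_of_one_lt₀ hs)
    (ε := r₀ ^ 2 / 8) (by positivity)
  refine ⟨max J₁ J₂, fun n j u v hj hjn hu hu4 hv => ?_⟩
  have e1 := h1 j ((le_max_left _ _).trans hj)
  have e2 := h2 (n - j) (by have := le_max_right J₁ J₂; omega)
  have e3 : (sig ^ j) ^ 2 * v = (sig⁻¹ ^ (n - j)) ^ 2 * ((sig ^ n) ^ 2 * v) := by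
    have : sig ^ n = sig ^ j * sig ^ (n - j) := by rw [← pow_add]; congr 1; omega
    rw [this, inv_pow]
    field_simp
  rw [e3]
  have e4 : (sig⁻¹ ^ (n - j)) ^ 2 * ((sig ^ n) ^ 2 * v) ≤ (sig⁻¹ ^ (n - j)) ^ 2 * 4 := by gcongr
  have e5 : (lam ^ j) ^ 2 * u ≤ (lam ^ j) ^ 2 * 4 := by gcongr
  linarith

/-- `eventually_passage` at `P`: an orbit that enters near `Xtil` and leaves near `Y` is moved by
the linear map and turned by the accumulated weight of the rotations. -/
theorem eventually_passage_P (hr : r ≠ 0) :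
    ∀ᶠ ρ in 𝓝[>] (0 : ℝ), ∀ᶠ q in 𝓝 ptXtil ×ˢ 𝓝 ptY, ∀ (F : M → M) (υ : E8),
      (∀ p, F p = C.Γ ρ (bump ρ) υ (f p)) → ∀ n : ℕ,
        q.2 = rotX (υ 6 * ∑ i ∈ Finset.range n, bump ρ ‖(linP C.lamP C.sigP C.phiP)^[i + 1] q.1‖)
          ((linP C.lamP C.sigP C.phiP)^[n] q.1) →
          F^[C.perP * n] (C.chP.symm q.1) = C.chP.symm q.2 := by
  have hl0 : C.lamP ≠ 0 := abs_pos.1 C.lamP_ne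
  have hs0 : C.sigP ≠ 0 := abs_pos.1 (by linarith [C.sigP_gt])
  refine C.eventually_passage (L := linP C.lamP C.sigP C.phiP)
    (L' := linP C.lamP⁻¹ C.sigP⁻¹ (-C.phiP)) (R := rotX) (i₀ := 0) (k := 6)
    C.cube_P C.perP_pos (continuous_linP _ _ _) (continuous_linP _ _ _) (linP_zero _ _ _) ?_ ?_ ?_
    ?_ (fun w => linP_one_zero w) norm_rotX C.linear_P C.iterate_linP_ptXtil_mem_cube ?_ ?_ ?_ ?_ ?_
    (fun s hs i => C.iterate_heteroPoint_ne_center hr hs i) ?_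
    (fun ρ hρ F υ hF w hw => C.step_P hρ hF hw) ?_
  · intro w; rw [linP_linP, mul_inv_cancel₀ hl0, mul_inv_cancel₀ hs0, add_neg_cancel, linP_one_zero]
  · intro w; rw [linP_linP, inv_mul_cancel₀ hl0, inv_mul_cancel₀ hs0, neg_add_cancel, linP_one_zero]
  · intro s w; rw [rotX, rotX, linP_linP, linP_linP]; congr 1 <;> ring
  · intro s s' w; rw [rotX, rotX, rotX, linP_linP]; norm_num
  · intro j
    refine mem_cube_of_norm_le (c := 2) (by norm_num) ?_
    refine (sq_le_sq₀ (norm_nonneg _) (by norm_num)).1 ?_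
    rw [linP_iterate, norm_linP_sq]
    have : (C.sigP⁻¹ ^ j) ^ 2 ≤ 1 := by
      rw [← sq_abs, abs_pow, abs_inv]
      exact pow_le_one₀ (by positivity) (pow_le_one₀ (by positivity)
        (inv_le_one_of_one_le₀ C.sigP_gt.le))
    simp [ptY] at this ⊢
    linarith
  · intro h; simpa [ptXtil] using congrArg (fun w : E3 => w 0) h
  · intro h; simpa [ptY] using congrArg (fun w : E3 => w 1) h
  · rw [C.chP_symm_zero]
    intro s hs hs' i
    by_cases hi : i = 0
    · rw [hi]; exact C.iterate_P_ne_P hs hs'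
    · exact C.iterate_P_ne_center hr s hi
  · rw [C.chP_symm_zero]
    exact fun i hi => C.iterate_P_ne_center hr 0 hi
  · intro x s hx i
    -- a point whose orbit reaches `Y` also reaches `Ytil`, at a later time
    refine C.ne_center_of_iterate_eq_tangencyPoint hr (i := C.N₂ + s) (by have := C.N₂_pos; omega)
      ?_ i
    rw [Function.iterate_add_apply, hx, C.iterate_N₂]
  · intro r₀ hr₀
    obtain ⟨J, hJ⟩ := exists_middle_bound C.lamP_lt C.sigP_gt hr₀
    refine ⟨J, ?_⟩
    have h1 : ∀ᶠ w in 𝓝 ptXtil, w 0 ^ 2 < 4 :=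
      ((contDiff_coord (n := 0) 0).continuous.pow 2).continuousAt.eventually
        (gt_mem_nhds (by simp [ptXtil]))
    have h2 : ∀ᶠ w in 𝓝 ptY, w 1 ^ 2 + w 2 ^ 2 < 4 :=
      (((contDiff_coord (n := 0) 1).continuous.pow 2).add
        ((contDiff_coord (n := 0) 2).continuous.pow 2)).continuousAt.eventually
        (gt_mem_nhds (by simp [ptY]; norm_num))
    filter_upwards [h1.prod_mk h2] with q hq n t he j hj hjn
    refine (sq_lt_sq₀ (norm_nonneg _) hr₀.le).1 ?_
    rw [linP_iterate, norm_linP_sq]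
    refine hJ n j _ _ hj hjn (sq_nonneg _) hq.1.le ?_
    have h3 := hq.2
    rw [he, linP_iterate, rotX, linP_linP] at h3
    have h4 : ∀ (a s φ : ℝ) (w : E3), (linP a s φ w) 1 ^ 2 + (linP a s φ w) 2 ^ 2 =
        s ^ 2 * (w 1 ^ 2 + w 2 ^ 2) := by
      intro a s φ w
      simp only [linP, PiLp.toLp_apply, Matrix.cons_val_one, Matrix.cons_val]
      linear_combination (s ^ 2 * (w 1 ^ 2 + w 2 ^ 2)) * Real.cos_sq_add_sin_sq (2 * Real.pi * φ)
    rw [h4, one_mul] at h3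
    exact h3.le

/-- `eventually_passage` at `Q`, from near `Ytil` to near `X`. -/
theorem eventually_passage_Q (hr : r ≠ 0) :
    ∀ᶠ ρ in 𝓝[>] (0 : ℝ), ∀ᶠ q in 𝓝 ptYtil ×ˢ 𝓝 ptX, ∀ (F : M → M) (υ : E8),
      (∀ p, F p = C.Γ ρ (bump ρ) υ (f p)) → ∀ n : ℕ,
        q.2 = rotY (υ 7 * ∑ i ∈ Finset.range n, bump ρ ‖(linQ C.lamQ C.sigQ C.phiQ)^[i + 1] q.1‖)
          ((linQ C.lamQ C.sigQ C.phiQ)^[n] q.1) →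
          F^[C.perQ * n] (C.chQ.symm q.1) = C.chQ.symm q.2 := by
  have hl0 : C.lamQ ≠ 0 := abs_pos.1 C.lamQ_ne
  have hs0 : C.sigQ ≠ 0 := abs_pos.1 (by linarith [C.sigQ_gt])
  refine C.eventually_passage (L := linQ C.lamQ C.sigQ C.phiQ)
    (L' := linQ C.lamQ⁻¹ C.sigQ⁻¹ (-C.phiQ)) (R := rotY) (i₀ := 1) (k := 7)
    C.cube_Q C.perQ_pos (continuous_linQ _ _ _) (continuous_linQ _ _ _) (linQ_zero _ _ _) ?_ ?_ ?_
    ?_ (fun w => linQ_one_zero w) norm_rotY C.linear_Q C.iterate_linQ_ptYtil_mem_cube ?_ ?_ ?_ ?_ ?_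
    (fun s hs i => C.iterate_tangencyPoint_ne_center hr hs i) ?_
    (fun ρ hρ F υ hF w hw => C.step_Q hρ hF hw) ?_
  · intro w; rw [linQ_linQ, mul_inv_cancel₀ hl0, mul_inv_cancel₀ hs0, add_neg_cancel, linQ_one_zero]
  · intro w; rw [linQ_linQ, inv_mul_cancel₀ hl0, inv_mul_cancel₀ hs0, neg_add_cancel, linQ_one_zero]
  · intro s w; rw [rotY, rotY, linQ_linQ, linQ_linQ]; congr 1 <;> ring
  · intro s s' w; rw [rotY, rotY, rotY, linQ_linQ]; norm_num
  · intro j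
    refine mem_cube_of_norm_le (c := 2) (by norm_num) ?_
    refine (sq_le_sq₀ (norm_nonneg _) (by norm_num)).1 ?_
    rw [linQ_iterate, norm_linQ_sq]
    have : (C.sigQ⁻¹ ^ j) ^ 2 ≤ 1 := by
      rw [← sq_abs, abs_pow, abs_inv]
      exact pow_le_one₀ (by positivity) (pow_le_one₀ (by positivity)
        (inv_le_one_of_one_le₀ C.sigQ_gt.le))
    simp [ptX] at this ⊢
    linarith
  · intro h; simpa [ptYtil] using congrArg (fun w : E3 => w 0) h
  · intro h; simpa [ptX] using congrArg (fun w : E3 => w 1) h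
  · rw [C.chQ_symm_zero]
    intro s hs hs' i
    by_cases hi : i = 1
    · rw [hi]; exact C.iterate_Q_ne_Q hs hs'
    · exact C.iterate_Q_ne_center hr s hi
  · rw [C.chQ_symm_zero]
    exact fun i hi => C.iterate_Q_ne_center hr 0 hi
  · intro x s hx i
    refine C.ne_center_of_iterate_eq_heteroPoint hr (i := C.N₁ + s) (by have := C.N₁_pos; omega)
      ?_ i
    rw [Function.iterate_add_apply, hx, C.iterate_N₁]
  · intro r₀ hr₀
    obtain ⟨J, hJ⟩ := exists_middle_bound C.lamQ_lt C.sigQ_gt hr₀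
    refine ⟨J, ?_⟩
    have h1 : ∀ᶠ w in 𝓝 ptYtil, w 0 ^ 2 + w 2 ^ 2 < 4 :=
      (((contDiff_coord (n := 0) 0).continuous.pow 2).add
        ((contDiff_coord (n := 0) 2).continuous.pow 2)).continuousAt.eventually
        (gt_mem_nhds (by simp [ptYtil]; norm_num))
    have h2 : ∀ᶠ w in 𝓝 ptX, w 1 ^ 2 < 4 :=
      ((contDiff_coord (n := 0) 1).continuous.pow 2).continuousAt.eventually
        (gt_mem_nhds (by simp [ptX]))
    filter_upwards [h1.prod_mk h2] with q hq n t he j hj hjn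
    refine (sq_lt_sq₀ (norm_nonneg _) hr₀.le).1 ?_
    rw [linQ_iterate, norm_linQ_sq]
    refine hJ n j _ _ hj hjn (by positivity) hq.1.le ?_
    have h3 := hq.2
    rw [he, linQ_iterate, rotY, linQ_linQ] at h3
    have h4 : ∀ (a s φ : ℝ) (w : E3), (linQ a s φ w) 1 = s * w 1 := by
      intro a s φ w
      simp [linQ]
    rw [h4, one_mul, mul_pow] at h3
    exact h3.le

/-- The transition from `Q` to `P` in coordinates. -/
def transQP (w : E3) : E3 :=
  !₂[1 + C.α 0 * w 0 + C.α 1 * w 1 + C.α 2 * w 2 + C.Htil w 0,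
    C.β 0 * w 0 + C.β 1 * w 1 + C.β 2 * w 2 + C.Htil w 1,
    C.γ 0 * w 0 + C.γ 1 * w 1 + C.γ 2 * w 2 + C.Htil w 2]

/-- The transition from `P` to `Q` in coordinates. -/
def transPQ (w : E3) : E3 :=
  !₂[1 + C.a 0 * w 0 + C.a 1 * w 1 + C.a 2 * w 2 + C.H w 0,
    C.b 0 * w 0 + C.b 1 * w 1 ^ 2 + C.b 2 * w 2 ^ 2 + C.b 3 * (w 1 * w 2) + C.H w 1,
    1 + C.c 0 * w 0 + C.c 1 * w 1 + C.c 2 * w 2 + C.H w 2]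

omit [T2Space M] in
theorem transQP_zero : C.transQP 0 = ptXtil := by
  ext i; fin_cases i <;> simp [transQP, ptXtil, C.Htil_zero]

omit [T2Space M] in
theorem transPQ_zero : C.transPQ 0 = ptYtil := by
  ext i; fin_cases i <;> simp [transPQ, ptYtil, C.H_zero]

omit [T2Space M] in
theorem contDiffAt_transQP : ContDiffAt ℝ r C.transQP 0 := by
  have h := contDiffAt_euclidean.1 C.Htil_contDiff
  have hc := fun i => (contDiff_coord (n := r) i).contDiffAt (x := 0)
  have h0 := hc 0
  have h1 := hc 1
  have h2 := hc 2
  refine contDiffAt_euclidean.2 fun i => ?_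
  have hi := h i
  fin_cases i <;> simp [transQP] at hi ⊢ <;> fun_prop

omit [T2Space M] in
theorem contDiffAt_transPQ : ContDiffAt ℝ r C.transPQ 0 := by
  have h := contDiffAt_euclidean.1 C.H_contDiff
  have hc := fun i => (contDiff_coord (n := r) i).contDiffAt (x := 0)
  have h0 := hc 0
  have h1 := hc 1
  have h2 := hc 2
  refine contDiffAt_euclidean.2 fun i => ?_
  have hi := h i
  fin_cases i <;> simp [transPQ] at hi ⊢ <;> fun_prop

omit [T2Space M] in
theorem box_mem_nhds (z : E3) {ρ : ℝ} (hρ : 0 < ρ) : box z ρ ∈ 𝓝 z := by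
  have : Metric.closedBall z ρ ⊆ box z ρ := fun w hw i => by
    rw [Metric.mem_closedBall, dist_eq_norm] at hw
    exact (PiLp.norm_apply_le (w - z) i).trans hw
  exact mem_of_superset (Metric.closedBall_mem_nhds z hρ) this

theorem eventually_iterate_notMem_V {x : M} {n : ℕ}
    (h : ∀ s, 0 < s → s < n → ∀ i, f^[s] x ≠ C.center i) :
    ∀ᶠ ρ in 𝓝[>] (0 : ℝ), ∀ᶠ y in 𝓝 x, ∀ s, 0 < s → s < n → ∀ i, f^[s] y ∉ C.V ρ i := by
  have e3 : ∀ᶠ q in 𝓝[>] (0 : ℝ) ×ˢ 𝓝 x, ∀ s ∈ Finset.Ioo 0 n, ∀ i, f^[s] q.2 ∉ C.V q.1 i := by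
    simp only [Finset.eventually_all, eventually_all]
    intro s hs i
    rw [Finset.mem_Ioo] at hs
    have : Tendsto (fun q : ℝ × M => (q.1, f^[s] q.2)) (𝓝[>] (0 : ℝ) ×ˢ 𝓝 x)
        (𝓝[>] (0 : ℝ) ×ˢ 𝓝 (f^[s] x)) :=
      tendsto_fst.prodMk (((continuous_iterate s).tendsto x).comp tendsto_snd)
    exact this.eventually (C.eventually_notMem_V (h s hs.1 hs.2 i))
  filter_upwards [e3.curry] with ρ h1
  filter_upwards [h1] with y hy s hs hs' i using hy s (Finset.mem_Ioo.2 ⟨hs, hs'⟩) i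

/-- Between `X` and `Xtil` a perturbed orbit meets no other support, whence the perturbation adds
the translation by the second group of parameters to the transition. -/
theorem eventually_transition_QP (hr : r ≠ 0) :
    ∀ᶠ ρ in 𝓝[>] (0 : ℝ), ∀ᶠ w in 𝓝 (0 : E3), ∀ (F : M → M) (υ : E8),
      (∀ p, F p = C.Γ ρ (bump ρ) υ (f p)) →
        F^[C.N₁] (C.chQ.symm (ptX + w)) = C.chP.symm (C.transQP w + !₂[υ 3, υ 4, υ 5]) := by
  have h1 := C.eventually_iterate_notMem_V (x := C.chQ.symm ptX) (n := C.N₁) fun s hs hs' i =>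
    C.ne_center_of_iterate_eq_heteroPoint hr (i := C.N₁ - s) (by omega) (by
      rw [← Function.iterate_add_apply, Nat.sub_add_cancel hs'.le, C.iterate_N₁]) i
  filter_upwards [h1, C.eventually_pairwise_disjoint_V hr, self_mem_nhdsWithin,
    nhdsWithin_le_nhds (Iio_mem_nhds (show (0 : ℝ) < 1 by norm_num))] with ρ h1 hV hρ hρ1
  have hρ0 : (0 : ℝ) < ρ := hρ
  have hc : Tendsto (fun w : E3 => C.chQ.symm (ptX + w)) (𝓝 0) (𝓝 (C.chQ.symm ptX)) := by
    have h2 : ContinuousAt C.chQ.symm (ptX + 0) := by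
      rw [add_zero]; exact C.chQ.continuousAt_symm (C.cube_Q ptX_mem_cube)
    have := h2.tendsto.comp ((continuous_const_add ptX).tendsto (0 : E3))
    rwa [add_zero] at this
  have hT := C.contDiffAt_transQP.continuousAt.preimage_mem_nhds
    (t := box ptXtil (ρ / 2)) (by rw [C.transQP_zero]; exact box_mem_nhds _ (by positivity))
  filter_upwards [hc.eventually h1, hT, C.transition_QP] with w h2 h3 h4 F υ hF
  rw [C.iterate_of_isolated' hF C.N₁_pos h2, h4]
  exact C.Γ_near_heteroPoint hρ0 hρ1 hV h3

/-- Between `Y` and `Ytil` a perturbed orbit meets no other support, whence the perturbation adds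
the translation by the first group of parameters to the transition. -/
theorem eventually_transition_PQ (hr : r ≠ 0) :
    ∀ᶠ ρ in 𝓝[>] (0 : ℝ), ∀ᶠ w in 𝓝 (0 : E3), ∀ (F : M → M) (υ : E8),
      (∀ p, F p = C.Γ ρ (bump ρ) υ (f p)) →
        F^[C.N₂] (C.chP.symm (ptY + w)) = C.chQ.symm (C.transPQ w + !₂[υ 0, υ 1, υ 2]) := by
  have h1 := C.eventually_iterate_notMem_V (x := C.chP.symm ptY) (n := C.N₂) fun s hs hs' i =>
    C.ne_center_of_iterate_eq_tangencyPoint hr (i := C.N₂ - s) (by omega) (by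
      rw [← Function.iterate_add_apply, Nat.sub_add_cancel hs'.le, C.iterate_N₂]) i
  filter_upwards [h1, C.eventually_pairwise_disjoint_V hr, self_mem_nhdsWithin,
    nhdsWithin_le_nhds (Iio_mem_nhds (show (0 : ℝ) < 1 by norm_num))] with ρ h1 hV hρ hρ1
  have hρ0 : (0 : ℝ) < ρ := hρ
  have hc : Tendsto (fun w : E3 => C.chP.symm (ptY + w)) (𝓝 0) (𝓝 (C.chP.symm ptY)) := by
    have h2 : ContinuousAt C.chP.symm (ptY + 0) := by
      rw [add_zero]; exact C.chP.continuousAt_symm (C.cube_P ptY_mem_cube)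
    have := h2.tendsto.comp ((continuous_const_add ptY).tendsto (0 : E3))
    rwa [add_zero] at this
  have hT := C.contDiffAt_transPQ.continuousAt.preimage_mem_nhds
    (t := box ptYtil (ρ / 2)) (by rw [C.transPQ_zero]; exact box_mem_nhds _ (by positivity))
  filter_upwards [hc.eventually h1, hT, C.transition_PQ] with w h2 h3 h4 F υ hF
  rw [C.iterate_of_isolated' hF C.N₂_pos h2, h4]
  exact C.Γ_near_tangencyPoint hρ0 hρ1 hV h3

end SaddleFocusCycle

end Passage

/-! ### The accumulated rotation during a passage -/

/-- The accumulated weight of the rotations in a passage of `n` returns, as a function of the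
deviations `q.1` and `q.2` from `u₀` and `v₀` of the squared norms of the contracted part at the
beginning and of the expanded part at the end of the passage. -/
def rotSum (ρ lam sig u₀ v₀ : ℝ) (n : ℕ) (q : ℝ × ℝ) : ℝ :=
  ∑ i ∈ Finset.range n, bumpSq ρ ((lam ^ (i + 1)) ^ 2 * (u₀ + q.1) +
    (sig ^ (i + 1)) ^ 2 * ((sig ^ n)⁻¹ ^ 2 * (v₀ + q.2)))

section

variable {ρ lam sig : ℝ}

theorem JetTendsto.fst' {ι : Type*} {r : ℕ} {l : Filter ι} {x : ℝ × ℝ} :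
    JetTendsto r l (fun _ q => q.1) (fun q : ℝ × ℝ => q.1) x := .of_contDiffAt contDiffAt_fst

theorem JetTendsto.snd' {ι : Type*} {r : ℕ} {l : Filter ι} {x : ℝ × ℝ} :
    JetTendsto r l (fun _ q => q.2) (fun q : ℝ × ℝ => q.2) x := .of_contDiffAt contDiffAt_snd

/-- Only boundedly many returns of a passage happen outside the ball where the rotation is rigid. Up
to a divergent constant the accumulated weight thus converges together with its derivatives. -/
theorem exists_jetTendsto_rotSum (hρ : 0 < ρ) (hl : |lam| < 1) (hs : 1 < |sig|) {u₀ v₀ : ℝ}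
    (hu : 0 ≤ u₀) (hv : 0 ≤ v₀) (r : ℕ) :
    ∃ (c : ℕ → ℝ) (G : ℝ × ℝ → ℝ), Tendsto c atTop atTop ∧
      JetTendsto r atTop (fun n q => rotSum ρ lam sig u₀ v₀ n q - c n) G 0 := by
  have hs0 : sig ≠ 0 := abs_pos.1 (by linarith)
  have hsi : |sig⁻¹| < 1 := by rw [abs_inv]; exact inv_lt_one_of_one_lt₀ hs
  -- from the return `J` on, and up to `J` returns before the end, both parts of the squared norm are
  -- less than `ρ ^ 2 / 8`, hence the weight is one
  obtain ⟨J₁, h1⟩ := SaddleFocusCycle.exists_pow_sq_lt hl (ε := ρ ^ 2 / 8 / (u₀ + 1))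
    (by positivity)
  obtain ⟨J₂, h2⟩ := SaddleFocusCycle.exists_pow_sq_lt hsi (ε := ρ ^ 2 / 8 / (v₀ + 1))
    (by positivity)
  set J := max J₁ J₂ with hJ
  -- the weights of the first `J` and of the last `J` returns
  set A : ℕ → ℕ → ℝ × ℝ → ℝ := fun i n q => bumpSq ρ ((lam ^ (i + 1)) ^ 2 * (u₀ + q.1) +
    (sig ^ (i + 1)) ^ 2 * ((sig ^ n)⁻¹ ^ 2 * (v₀ + q.2))) with hA
  set B : ℕ → ℕ → ℝ × ℝ → ℝ := fun k n q => bumpSq ρ ((lam ^ (n - (J - 1 - k))) ^ 2 * (u₀ + q.1) +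
    (sig⁻¹ ^ (J - 1 - k)) ^ 2 * (v₀ + q.2)) with hB
  refine ⟨fun n => (n : ℝ) - 2 * J, fun q =>
    (∑ i ∈ Finset.range J, bumpSq ρ ((lam ^ (i + 1)) ^ 2 * (u₀ + q.1) + 0)) +
      ∑ k ∈ Finset.range J, bumpSq ρ (0 + (sig⁻¹ ^ (J - 1 - k)) ^ 2 * (v₀ + q.2)),
    tendsto_atTop_add_const_right _ _ tendsto_natCast_atTop_atTop, ?_⟩
  have hzl : Tendsto (fun n : ℕ => lam ^ n) atTop (𝓝 0) :=
    tendsto_pow_atTop_nhds_zero_of_abs_lt_one hl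
  have hzs : Tendsto (fun n : ℕ => (sig ^ n)⁻¹) atTop (𝓝 0) := by
    simpa only [inv_pow] using tendsto_pow_atTop_nhds_zero_of_abs_lt_one hsi
  have hbump : ∀ t : ℝ, ContDiffAt ℝ r (bumpSq ρ) t := fun t =>
    (contDiff_bumpSq ρ (n := r)).contDiffAt
  have hAt : ∀ i, JetTendsto r atTop (A i)
      (fun q => bumpSq ρ ((lam ^ (i + 1)) ^ 2 * (u₀ + q.1) + 0)) 0 := by
    intro i
    refine JetTendsto.comp_contDiffAt (hbump _) (JetTendsto.add ?_ ?_)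
    · exact (JetTendsto.const tendsto_const_nhds).mul
        ((JetTendsto.const tendsto_const_nhds).add JetTendsto.fst')
    · have : JetTendsto r atTop (fun n (q : ℝ × ℝ) =>
          (sig ^ (i + 1)) ^ 2 * ((sig ^ n)⁻¹ ^ 2 * (v₀ + q.2)))
          (fun q => (sig ^ (i + 1)) ^ 2 * ((0 : ℝ) ^ 2 * (v₀ + q.2))) 0 :=
        (JetTendsto.const tendsto_const_nhds).mul ((JetTendsto.const (hzs.pow 2)).mul
          ((JetTendsto.const tendsto_const_nhds).add JetTendsto.snd'))
      simpa using this
  have hBt : ∀ k, JetTendsto r atTop (B k)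
      (fun q => bumpSq ρ (0 + (sig⁻¹ ^ (J - 1 - k)) ^ 2 * (v₀ + q.2))) 0 := by
    intro k
    refine JetTendsto.comp_contDiffAt (hbump _) (JetTendsto.add ?_ ?_)
    · have hz : Tendsto (fun n : ℕ => lam ^ (n - (J - 1 - k))) atTop (𝓝 0) :=
        hzl.comp (tendsto_sub_atTop_nat _)
      have : JetTendsto r atTop (fun n (q : ℝ × ℝ) =>
          (lam ^ (n - (J - 1 - k))) ^ 2 * (u₀ + q.1)) (fun q => (0 : ℝ) ^ 2 * (u₀ + q.1)) 0 :=
        (JetTendsto.const (hz.pow 2)).mul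
          ((JetTendsto.const tendsto_const_nhds).add JetTendsto.fst')
      simpa using this
    · exact (JetTendsto.const tendsto_const_nhds).mul
        ((JetTendsto.const tendsto_const_nhds).add JetTendsto.snd')
  refine ((JetTendsto.sum (Finset.range J) fun i _ => hAt i).add
    (JetTendsto.sum (Finset.range J) fun k _ => hBt k)).congr ?_
  have e1 : ∀ᶠ p : ℕ × (ℝ × ℝ) in atTop ×ˢ 𝓝 0, 2 * J ≤ p.1 :=
    tendsto_fst.eventually (eventually_ge_atTop _)
  have hq1 : ∀ᶠ q : ℝ × ℝ in 𝓝 0, q.1 < 1 ∧ q.2 < 1 :=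
    (continuous_fst.continuousAt.eventually (gt_mem_nhds (by simp))).and
      (continuous_snd.continuousAt.eventually (gt_mem_nhds (by simp)))
  have e2 : ∀ᶠ p : ℕ × (ℝ × ℝ) in atTop ×ˢ 𝓝 0, p.2.1 < 1 ∧ p.2.2 < 1 :=
    tendsto_snd.eventually hq1
  filter_upwards [e1, e2] with p hp hq
  obtain ⟨n, q⟩ := p
  simp only at hp hq ⊢
  obtain ⟨m, rfl⟩ := Nat.exists_eq_add_of_le hp
  have hratio : ∀ a b : ℕ, (sig ^ a) ^ 2 * ((sig ^ (a + b))⁻¹ ^ 2 * (v₀ + q.2)) =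
      (sig⁻¹ ^ b) ^ 2 * (v₀ + q.2) := by
    intro a b
    have ha : sig ^ a ≠ 0 := pow_ne_zero _ hs0
    rw [pow_add, mul_inv, inv_pow sig b]
    field_simp
  have hsplit : 2 * J + m = (J + m) + J := by ring
  have hmid : ∀ i ∈ Finset.range m, bumpSq ρ ((lam ^ (J + i + 1)) ^ 2 * (u₀ + q.1) +
      (sig ^ (J + i + 1)) ^ 2 * ((sig ^ (2 * J + m))⁻¹ ^ 2 * (v₀ + q.2))) = 1 := by
    intro i hi
    rw [Finset.mem_range] at hi
    have hn : 2 * J + m = (J + i + 1) + (J + (m - i - 1)) := by omega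
    rw [hn, hratio]
    refine bumpSq_eq_one hρ ?_
    have b1 := h1 (J + i + 1) (by have := le_max_left J₁ J₂; omega)
    have b2 := h2 (J + (m - i - 1)) (by have := le_max_right J₁ J₂; omega)
    rw [lt_div_iff₀ (by positivity)] at b1 b2
    have b3 : (lam ^ (J + i + 1)) ^ 2 * (u₀ + q.1) ≤ (lam ^ (J + i + 1)) ^ 2 * (u₀ + 1) := by
      gcongr; exact hq.1.le
    have b4 : (sig⁻¹ ^ (J + (m - i - 1))) ^ 2 * (v₀ + q.2) ≤
        (sig⁻¹ ^ (J + (m - i - 1))) ^ 2 * (v₀ + 1) := by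
      gcongr; exact hq.2.le
    linarith
  have hlast : ∀ k ∈ Finset.range J, bumpSq ρ ((lam ^ (J + m + k + 1)) ^ 2 * (u₀ + q.1) +
      (sig ^ (J + m + k + 1)) ^ 2 * ((sig ^ (2 * J + m))⁻¹ ^ 2 * (v₀ + q.2))) =
      B k (2 * J + m) q := by
    intro k hk
    rw [Finset.mem_range] at hk
    have hn : 2 * J + m = (J + m + k + 1) + (J - 1 - k) := by omega
    have hn' : 2 * J + m - (J - 1 - k) = J + m + k + 1 := by omega
    simp only [hB, hn']
    conv_lhs => rw [hn, hratio]
  rw [rotSum]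
  conv_lhs => enter [1, 1, 1]; rw [hsplit]
  rw [Finset.sum_range_add, Finset.sum_range_add, Finset.sum_congr rfl hmid,
    Finset.sum_congr rfl hlast]
  simp only [hA, Finset.sum_const, Finset.card_range, nsmul_eq_mul, mul_one]
  push_cast
  ring

/-- A rotation whose rate tends to zero does not contribute to the limit of the rescaled passage. -/
theorem JetTendsto.rotSum_blowup {E : Type*} [NormedAddCommGroup E] [NormedSpace ℝ E] {x : E}
    {r : ℕ} (hr : r ≠ 0) (hρ : 0 < ρ) (hl : |lam| < 1) (hs : 1 < |sig|) {u₀ v₀ : ℝ}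
    (hu : 0 ≤ u₀) (hv : 0 ≤ v₀) {n : ℕ → ℕ} {δ β : ℕ → ℝ}
    (hn : Tendsto n atTop atTop) (hδ : Tendsto δ atTop (𝓝 0)) (hδ0 : ∀ k, δ k ≠ 0)
    (hβ : Tendsto β atTop (𝓝 0)) {U V : ℕ → E → ℝ} {U₀ V₀ : E → ℝ}
    (hU : JetTendsto r atTop U U₀ x) (hV : JetTendsto r atTop V V₀ x) :
    JetTendsto r atTop (fun k w => β k * ((δ k)⁻¹ *
      (rotSum ρ lam sig u₀ v₀ (n k) (δ k * U k w, δ k * V k w) -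
        rotSum ρ lam sig u₀ v₀ (n k) 0))) (fun _ => 0) x := by
  obtain ⟨c, G, -, hG⟩ := exists_jetTendsto_rotSum hρ hl hs hu hv r
  have hG' : JetTendsto r atTop (fun k q => rotSum ρ lam sig u₀ v₀ (n k) q - c (n k)) G 0 :=
    hG.comp_tendsto hn
  have h1 : JetTendsto r atTop (fun k (q : ℝ × ℝ) => (δ k)⁻¹ •
      ((rotSum ρ lam sig u₀ v₀ (n k) (0 + δ k • q) - c (n k)) -
        (rotSum ρ lam sig u₀ v₀ (n k) 0 - c (n k)))) (fun q => _root_.fderiv ℝ G 0 q)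
      (U₀ x, V₀ x) :=
    JetTendsto.blowup hr hG' tendsto_const_nhds hδ (Eventually.of_forall hδ0)
  have h2 : JetTendsto r atTop (fun k w => (δ k)⁻¹ •
      ((rotSum ρ lam sig u₀ v₀ (n k) (0 + δ k • (U k w, V k w)) - c (n k)) -
        (rotSum ρ lam sig u₀ v₀ (n k) 0 - c (n k))))
      (fun w => _root_.fderiv ℝ G 0 (U₀ w, V₀ w)) x :=
    JetTendsto.comp (g := fun k w => (U k w, V k w)) (g₀ := fun w => (U₀ w, V₀ w)) h1
      (hU.prodMk hV)
  have h3 := (JetTendsto.const (x := x) (r := r) hβ).mul h2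
  refine (h3.congr (Eventually.of_forall fun p => ?_)).congr_limit
    (Eventually.of_forall fun w => (zero_mul _).symm)
  have e : (0 : ℝ × ℝ) + δ p.1 • (U p.1 p.2, V p.1 p.2) =
      (δ p.1 * U p.1 p.2, δ p.1 * V p.1 p.2) := by
    rw [zero_add]; rfl
  simp only [e, smul_eq_mul, sub_sub_sub_cancel_right]

theorem tendsto_rotSum_zero (hρ : 0 < ρ) (hl : |lam| < 1) (hs : 1 < |sig|) {u₀ v₀ : ℝ}
    (hu : 0 ≤ u₀) (hv : 0 ≤ v₀) :
    Tendsto (fun n => rotSum ρ lam sig u₀ v₀ n 0) atTop atTop := by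
  obtain ⟨c, G, hc, hG⟩ := exists_jetTendsto_rotSum hρ hl hs hu hv 0
  have hp : Tendsto (fun n : ℕ => (n, (0 : ℝ × ℝ))) atTop (atTop ×ˢ 𝓝 0) :=
    tendsto_id.prodMk tendsto_const_nhds
  refine ((hG.tendsto.comp hp).add_atTop hc).congr fun n => ?_
  simp only [Function.comp_apply, sub_add_cancel]

/-- There is a rotation rate tending to zero for which the total angle of the reference orbit is
prescribed modulo one. -/
theorem exists_rate {S : ℕ → ℝ} (hS : Tendsto S atTop atTop) (φ a : ℝ) {n : ℕ → ℕ} :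
    ∃ β : ℕ → ℝ, Tendsto β atTop (𝓝 0) ∧
      ∀ᶠ k in atTop, ∃ z : ℤ, n k * φ + β k * S k = a + z := by
  -- a correction of the angle by less than one full turn suffices; `S` tends to infinity
  refine ⟨fun k => Int.fract (a - n k * φ) / S k, ?_, ?_⟩
  · refine squeeze_zero_norm' ?_ (tendsto_inv_atTop_zero.comp hS)
    filter_upwards [hS.eventually_gt_atTop 0] with k hk
    rw [Real.norm_eq_abs, abs_div, abs_of_pos hk, Int.abs_fract, Function.comp_apply, ← one_div]
    gcongr
    exact (Int.fract_lt_one _).le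
  · filter_upwards [hS.eventually_gt_atTop 0] with k hk
    refine ⟨-⌊a - n k * φ⌋, ?_⟩
    rw [div_mul_cancel₀ _ hk.ne', Int.fract]
    push_cast
    ring

end

/-! ### The passages in rescaled coordinates -/

section Jets

variable {ι E : Type*} [NormedAddCommGroup E] [NormedSpace ℝ E] {r : ℕ} {l : Filter ι} {x : E}

theorem JetTendsto.coord {g : ι → E → E3} {g₀ : E → E3} (h : JetTendsto r l g g₀ x) (i : Fin 3) :
    JetTendsto r l (fun k y => g k y i) (fun y => g₀ y i) x :=
  JetTendsto.comp_contDiffAt (h := fun w : E3 => w i) (contDiff_coord i).contDiffAt h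

theorem contDiff_vec3 {X : Type*} [NormedAddCommGroup X] [NormedSpace ℝ X] {n : WithTop ℕ∞}
    {f₀ f₁ f₂ : X → ℝ} (h₀ : ContDiff ℝ n f₀) (h₁ : ContDiff ℝ n f₁) (h₂ : ContDiff ℝ n f₂) :
    ContDiff ℝ n (fun y => (!₂[f₀ y, f₁ y, f₂ y] : E3)) := by
  refine contDiff_euclidean.2 fun i => ?_
  fin_cases i <;> simpa

theorem JetTendsto.vec3 {f₀ f₁ f₂ : ι → E → ℝ} {g₀ g₁ g₂ : E → ℝ} (h₀ : JetTendsto r l f₀ g₀ x)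
    (h₁ : JetTendsto r l f₁ g₁ x) (h₂ : JetTendsto r l f₂ g₂ x) :
    JetTendsto r l (fun k y => (!₂[f₀ k y, f₁ k y, f₂ k y] : E3))
      (fun y => !₂[g₀ y, g₁ y, g₂ y]) x :=
  JetTendsto.comp_contDiffAt (h := fun q : ℝ × ℝ × ℝ => (!₂[q.1, q.2.1, q.2.2] : E3))
    (contDiff_vec3 contDiff_fst (contDiff_fst.comp contDiff_snd)
      (contDiff_snd.comp contDiff_snd)).contDiffAt (h₀.prodMk (h₁.prodMk h₂))

theorem JetTendsto.ident : JetTendsto r l (fun _ w => w) (fun w : E => w) x :=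
  .of_contDiffAt contDiffAt_id

/-- The sine of a small angle `2πδτ` in units of `δ`. -/
def blowSin (δ τ : ℝ) : ℝ := δ⁻¹ * Real.sin (2 * Real.pi * (δ * τ))

/-- The deviation from one of the cosine of a small angle `2πδτ` in units of `δ`. -/
def blowCos (δ τ : ℝ) : ℝ := δ⁻¹ * (Real.cos (2 * Real.pi * (δ * τ)) - 1)

theorem JetTendsto.blowSin (hr : r ≠ 0) {δ : ι → ℝ} (hδ : Tendsto δ l (𝓝 0))
    (hδ0 : ∀ k, δ k ≠ 0) {τ : ι → E → ℝ} (hτ : JetTendsto r l τ (fun _ => 0) x) :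
    JetTendsto r l (fun k w => blowSin (δ k) (τ k w)) (fun _ => 0) x := by
  have h1 : JetTendsto r l (fun k (u : ℝ) => (δ k)⁻¹ • (Real.sin (2 * Real.pi * (0 + δ k • u)) -
      Real.sin (2 * Real.pi * 0))) (fun u => _root_.fderiv ℝ
        (fun t => Real.sin (2 * Real.pi * t)) 0 u) 0 :=
    JetTendsto.blowup hr (h := fun _ t => Real.sin (2 * Real.pi * t))
      (JetTendsto.of_contDiffAt (Real.contDiff_sin.comp (by fun_prop)).contDiffAt)
      tendsto_const_nhds hδ (Eventually.of_forall hδ0)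
  refine ((JetTendsto.comp (g := τ) (g₀ := fun _ => 0) h1 hτ).congr
    (Eventually.of_forall fun p => ?_)).congr_limit (Eventually.of_forall fun w => ?_)
  · simp [HetCycle.blowSin]
  · rw [map_zero]

theorem JetTendsto.blowCos (hr : r ≠ 0) {δ : ι → ℝ} (hδ : Tendsto δ l (𝓝 0))
    (hδ0 : ∀ k, δ k ≠ 0) {τ : ι → E → ℝ} (hτ : JetTendsto r l τ (fun _ => 0) x) :
    JetTendsto r l (fun k w => blowCos (δ k) (τ k w)) (fun _ => 0) x := by
  have h1 : JetTendsto r l (fun k (u : ℝ) => (δ k)⁻¹ • (Real.cos (2 * Real.pi * (0 + δ k • u)) -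
      Real.cos (2 * Real.pi * 0))) (fun u => _root_.fderiv ℝ
        (fun t => Real.cos (2 * Real.pi * t)) 0 u) 0 :=
    JetTendsto.blowup hr (h := fun _ t => Real.cos (2 * Real.pi * t))
      (JetTendsto.of_contDiffAt (Real.contDiff_cos.comp (by fun_prop)).contDiffAt)
      tendsto_const_nhds hδ (Eventually.of_forall hδ0)
  refine ((JetTendsto.comp (g := τ) (g₀ := fun _ => 0) h1 hτ).congr
    (Eventually.of_forall fun p => ?_)).congr_limit (Eventually.of_forall fun w => ?_)
  · simp [HetCycle.blowCos]
  · rw [map_zero]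

end Jets

/-- The rescaled coordinates near `Ytil`. -/
def posQ (δ h : ℝ) (w : E3) : E3 := !₂[1 + δ * w 0, h + δ ^ 2 * w 1, 1 + δ * w 2]

/-- The rescaled coordinates near `Xtil`. -/
def posP (e h : ℝ) (v : E3) : E3 := !₂[1 + e * v 0, h + e * v 1, e * v 2]

/-- The passage near `Q` in rescaled coordinates, `S` and `C` being the rescaled sine and cosine of
the rotation relative to the passage of reference. -/
def outQ (δ s' S C : ℝ) (w : E3) : E3 :=
  !₂[-S * (1 + δ * w 0) - C * (1 + δ * w 2) - w 2, s' * w 1,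
    w 0 + C * (1 + δ * w 0) - S * (1 + δ * w 2)]

/-- The passage near `P` in rescaled coordinates. -/
def outP (δ s e l S C : ℝ) (v : E3) : E3 :=
  !₂[δ * (l * (1 + e * v 0)),
    C - S + s / √2 * ((1 + δ * C - δ * S) * v 1 - (1 + δ * C + δ * S) * v 2),
    C + S + s / √2 * ((1 + δ * C + δ * S) * v 1 + (1 + δ * C - δ * S) * v 2)]

/-- After a rotation by a quarter turn, up to the angle `2πδτ`, the image under the linear map of
the point with rescaled coordinates `w`. -/
theorem linQ_posQ {δ ε h s τ θ : ℝ} {z : ℤ} (hδ : δ ≠ 0) (hh : h ≠ 0) (hs : s ≠ 0)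
    (hδs : δ * s = ε * h) (hθ : θ = 1 / 4 + z + δ * τ) (w : E3) :
    linQ ε h⁻¹ θ (posQ δ h w) =
      ptX + (ε • !₂[-1, 0, 1] + (ε * δ) • outQ δ s⁻¹ (blowSin δ τ) (blowCos δ τ) w) := by
  have hang : 2 * Real.pi * θ = (2 * Real.pi * (δ * τ) + Real.pi / 2) + z * (2 * Real.pi) := by
    rw [hθ]; ring
  have hc : Real.cos (2 * Real.pi * θ) = -(δ * blowSin δ τ) := by
    rw [hang, Real.cos_add_int_mul_two_pi, Real.cos_add_pi_div_two, blowSin,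
      mul_inv_cancel_left₀ hδ]
  have hsn : Real.sin (2 * Real.pi * θ) = 1 + δ * blowCos δ τ := by
    rw [hang, Real.sin_add_int_mul_two_pi, Real.sin_add_pi_div_two, blowCos,
      mul_inv_cancel_left₀ hδ]
    ring
  have h1 : h⁻¹ * (h + δ ^ 2 * w 1) = 1 + ε * δ * (s⁻¹ * w 1) := by
    field_simp
    linear_combination δ * w 1 * hδs
  ext i
  fin_cases i
  · simp [linQ, posQ, outQ, ptX, hc, hsn]; ring
  · simpa [linQ, posQ, outQ, ptX] using h1
  · simp [linQ, posQ, outQ, ptX, hc, hsn]; ring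

/-- After a rotation by an eighth of a turn, up to the angle `2πδτ`, the image under the linear map
of the point with rescaled coordinates `v`. -/
theorem linP_posP {δ ε h s l τ θ : ℝ} {z : ℤ} (hδ : δ ≠ 0) (hh : h ≠ 0) (hs : ε = s * h)
    (hθ : θ = 1 / 8 + z + δ * τ) (v : E3) :
    linP (δ ^ 2 * l) h⁻¹ θ (posP (ε * δ) (√2 * h) v) =
      ptY + δ • outP δ s (ε * δ) l (blowSin δ τ) (blowCos δ τ) v := by
  have h2 : √2 ≠ 0 := by positivity
  have h22 : √2 ^ 2 = 2 := Real.sq_sqrt (by norm_num)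
  have hang : 2 * Real.pi * θ = (2 * Real.pi * (δ * τ) + Real.pi / 4) + z * (2 * Real.pi) := by
    rw [hθ]; ring
  have hC : Real.cos (2 * Real.pi * (δ * τ)) = 1 + δ * blowCos δ τ := by
    rw [blowCos, mul_inv_cancel_left₀ hδ]; ring
  have hS : Real.sin (2 * Real.pi * (δ * τ)) = δ * blowSin δ τ := by
    rw [blowSin, mul_inv_cancel_left₀ hδ]
  have hc : Real.cos (2 * Real.pi * θ) = (1 + δ * blowCos δ τ - δ * blowSin δ τ) / √2 := by
    rw [hang, Real.cos_add_int_mul_two_pi, Real.cos_add, Real.cos_pi_div_four,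
      Real.sin_pi_div_four, hC, hS]
    field_simp
    rw [h22]
  have hsn : Real.sin (2 * Real.pi * θ) = (1 + δ * blowCos δ τ + δ * blowSin δ τ) / √2 := by
    rw [hang, Real.sin_add_int_mul_two_pi, Real.sin_add, Real.cos_pi_div_four,
      Real.sin_pi_div_four, hC, hS]
    field_simp
    rw [h22]
    ring
  ext i
  fin_cases i
  · simp [linP, posP, outP, ptY]; ring
  · simp [linP, posP, outP, ptY, hc, hsn, hs]
    field_simp
    ring
  · simp [linP, posP, outP, ptY, hc, hsn, hs]
    field_simp
    ring

theorem sum_bump_linQ {ρ lam sig φ : ℝ} (hs : sig ≠ 0) (u₀ v₀ : ℝ) (n : ℕ) (w : E3) :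
    ∑ i ∈ Finset.range n, bump ρ ‖(linQ lam sig φ)^[i + 1] w‖ =
      rotSum ρ lam sig u₀ v₀ n (w 0 ^ 2 + w 2 ^ 2 - u₀, (sig ^ n * w 1) ^ 2 - v₀) := by
  refine Finset.sum_congr rfl fun i _ => ?_
  have := pow_ne_zero n hs
  rw [linQ_iterate, bump, norm_linQ_sq]
  congr 2
  · ring
  · simp only [add_sub_cancel]
    field_simp

theorem sum_bump_linP {ρ lam sig φ : ℝ} (hs : sig ≠ 0) (u₀ v₀ : ℝ) (n : ℕ) (w : E3) :
    ∑ i ∈ Finset.range n, bump ρ ‖(linP lam sig φ)^[i + 1] w‖ =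
      rotSum ρ lam sig u₀ v₀ n (w 0 ^ 2 - u₀, (sig ^ n) ^ 2 * (w 1 ^ 2 + w 2 ^ 2) - v₀) := by
  refine Finset.sum_congr rfl fun i _ => ?_
  have := pow_ne_zero n hs
  rw [linP_iterate, bump, norm_linP_sq]
  congr 2
  · ring
  · simp only [add_sub_cancel]
    field_simp

theorem contDiff_outQ {n : WithTop ℕ∞} : ContDiff ℝ n (fun q : ℝ × ℝ × ℝ × ℝ × E3 =>
    outQ q.1 q.2.1 q.2.2.1 q.2.2.2.1 q.2.2.2.2) := by
  have h := fun i => (contDiff_coord (n := n) i).comp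
    (contDiff_snd.comp (contDiff_snd.comp (contDiff_snd.comp contDiff_snd)) :
      ContDiff ℝ n (fun q : ℝ × ℝ × ℝ × ℝ × E3 => q.2.2.2.2))
  simp only [Function.comp_def] at h
  have h0 := h 0
  have h1 := h 1
  have h2 := h 2
  exact contDiff_vec3 (by fun_prop) (by fun_prop) (by fun_prop)

theorem contDiff_outP {n : WithTop ℕ∞} : ContDiff ℝ n (fun q : ℝ × ℝ × ℝ × ℝ × ℝ × ℝ × E3 =>
    outP q.1 q.2.1 q.2.2.1 q.2.2.2.1 q.2.2.2.2.1 q.2.2.2.2.2.1 q.2.2.2.2.2.2) := by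
  have h := fun i => (contDiff_coord (n := n) i).comp
    (contDiff_snd.comp (contDiff_snd.comp (contDiff_snd.comp (contDiff_snd.comp
      (contDiff_snd.comp contDiff_snd)))) :
      ContDiff ℝ n (fun q : ℝ × ℝ × ℝ × ℝ × ℝ × ℝ × E3 => q.2.2.2.2.2.2))
  simp only [Function.comp_def] at h
  have h0 := h 0
  have h1 := h 1
  have h2 := h 2
  exact contDiff_vec3 (by fun_prop) (by fun_prop) (by fun_prop)

/-! ### The renormalised return map -/

/-- The data of a return: the point makes `2 * n` returns near `Q` and `2 * m` returns near `P`,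
perturbed by rotations of parameters `β` and `α`. The even numbers make the signs of the
eigenvalues irrelevant. -/
structure Itinerary where
  m : ℕ
  n : ℕ
  α : ℝ
  β : ℝ

section Renormalization

variable {M : Type*} [TopologicalSpace M]

namespace SaddleFocusCycle

variable [ChartedSpace E3 M] {r : ℕ} {f : M ≃ₘ^r⟮𝓡 3, 𝓡 3⟯ M} (C : SaddleFocusCycle r f)
  (ρ : ℝ) (σ : Itinerary) (μ : ℝ)

/-- The reciprocal of the expansion during the passage near `P`. -/
def hP : ℝ := (C.sigP ^ (2 * σ.m))⁻¹

/-- The reciprocal of the expansion during the passage near `Q`. -/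
def hQ : ℝ := (C.sigQ ^ (2 * σ.n))⁻¹

/-- The contraction during the passage near `Q`. -/
def eps : ℝ := C.lamQ ^ (2 * σ.n)

/-- The scale of the renormalisation. -/
def del : ℝ := C.hP σ * C.hQ σ

/-- The ratio of the contraction near `Q` to the reciprocal of the expansion near `P`. -/
def rat : ℝ := C.eps σ / C.hP σ

/-- The contraction during the passage near `P` in units of the square of the scale. -/
def lam2 : ℝ := C.lamP ^ (2 * σ.m) / C.del σ ^ 2

/-- The rotation near `Q` relative to the passage of reference, in units of the scale. -/
def tauQ (w : E3) : ℝ :=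
  σ.β * ((C.del σ)⁻¹ * (rotSum ρ C.lamQ C.sigQ 2 1 (2 * σ.n)
    (C.del σ * (2 * w 0 + 2 * w 2 + C.del σ * (w 0 ^ 2 + w 2 ^ 2)),
      C.del σ * (2 * C.hP σ * w 1 + C.del σ * C.hP σ ^ 2 * w 1 ^ 2)) -
    rotSum ρ C.lamQ C.sigQ 2 1 (2 * σ.n) 0))

/-- The rotation near `P` relative to the passage of reference, in units of the scale. -/
def tauP (v : E3) : ℝ :=
  σ.α * ((C.del σ)⁻¹ * (rotSum ρ C.lamP C.sigP 1 2 (2 * σ.m)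
    (C.del σ * (2 * C.eps σ * v 0 + C.eps σ ^ 2 * C.del σ * v 0 ^ 2),
      C.del σ * (2 * √2 * C.rat σ * v 1 + C.rat σ ^ 2 * C.del σ * (v 1 ^ 2 + v 2 ^ 2))) -
    rotSum ρ C.lamP C.sigP 1 2 (2 * σ.m) 0))

/-- The passage near `Q` in rescaled coordinates. -/
def stageQ (w : E3) : E3 :=
  outQ (C.del σ) (C.rat σ)⁻¹ (blowSin (C.del σ) (C.tauQ ρ σ w)) (blowCos (C.del σ) (C.tauQ ρ σ w)) w

/-- The displacement from `X` of the end of the passage of reference near `Q`. -/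
def refX : E3 := C.eps σ • !₂[-1, 0, 1]

/-- The transition from `Q` to `P` in rescaled coordinates. -/
def stageX (u : E3) : E3 :=
  (C.eps σ * C.del σ)⁻¹ •
    (C.transQP (C.refX σ + (C.eps σ * C.del σ) • u) - C.transQP (C.refX σ))

/-- The translation at `Xtil` that makes the passage of reference near `P` end close to `Y`. -/
def nu : E3 := !₂[1, √2 * C.hP σ, 0] - C.transQP (C.refX σ)

/-- The passage near `P` in rescaled coordinates. -/
def stageP (v : E3) : E3 :=
  outP (C.del σ) (C.rat σ) (C.eps σ * C.del σ) (C.lam2 σ) (blowSin (C.del σ) (C.tauP ρ σ v))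
    (blowCos (C.del σ) (C.tauP ρ σ v)) v

/-- The transition from `P` to `Q` in rescaled coordinates. -/
def stageY (t : E3) : E3 :=
  !₂[C.a 0 * t 0 + C.a 1 * t 1 + C.a 2 * t 2 + (C.del σ)⁻¹ * C.H (C.del σ • t) 0,
    C.b 0 * ((C.del σ)⁻¹ * t 0) + (C.b 1 * t 1 ^ 2 + C.b 2 * t 2 ^ 2 + C.b 3 * (t 1 * t 2)) +
      (C.del σ ^ 2)⁻¹ * C.H (C.del σ • t) 1 + μ,
    C.c 0 * t 0 + C.c 1 * t 1 + C.c 2 * t 2 + (C.del σ)⁻¹ * C.H (C.del σ • t) 2]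

/-- The return map in rescaled coordinates. -/
def renorm (w : E3) : E3 := C.stageY σ μ (C.stageP ρ σ (C.stageX σ (C.stageQ ρ σ w)))

/-- The parameter of the unfolding family for which the return has a renormalisation. -/
def param : E8 :=
  !₂[0, C.hQ σ + C.del σ ^ 2 * μ, 0, C.nu σ 0, C.nu σ 1, C.nu σ 2, σ.α, σ.β]

theorem hP_pos : 0 < C.hP σ :=
  inv_pos.2 ((even_two_mul _).pow_pos (abs_pos.1 (by linarith [C.sigP_gt])))

theorem hQ_pos : 0 < C.hQ σ :=
  inv_pos.2 ((even_two_mul _).pow_pos (abs_pos.1 (by linarith [C.sigQ_gt])))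

theorem hQ_le_one : C.hQ σ ≤ 1 := by
  refine inv_le_one_of_one_le₀ ?_
  rw [← (even_two_mul σ.n).pow_abs]
  exact one_le_pow₀ C.sigQ_gt.le

theorem eps_pos : 0 < C.eps σ := (even_two_mul _).pow_pos (abs_pos.1 C.lamQ_ne)

theorem del_pos : 0 < C.del σ := mul_pos (C.hP_pos σ) (C.hQ_pos σ)

theorem rat_pos : 0 < C.rat σ := div_pos (C.eps_pos σ) (C.hP_pos σ)

theorem eps_eq : C.eps σ = C.rat σ * C.hP σ := (div_mul_cancel₀ _ (C.hP_pos σ).ne').symm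

theorem del_mul_rat : C.del σ * C.rat σ = C.eps σ * C.hQ σ := by
  rw [C.eps_eq, del]; ring

theorem rotY_iterate_posQ {z : ℤ}
    (hz : ((2 * σ.n : ℕ) : ℝ) * C.phiQ + σ.β * rotSum ρ C.lamQ C.sigQ 2 1 (2 * σ.n) 0 = 1 / 4 + z)
    (w : E3) :
    rotY (σ.β * ∑ i ∈ Finset.range (2 * σ.n),
        bump ρ ‖(linQ C.lamQ C.sigQ C.phiQ)^[i + 1] (posQ (C.del σ) (C.hQ σ) w)‖)
      ((linQ C.lamQ C.sigQ C.phiQ)^[2 * σ.n] (posQ (C.del σ) (C.hQ σ) w)) =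
      ptX + (C.refX σ + (C.eps σ * C.del σ) • C.stageQ ρ σ w) := by
  have hs : C.sigQ ≠ 0 := abs_pos.1 (by linarith [C.sigQ_gt])
  have hδ := (C.del_pos σ).ne'
  have hh := (C.hQ_pos σ).ne'
  have hsig : C.sigQ ^ (2 * σ.n) = (C.hQ σ)⁻¹ := (inv_inv _).symm
  rw [sum_bump_linQ hs 2 1, linQ_iterate, rotY, linQ_linQ, one_mul, one_mul, hsig]
  refine linQ_posQ (z := z) (τ := C.tauQ ρ σ w) hδ hh (C.rat_pos σ).ne' (C.del_mul_rat σ) ?_ w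
  have e1 : posQ (C.del σ) (C.hQ σ) w 0 ^ 2 + posQ (C.del σ) (C.hQ σ) w 2 ^ 2 - 2 =
      C.del σ * (2 * w 0 + 2 * w 2 + C.del σ * (w 0 ^ 2 + w 2 ^ 2)) := by
    simp [posQ]; ring
  have e2 : ((C.hQ σ)⁻¹ * posQ (C.del σ) (C.hQ σ) w 1) ^ 2 - 1 =
      C.del σ * (2 * C.hP σ * w 1 + C.del σ * C.hP σ ^ 2 * w 1 ^ 2) := by
    simp [posQ, del]; field_simp; ring
  rw [e1, e2, tauQ, ← hz]
  field_simp
  ring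

theorem transQP_add_nu (u : E3) :
    C.transQP (C.refX σ + (C.eps σ * C.del σ) • u) + C.nu σ =
      posP (C.eps σ * C.del σ) (√2 * C.hP σ) (C.stageX σ u) := by
  have h0 : C.eps σ * C.del σ ≠ 0 := (mul_pos (C.eps_pos σ) (C.del_pos σ)).ne'
  have h1 : posP (C.eps σ * C.del σ) (√2 * C.hP σ) (C.stageX σ u) =
      !₂[1, √2 * C.hP σ, 0] + (C.eps σ * C.del σ) • C.stageX σ u := by
    ext i; fin_cases i <;> simp [posP]
  rw [h1, stageX, smul_inv_smul₀ h0, nu]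
  abel

theorem rotX_iterate_posP {z : ℤ}
    (hz : ((2 * σ.m : ℕ) : ℝ) * C.phiP + σ.α * rotSum ρ C.lamP C.sigP 1 2 (2 * σ.m) 0 = 1 / 8 + z)
    (v : E3) :
    rotX (σ.α * ∑ i ∈ Finset.range (2 * σ.m), bump ρ ‖(linP C.lamP C.sigP C.phiP)^[i + 1]
        (posP (C.eps σ * C.del σ) (√2 * C.hP σ) v)‖)
      ((linP C.lamP C.sigP C.phiP)^[2 * σ.m] (posP (C.eps σ * C.del σ) (√2 * C.hP σ) v)) =
      ptY + C.del σ • C.stageP ρ σ v := by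
  have hs : C.sigP ≠ 0 := abs_pos.1 (by linarith [C.sigP_gt])
  have hδ := (C.del_pos σ).ne'
  have hh := (C.hP_pos σ).ne'
  have hsig : C.sigP ^ (2 * σ.m) = (C.hP σ)⁻¹ := (inv_inv _).symm
  have hlam : C.lamP ^ (2 * σ.m) = C.del σ ^ 2 * C.lam2 σ := by
    rw [lam2, mul_div_cancel₀ _ (pow_ne_zero 2 hδ)]
  rw [sum_bump_linP hs 1 2, linP_iterate, rotX, linP_linP, one_mul, one_mul, hsig, hlam]
  refine linP_posP (z := z) (τ := C.tauP ρ σ v) hδ hh (C.eps_eq σ) ?_ v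
  have h22 : √2 ^ 2 = 2 := Real.sq_sqrt (by norm_num)
  have e1 : posP (C.eps σ * C.del σ) (√2 * C.hP σ) v 0 ^ 2 - 1 =
      C.del σ * (2 * C.eps σ * v 0 + C.eps σ ^ 2 * C.del σ * v 0 ^ 2) := by
    simp [posP]; ring
  have e2 : (C.hP σ)⁻¹ ^ 2 * (posP (C.eps σ * C.del σ) (√2 * C.hP σ) v 1 ^ 2 +
      posP (C.eps σ * C.del σ) (√2 * C.hP σ) v 2 ^ 2) - 2 =
      C.del σ * (2 * √2 * C.rat σ * v 1 + C.rat σ ^ 2 * C.del σ * (v 1 ^ 2 + v 2 ^ 2)) := by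
    simp [posP, C.eps_eq]
    field_simp
    linear_combination h22
  rw [e1, e2, tauP, ← hz]
  field_simp
  ring

theorem transPQ_add (t : E3) :
    C.transPQ (C.del σ • t) + !₂[0, C.hQ σ + C.del σ ^ 2 * μ, 0] =
      posQ (C.del σ) (C.hQ σ) (C.stageY σ μ t) := by
  have hδ := (C.del_pos σ).ne'
  ext i
  fin_cases i
  · simp [transPQ, posQ, stageY]; field_simp; ring
  · simp [transPQ, posQ, stageY]; field_simp; ring
  · simp [transPQ, posQ, stageY]; field_simp; ring

theorem fderiv_transQP_apply (hr : r ≠ 0) (u : E3) :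
    fderiv ℝ C.transQP 0 u 1 = C.β 1 * u 1 ∧ fderiv ℝ C.transQP 0 u 2 = C.γ 2 * u 2 := by
  have hT := (C.contDiffAt_transQP.differentiableAt (by exact_mod_cast hr)).hasFDerivAt
  have hH := (C.Htil_contDiff.differentiableAt (by exact_mod_cast hr)).hasFDerivAt
  rw [C.Htil_fderiv] at hH
  have hp := fun i : Fin 3 => (EuclideanSpace.proj i : E3 →L[ℝ] ℝ).hasFDerivAt (x := (0 : E3))
  have hHi := fun i : Fin 3 => (EuclideanSpace.proj i : E3 →L[ℝ] ℝ).hasFDerivAt.comp (0 : E3) hH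
  have hTi := fun i : Fin 3 => (EuclideanSpace.proj i : E3 →L[ℝ] ℝ).hasFDerivAt.comp (0 : E3) hT
  have key : ∀ (i : Fin 3) (a : Fin 3 → ℝ), (∀ w, C.transQP w i =
      a 0 * w 0 + a 1 * w 1 + a 2 * w 2 + C.Htil w i) →
      fderiv ℝ C.transQP 0 u i = a 0 * u 0 + a 1 * u 1 + a 2 * u 2 := by
    intro i a h
    have h1 := ((((hp 0).const_mul (a 0)).add ((hp 1).const_mul (a 1))).add
      ((hp 2).const_mul (a 2))).add (hHi i)
    have h2 := (hTi i).unique (h1.congr_of_eventuallyEq (Eventually.of_forall fun w => h w))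
    simpa using congrArg (fun L : E3 →L[ℝ] ℝ => L u) h2
  constructor
  · rw [key 1 C.β fun w => by simp [transQP], C.β_one, C.β_three]; ring
  · rw [key 2 C.γ fun w => by simp [transQP], C.γ_one, C.γ_two]; ring

/-- The second derivative of the second component of the remainder of the transition from `P` to
`Q` vanishes on the unstable plane of `P`. -/
theorem fderiv_fderiv_H (hr : 2 ≤ r) (y z : ℝ) :
    fderiv ℝ (fderiv ℝ (fun w => C.H w 1)) 0 !₂[0, y, z] !₂[0, y, z] = 0 := by
  have hh : ContDiffAt ℝ r (fun w => C.H w 1) 0 :=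
    (contDiff_coord 1).contDiffAt.comp (0 : E3) C.H_contDiff
  have hsymm := hh.isSymmSndFDerivAt (by
    rw [minSmoothness_of_isRCLikeNormedField]; exact_mod_cast hr)
  have h1 := C.H_yy
  have h2 := C.H_zz
  have h3 := C.H_yz
  rw [iteratedFDeriv_two_apply] at h1 h2 h3
  simp only [Matrix.cons_val_zero, Matrix.cons_val_one] at h1 h2 h3
  have h4 := hsymm.eq !₂[0, 0, 1] !₂[0, 1, 0]
  rw [h3] at h4
  have e : (!₂[0, y, z] : E3) = y • !₂[0, 1, 0] + z • !₂[0, 0, 1] := by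
    ext i; fin_cases i <;> simp
  rw [e]
  simp [h1, h2, h3, h4]

end SaddleFocusCycle

end Renormalization

/-! ### Convergence of the renormalised return maps -/

section Renormalization

variable {M : Type*} [TopologicalSpace M]

namespace SaddleFocusCycle

variable [ChartedSpace E3 M] {r : ℕ} {f : M ≃ₘ^r⟮𝓡 3, 𝓡 3⟯ M} (C : SaddleFocusCycle r f)
  {ρ s : ℝ} {σ : ℕ → Itinerary}

/-- A sequence of ever longer returns for which the contraction near `Q` balances the expansion near
`P`, with small rotations such that the reference orbits turn by a quarter near `Q` and by an eighth
near `P`. -/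
structure Resonant (ρ s : ℝ) (σ : ℕ → Itinerary) : Prop where
  s_pos : 0 < s
  m : Tendsto (fun k => 2 * (σ k).m) atTop atTop
  n : Tendsto (fun k => 2 * (σ k).n) atTop atTop
  rat : Tendsto (fun k => C.rat (σ k)) atTop (𝓝 s)
  lam2 : Tendsto (fun k => C.lam2 (σ k)) atTop (𝓝 0)
  α : Tendsto (fun k => (σ k).α) atTop (𝓝 0)
  β : Tendsto (fun k => (σ k).β) atTop (𝓝 0)
  angle_P : ∀ᶠ k in atTop, ∃ z : ℤ, ((2 * (σ k).m : ℕ) : ℝ) * C.phiP +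
    (σ k).α * rotSum ρ C.lamP C.sigP 1 2 (2 * (σ k).m) 0 = 1 / 8 + z
  angle_Q : ∀ᶠ k in atTop, ∃ z : ℤ, ((2 * (σ k).n : ℕ) : ℝ) * C.phiQ +
    (σ k).β * rotSum ρ C.lamQ C.sigQ 2 1 (2 * (σ k).n) 0 = 1 / 4 + z

variable {C}

namespace Resonant

variable (h : C.Resonant ρ s σ)

include h

theorem hP : Tendsto (fun k => C.hP (σ k)) atTop (𝓝 0) := by
  have : |C.sigP⁻¹| < 1 := by rw [abs_inv]; exact inv_lt_one_of_one_lt₀ C.sigP_gt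
  simpa [SaddleFocusCycle.hP, Function.comp_def] using
    (tendsto_pow_atTop_nhds_zero_of_abs_lt_one this).comp h.m

theorem hQ : Tendsto (fun k => C.hQ (σ k)) atTop (𝓝 0) := by
  have : |C.sigQ⁻¹| < 1 := by rw [abs_inv]; exact inv_lt_one_of_one_lt₀ C.sigQ_gt
  simpa [SaddleFocusCycle.hQ, Function.comp_def] using
    (tendsto_pow_atTop_nhds_zero_of_abs_lt_one this).comp h.n

theorem eps : Tendsto (fun k => C.eps (σ k)) atTop (𝓝 0) :=
  (tendsto_pow_atTop_nhds_zero_of_abs_lt_one C.lamQ_lt).comp h.n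

theorem del : Tendsto (fun k => C.del (σ k)) atTop (𝓝 0) := by
  have := h.hP.mul h.hQ
  rwa [mul_zero] at this

theorem eps_mul_del : Tendsto (fun k => C.eps (σ k) * C.del (σ k)) atTop (𝓝 0) := by
  simpa using h.eps.mul h.del

theorem refX : Tendsto (fun k => C.refX (σ k)) atTop (𝓝 0) := by
  have := h.eps.smul_const (!₂[-1, 0, 1] : E3)
  rwa [zero_smul] at this

theorem jet_tauQ (hr : r ≠ 0) (hρ : 0 < ρ) (x : E3) :
    JetTendsto r atTop (fun k w => C.tauQ ρ (σ k) w) (fun _ => 0) x := by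
  have hc := fun i => JetTendsto.ident.coord (r := r) (l := atTop (α := ℕ)) (x := x) i
  have hcst : ∀ {c : ℕ → ℝ} {c₀ : ℝ}, Tendsto c atTop (𝓝 c₀) →
      JetTendsto r atTop (fun k _ => c k) (fun _ => c₀) x := JetTendsto.const
  have hU : JetTendsto r atTop
      (fun k (w : E3) => 2 * w 0 + 2 * w 2 + C.del (σ k) * (w 0 ^ 2 + w 2 ^ 2))
      (fun w => 2 * w 0 + 2 * w 2 + 0 * (w 0 ^ 2 + w 2 ^ 2)) x := by
    exact (((hcst tendsto_const_nhds).mul (hc 0)).add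
      ((hcst tendsto_const_nhds).mul (hc 2))).add
      ((hcst h.del).mul ((hc 0).sq.add (hc 2).sq))
  have hV : JetTendsto r atTop
      (fun k (w : E3) => 2 * C.hP (σ k) * w 1 + C.del (σ k) * C.hP (σ k) ^ 2 * w 1 ^ 2)
      (fun w => 2 * 0 * w 1 + 0 * 0 ^ 2 * w 1 ^ 2) x := by
    exact ((hcst (h.hP.const_mul 2)).mul (hc 1)).add
      ((hcst (h.del.mul (h.hP.pow 2))).mul (hc 1).sq)
  exact JetTendsto.rotSum_blowup hr hρ C.lamQ_lt C.sigQ_gt zero_le_two zero_le_one h.n h.del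
    (fun k => (C.del_pos _).ne') h.β hU hV

theorem jet_stageQ (hr : r ≠ 0) (hρ : 0 < ρ) (x : E3) :
    JetTendsto r atTop (fun k w => C.stageQ ρ (σ k) w) (fun w => !₂[-w 2, s⁻¹ * w 1, w 0]) x := by
  have hτ := h.jet_tauQ hr hρ x
  have hδ0 : ∀ k, C.del (σ k) ≠ 0 := fun k => (C.del_pos _).ne'
  refine (JetTendsto.comp_contDiffAt (h := fun q : ℝ × ℝ × ℝ × ℝ × E3 =>
      outQ q.1 q.2.1 q.2.2.1 q.2.2.2.1 q.2.2.2.2) contDiff_outQ.contDiffAt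
    ((JetTendsto.const h.del).prodMk ((JetTendsto.const (h.rat.inv₀ h.s_pos.ne')).prodMk
      ((JetTendsto.blowSin hr h.del hδ0 hτ).prodMk
        ((JetTendsto.blowCos hr h.del hδ0 hτ).prodMk JetTendsto.ident))))).congr_limit
    (Eventually.of_forall fun w => ?_)
  simp [outQ]

theorem jet_stageX (hr : r ≠ 0) (x : E3) :
    JetTendsto r atTop (fun k u => C.stageX (σ k) u) (fun u => fderiv ℝ C.transQP 0 u) x :=
  JetTendsto.blowup hr (h := fun _ => C.transQP) (JetTendsto.of_contDiffAt C.contDiffAt_transQP)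
    h.refX h.eps_mul_del
    (Eventually.of_forall fun _ => (mul_pos (C.eps_pos _) (C.del_pos _)).ne')

theorem jet_tauP (hr : r ≠ 0) (hρ : 0 < ρ) (x : E3) :
    JetTendsto r atTop (fun k v => C.tauP ρ (σ k) v) (fun _ => 0) x := by
  have hc := fun i => JetTendsto.ident.coord (r := r) (l := atTop (α := ℕ)) (x := x) i
  have hcst : ∀ {c : ℕ → ℝ} {c₀ : ℝ}, Tendsto c atTop (𝓝 c₀) →
      JetTendsto r atTop (fun k _ => c k) (fun _ => c₀) x := JetTendsto.const
  have hU : JetTendsto r atTop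
      (fun k (v : E3) => 2 * C.eps (σ k) * v 0 + C.eps (σ k) ^ 2 * C.del (σ k) * v 0 ^ 2)
      (fun v => 2 * 0 * v 0 + 0 ^ 2 * 0 * v 0 ^ 2) x := by
    exact ((hcst (h.eps.const_mul 2)).mul (hc 0)).add
      ((hcst ((h.eps.pow 2).mul h.del)).mul (hc 0).sq)
  have hV : JetTendsto r atTop (fun k (v : E3) => 2 * √2 * C.rat (σ k) * v 1 +
      C.rat (σ k) ^ 2 * C.del (σ k) * (v 1 ^ 2 + v 2 ^ 2))
      (fun v => 2 * √2 * s * v 1 + s ^ 2 * 0 * (v 1 ^ 2 + v 2 ^ 2)) x := by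
    exact ((hcst (h.rat.const_mul (2 * √2))).mul (hc 1)).add
      ((hcst ((h.rat.pow 2).mul h.del)).mul ((hc 1).sq.add (hc 2).sq))
  exact JetTendsto.rotSum_blowup hr hρ C.lamP_lt C.sigP_gt zero_le_one zero_le_two h.m h.del
    (fun k => (C.del_pos _).ne') h.α hU hV

theorem jet_stageP (hr : r ≠ 0) (hρ : 0 < ρ) (x : E3) :
    JetTendsto r atTop (fun k v => C.stageP ρ (σ k) v)
      (fun v => !₂[0, s / √2 * (v 1 - v 2), s / √2 * (v 1 + v 2)]) x := by
  have hτ := h.jet_tauP hr hρ x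
  have hδ0 : ∀ k, C.del (σ k) ≠ 0 := fun k => (C.del_pos _).ne'
  refine (JetTendsto.comp_contDiffAt (h := fun q : ℝ × ℝ × ℝ × ℝ × ℝ × ℝ × E3 =>
      outP q.1 q.2.1 q.2.2.1 q.2.2.2.1 q.2.2.2.2.1 q.2.2.2.2.2.1 q.2.2.2.2.2.2)
      contDiff_outP.contDiffAt
    ((JetTendsto.const h.del).prodMk ((JetTendsto.const h.rat).prodMk
      ((JetTendsto.const h.eps_mul_del).prodMk ((JetTendsto.const h.lam2).prodMk
      ((JetTendsto.blowSin hr h.del hδ0 hτ).prodMk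
        ((JetTendsto.blowCos hr h.del hδ0 hτ).prodMk JetTendsto.ident))))))).congr_limit
    (Eventually.of_forall fun w => ?_)
  simp [outP]

/-- The contraction near `P` is negligible even in units of the square of the scale. -/
theorem jet_stageP_zero (x : E3) :
    JetTendsto r atTop (fun k v => (C.del (σ k))⁻¹ * C.stageP ρ (σ k) v 0) (fun _ => 0) x := by
  have h1 : JetTendsto r atTop (fun k (v : E3) => C.lam2 (σ k) *
      (1 + C.eps (σ k) * C.del (σ k) * v 0)) (fun v => 0 * (1 + 0 * v 0)) x :=
    (JetTendsto.const h.lam2).mul ((JetTendsto.const tendsto_const_nhds).add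
      ((JetTendsto.const h.eps_mul_del).mul (JetTendsto.ident.coord 0)))
  refine (h1.congr (Eventually.of_forall fun p => ?_)).congr_limit
    (Eventually.of_forall fun w => (zero_mul _).symm)
  simp [stageP, outP, inv_mul_cancel_left₀ (C.del_pos (σ p.1)).ne']

omit h in
theorem jet_H_blowup (hr : r ≠ 0) {δ : ℕ → ℝ} (hδ : Tendsto δ atTop (𝓝 0)) (hδ0 : ∀ k, δ k ≠ 0)
    (i : Fin 3) (x : E3) :
    JetTendsto r atTop (fun k (t : E3) => (δ k)⁻¹ * C.H (δ k • t) i) (fun _ => 0) x := by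
  have h1 : JetTendsto r atTop (fun k (u : E3) => (δ k)⁻¹ • (C.H (0 + δ k • u) - C.H 0))
      (fun u => fderiv ℝ C.H 0 u) x :=
    JetTendsto.blowup hr (h := fun _ => C.H) (JetTendsto.of_contDiffAt C.H_contDiff)
      tendsto_const_nhds hδ (Eventually.of_forall hδ0)
  refine ((h1.coord i).congr (Eventually.of_forall fun p => ?_)).congr_limit
    (Eventually.of_forall fun w => ?_)
  · simp [C.H_zero]
  · simp [C.H_fderiv]

/-- The first two orders of the remainder of the transition do not contribute on the unstable plane
of `P`. -/
theorem jet_H_blowup_sq (hr : 2 ≤ r) {t : ℕ → E3 → E3} {y z : E3 → ℝ} {x : E3}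
    (ht : JetTendsto r atTop t (fun w => !₂[0, y w, z w]) x) :
    JetTendsto r atTop (fun k w => (C.del (σ k) ^ 2)⁻¹ * C.H (C.del (σ k) • t k w) 1)
      (fun _ => 0) x := by
  have hr0 : r ≠ 0 := by omega
  have h1 : JetTendsto r atTop (fun k (u : E3) => (C.del (σ k) ^ 2)⁻¹ •
      (fun w => C.H w 1) (C.del (σ k) • u))
      (fun u => (2⁻¹ : ℝ) • fderiv ℝ (fderiv ℝ (fun w => C.H w 1)) 0 u u) (!₂[0, y x, z x]) := by
    refine JetTendsto.blowup_sq hr (h := fun w => C.H w 1)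
      ((contDiff_coord 1).contDiffAt.comp (0 : E3) C.H_contDiff) (by simp [C.H_zero]) ?_ h.del
      (Eventually.of_forall fun k => (C.del_pos _).ne')
    have hH := (C.H_contDiff.differentiableAt (by exact_mod_cast hr0)).hasFDerivAt
    have := ((EuclideanSpace.proj 1 : E3 →L[ℝ] ℝ).hasFDerivAt.comp (0 : E3) hH).fderiv
    rw [C.H_fderiv, ContinuousLinearMap.comp_zero] at this
    exact this
  refine (JetTendsto.comp (g := t) (g₀ := fun w => !₂[0, y w, z w]) h1 ht).congr_limit
    (Eventually.of_forall fun w => ?_)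
  simp only [C.fderiv_fderiv_H hr, smul_zero]

/-- The renormalised return maps converge. In the limit the point `w` is moved near `Q` by the
quarter turn and near `P` by the eighth turn, so that `Y + del • (0, y w, z w)` is the end of the
passage near `P`; the transition at the tangency is quadratic in `(y w, z w)`. The factor `s` enters
through `s * γ₃` only, which the hypothesis expresses by `ξ`. -/
theorem jet_renorm (hr : 2 ≤ r) (hρ : 0 < ρ) {ξ : ℝ} (hs : s * C.γ 2 * (C.a 2 - C.a 1) = √2 * ξ)
    (μ : ℝ) (x : E3) :
    JetTendsto r atTop (fun k w => C.renorm ρ (σ k) μ w)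
      (endoE ξ μ (varsigma (C.β 1) C.a C.b C.c ξ)) x := by
  have hr0 : r ≠ 0 := by omega
  have hδ0 : ∀ k, C.del (σ k) ≠ 0 := fun k => (C.del_pos _).ne'
  have hu := h.jet_stageQ hr0 hρ x
  have hv : JetTendsto r atTop (fun k w => C.stageX (σ k) (C.stageQ ρ (σ k) w))
      (fun w => fderiv ℝ C.transQP 0 !₂[-w 2, s⁻¹ * w 1, w 0]) x :=
    JetTendsto.comp (g₀ := fun w : E3 => !₂[-w 2, s⁻¹ * w 1, w 0]) (h.jet_stageX hr0 _) hu
  set t : ℕ → E3 → E3 := fun k w =>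
    C.stageP ρ (σ k) (C.stageX (σ k) (C.stageQ ρ (σ k) w)) with ht_def
  -- the limiting displacement from `Y`, in the unstable plane of `P`
  set y : E3 → ℝ := fun w => s / √2 * (C.β 1 * (s⁻¹ * w 1) - C.γ 2 * w 0) with hy
  set z : E3 → ℝ := fun w => s / √2 * (C.β 1 * (s⁻¹ * w 1) + C.γ 2 * w 0) with hz
  have ht : JetTendsto r atTop t (fun w => !₂[0, y w, z w]) x := by
    refine (JetTendsto.comp (g₀ := fun w : E3 => fderiv ℝ C.transQP 0 !₂[-w 2, s⁻¹ * w 1, w 0])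
      (h.jet_stageP hr0 hρ _) hv).congr_limit (Eventually.of_forall fun w => ?_)
    simp [hy, hz, (C.fderiv_transQP_apply hr0 _).1, (C.fderiv_transQP_apply hr0 _).2]
  -- the contracted coordinate is even `o(δ)`, so that `b₁ x` does not contribute
  have ht0 : JetTendsto r atTop (fun k w => (C.del (σ k))⁻¹ * t k w 0) (fun _ => 0) x :=
    JetTendsto.comp (g₀ := fun w : E3 => fderiv ℝ C.transQP 0 !₂[-w 2, s⁻¹ * w 1, w 0])
      (h.jet_stageP_zero _) hv
  have hH : ∀ i, JetTendsto r atTop (fun k w => (C.del (σ k))⁻¹ * C.H (C.del (σ k) • t k w) i)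
      (fun _ => 0) x := fun i =>
    JetTendsto.comp (g₀ := fun w => !₂[0, y w, z w]) (jet_H_blowup hr0 h.del hδ0 i _) ht
  have hc := fun i => ht.coord i
  have hk : ∀ c : ℝ, JetTendsto r (atTop : Filter ℕ) (fun _ _ => c) (fun _ : E3 => c) x :=
    fun c => JetTendsto.const tendsto_const_nhds
  have hlin : ∀ (a : Fin 3 → ℝ) (i : Fin 3), JetTendsto r atTop
      (fun k w => a 0 * t k w 0 + a 1 * t k w 1 + a 2 * t k w 2 +
        (C.del (σ k))⁻¹ * C.H (C.del (σ k) • t k w) i)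
      (fun w => a 0 * 0 + a 1 * y w + a 2 * z w + 0) x := fun a i =>
    ((((hk _).mul (hc 0)).add ((hk _).mul (hc 1))).add ((hk _).mul (hc 2))).add (hH i)
  have hquad : JetTendsto r atTop
      (fun k w => C.b 0 * ((C.del (σ k))⁻¹ * t k w 0) +
        (C.b 1 * t k w 1 ^ 2 + C.b 2 * t k w 2 ^ 2 + C.b 3 * (t k w 1 * t k w 2)) +
        (C.del (σ k) ^ 2)⁻¹ * C.H (C.del (σ k) • t k w) 1 + μ)
      (fun w => C.b 0 * 0 + (C.b 1 * y w ^ 2 + C.b 2 * z w ^ 2 + C.b 3 * (y w * z w)) + 0 + μ) x :=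
    ((((hk _).mul ht0).add ((((hk _).mul (hc 1).sq).add ((hk _).mul (hc 2).sq)).add
      ((hk _).mul ((hc 1).mul (hc 2))))).add (h.jet_H_blowup_sq hr ht)).add (hk _)
  refine ((hlin C.a 0).vec3 hquad (hlin C.c 2)).congr_limit (Eventually.of_forall fun w => ?_)
  have hs0 := h.s_pos.ne'
  have h2 : √2 ≠ 0 := by positivity
  have h22 : √2 ^ 2 = 2 := Real.sq_sqrt (by norm_num)
  have h23 : √2 ^ 3 = 2 * √2 := by rw [pow_succ, h22]
  have ha : C.a 2 - C.a 1 ≠ 0 := fun h0 => by simpa [h0] using C.sign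
  have hg : s * C.γ 2 = √2 * ξ / (C.a 2 - C.a 1) := by rw [← hs]; field_simp
  have hy' : y w = C.β 1 * w 1 / √2 - ξ / (C.a 2 - C.a 1) * w 0 := by
    have : y w = C.β 1 * w 1 / √2 - s * C.γ 2 / √2 * w 0 := by
      simp only [hy]; field_simp
    rw [this, hg]; field_simp
  have hz' : z w = C.β 1 * w 1 / √2 + ξ / (C.a 2 - C.a 1) * w 0 := by
    have : z w = C.β 1 * w 1 / √2 + s * C.γ 2 / √2 * w 0 := by
      simp only [hz]; field_simp
    rw [this, hg]; field_simp
  ext i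
  fin_cases i
  · simp [endoE, varsigma, hy', hz']
    field_simp
    ring
  · simp [endoE, varsigma, hy', hz']
    field_simp
    ring_nf
    simp only [h22, h23]
    ring
  · simp [endoE, varsigma, hy', hz', C.c_two_three]
    field_simp
    ring

end Resonant

end SaddleFocusCycle

end Renormalization

/-! ### The returns along resonant itineraries -/

section Renormalization

variable {M : Type*} [TopologicalSpace M]

theorem contDiff_posQ {n : WithTop ℕ∞} :
    ContDiff ℝ n (fun q : ℝ × ℝ × E3 => posQ q.1 q.2.1 q.2.2) := by
  have h := fun i => (contDiff_coord (n := n) i).comp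
    (contDiff_snd.comp contDiff_snd : ContDiff ℝ n (fun q : ℝ × ℝ × E3 => q.2.2))
  simp only [Function.comp_def] at h
  have h0 := h 0
  have h1 := h 1
  have h2 := h 2
  exact contDiff_vec3 (by fun_prop) (by fun_prop) (by fun_prop)

theorem contDiff_posP {n : WithTop ℕ∞} :
    ContDiff ℝ n (fun q : ℝ × ℝ × E3 => posP q.1 q.2.1 q.2.2) := by
  have h := fun i => (contDiff_coord (n := n) i).comp
    (contDiff_snd.comp contDiff_snd : ContDiff ℝ n (fun q : ℝ × ℝ × E3 => q.2.2))
  simp only [Function.comp_def] at h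
  have h0 := h 0
  have h1 := h 1
  have h2 := h 2
  exact contDiff_vec3 (by fun_prop) (by fun_prop) (by fun_prop)

theorem posQ_zero (w : E3) : posQ 0 0 w = ptYtil := by
  ext i; fin_cases i <;> simp [posQ, ptYtil]

theorem posP_zero (v : E3) : posP 0 0 v = ptXtil := by
  ext i; fin_cases i <;> simp [posP, ptXtil]

namespace SaddleFocusCycle

variable [ChartedSpace E3 M] {r : ℕ} {f : M ≃ₘ^r⟮𝓡 3, 𝓡 3⟯ M} {C : SaddleFocusCycle r f}

namespace Resonant

variable {ρ s : ℝ} {σ : ℕ → Itinerary} (h : C.Resonant ρ s σ)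

include h

theorem tendsto_posQ (x : E3) :
    Tendsto (fun p : ℕ × E3 => posQ (C.del (σ p.1)) (C.hQ (σ p.1)) p.2) (atTop ×ˢ 𝓝 x)
      (𝓝 ptYtil) := by
  have h1 := (contDiff_posQ (n := 0)).continuous.tendsto (0, 0, x)
  rw [posQ_zero] at h1
  exact h1.comp ((h.del.comp tendsto_fst).prodMk_nhds
    ((h.hQ.comp tendsto_fst).prodMk_nhds tendsto_snd))

theorem tendsto_nu : Tendsto (fun k => C.nu (σ k)) atTop (𝓝 0) := by
  have h1 : Tendsto (fun k => C.transQP (C.refX (σ k))) atTop (𝓝 ptXtil) := by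
    rw [← C.transQP_zero]
    exact C.contDiffAt_transQP.continuousAt.tendsto.comp h.refX
  have h2 := ((contDiff_posP (n := 0)).continuous.tendsto (0, √2 * 0, 0)).comp
    (tendsto_const_nhds.prodMk_nhds ((h.hP.const_mul (√2)).prodMk_nhds tendsto_const_nhds))
  have h3 := h2.sub h1
  simp only [mul_zero, posP_zero, sub_self] at h3
  refine h3.congr fun k => ?_
  simp [nu, posP]

theorem tendsto_param (μ : ℝ) :
    Tendsto (fun p : ℕ × ℝ => C.param (σ p.1) p.2) (atTop ×ˢ 𝓝 μ) (𝓝 0) := by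
  have hz : (0 : E8) = WithLp.toLp 2 0 := rfl
  rw [hz]
  refine ((PiLp.continuous_toLp 2 _).tendsto _).comp (tendsto_pi_nhds.2 fun i => ?_)
  have hν : ∀ i : Fin 3, Tendsto (fun p : ℕ × ℝ => C.nu (σ p.1) i) (atTop ×ˢ 𝓝 μ) (𝓝 0) :=
    fun i => (((contDiff_coord (n := 0) i).continuous.tendsto 0).comp h.tendsto_nu).comp
      tendsto_fst
  have h1 : Tendsto (fun p : ℕ × ℝ => C.hQ (σ p.1) + C.del (σ p.1) ^ 2 * p.2) (atTop ×ˢ 𝓝 μ)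
      (𝓝 0) := by
    simpa using (h.hQ.comp tendsto_fst).add (((h.del.pow 2).comp tendsto_fst).mul tendsto_snd)
  fin_cases i
  · exact tendsto_const_nhds
  · exact h1
  · exact tendsto_const_nhds
  · exact hν 0
  · exact hν 1
  · exact hν 2
  · exact h.α.comp tendsto_fst
  · exact h.β.comp tendsto_fst

end Resonant

/-- Itineraries for the scaling parameter `ξ`. The sign condition on the transition coefficients
makes the required limit `s` of the ratio positive, hence a limit of powers of the eigenvalues. -/
theorem exists_resonant (C : SaddleFocusCycle r f) {ρ ξ : ℝ} (hρ : 0 < ρ) (hξ : 0 < ξ)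
    (hirr : Irrational (Real.log |C.lamQ| / Real.log |C.sigP|)) :
    ∃ s σ, C.Resonant ρ s σ ∧ s * C.γ 2 * (C.a 2 - C.a 1) = √2 * ξ := by
  have hs : 0 < √2 * ξ / (C.γ 2 * (C.a 2 - C.a 1)) := div_pos (by positivity) C.sign
  obtain ⟨m, n, hm, hn, h1, h2⟩ := exists_resonant_times C.lamP_ne C.sigP_gt C.lamQ_ne C.lamQ_lt
    C.sigQ_gt C.spectral hirr hs
  have hm2 : Tendsto (fun k => 2 * m k) atTop atTop := hm.const_mul_atTop' two_pos
  have hn2 : Tendsto (fun k => 2 * n k) atTop atTop := hn.const_mul_atTop' two_pos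
  obtain ⟨α, hα, hα'⟩ := exists_rate ((tendsto_rotSum_zero hρ C.lamP_lt C.sigP_gt zero_le_one
    zero_le_two).comp hm2) C.phiP (1 / 8) (n := fun k => 2 * m k)
  obtain ⟨β, hβ, hβ'⟩ := exists_rate ((tendsto_rotSum_zero hρ C.lamQ_lt C.sigQ_gt zero_le_two
    zero_le_one).comp hn2) C.phiQ (1 / 4) (n := fun k => 2 * n k)
  refine ⟨_, fun k => ⟨m k, n k, α k, β k⟩, ⟨hs, hm2, hn2, h1.congr fun k => ?_,
    h2.congr fun k => ?_, hα, hβ, hα', hβ'⟩, ?_⟩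
  · simp only [SaddleFocusCycle.rat, SaddleFocusCycle.hP, SaddleFocusCycle.eps, div_inv_eq_mul]
    ring
  · simp only [SaddleFocusCycle.lam2, SaddleFocusCycle.del, SaddleFocusCycle.hP,
      SaddleFocusCycle.hQ, ← mul_inv, inv_pow, div_inv_eq_mul]
  · rw [mul_assoc, div_mul_cancel₀ _ C.sign.ne']

variable [T2Space M]

/-- In rescaled coordinates the return along an itinerary is the renormalised map. -/
theorem eventually_iterate_eq_renorm (C : SaddleFocusCycle r f) (hr : r ≠ 0) :
    ∀ᶠ ρ in 𝓝[>] (0 : ℝ), ∀ (s : ℝ) (σ : ℕ → Itinerary), C.Resonant ρ s σ → ∀ (μ : ℝ) (x : E3),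
      ∀ᶠ p in atTop ×ˢ 𝓝 x, ∀ F : M → M,
        (∀ q, F q = C.Γ ρ (bump ρ) (C.param (σ p.1) μ) (f q)) →
        F^[C.N₂ + C.perP * (2 * (σ p.1).m) + C.N₁ + C.perQ * (2 * (σ p.1).n)]
            (C.chQ.symm (posQ (C.del (σ p.1)) (C.hQ (σ p.1)) p.2)) =
          C.chQ.symm (posQ (C.del (σ p.1)) (C.hQ (σ p.1)) (C.renorm ρ (σ p.1) μ p.2)) := by
  filter_upwards [C.eventually_passage_Q hr, C.eventually_transition_QP hr,
    C.eventually_passage_P hr, C.eventually_transition_PQ hr, self_mem_nhdsWithin]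
    with ρ hQ hQP hP hPQ hρ s σ h μ x
  have hρ0 : 0 < ρ := hρ
  have hu := (h.jet_stageQ hr hρ0 x).tendsto
  have hv := (JetTendsto.comp (g₀ := fun w : E3 => !₂[-w 2, s⁻¹ * w 1, w 0])
    (h.jet_stageX hr _) (h.jet_stageQ hr hρ0 x))
  have ht := (JetTendsto.comp (g₀ := fun w : E3 => fderiv ℝ C.transQP 0 !₂[-w 2, s⁻¹ * w 1, w 0])
    (h.jet_stageP hr hρ0 _) hv).tendsto
  have hwX : Tendsto (fun p : ℕ × E3 => C.refX (σ p.1) + (C.eps (σ p.1) * C.del (σ p.1)) •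
      C.stageQ ρ (σ p.1) p.2) (atTop ×ˢ 𝓝 x) (𝓝 0) := by
    have := (h.refX.comp tendsto_fst).add ((h.eps_mul_del.comp tendsto_fst).smul hu)
    rwa [zero_smul, add_zero] at this
  have hwX' : Tendsto (fun p : ℕ × E3 => ptX + (C.refX (σ p.1) +
      (C.eps (σ p.1) * C.del (σ p.1)) • C.stageQ ρ (σ p.1) p.2)) (atTop ×ˢ 𝓝 x) (𝓝 ptX) := by
    simpa using hwX.const_add ptX
  have hposP : Tendsto (fun p : ℕ × E3 => posP (C.eps (σ p.1) * C.del (σ p.1))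
      (√2 * C.hP (σ p.1)) (C.stageX (σ p.1) (C.stageQ ρ (σ p.1) p.2))) (atTop ×ˢ 𝓝 x)
      (𝓝 ptXtil) := by
    have := ((contDiff_posP (n := 0)).continuous.tendsto (0, √2 * 0, _)).comp
      ((h.eps_mul_del.comp tendsto_fst).prodMk_nhds
        (((h.hP.const_mul (√2)).comp tendsto_fst).prodMk_nhds hv.tendsto))
    simp only [mul_zero, posP_zero] at this
    exact this
  have hwY : Tendsto (fun p : ℕ × E3 => C.del (σ p.1) • C.stageP ρ (σ p.1)
      (C.stageX (σ p.1) (C.stageQ ρ (σ p.1) p.2))) (atTop ×ˢ 𝓝 x) (𝓝 0) := by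
    have := (h.del.comp tendsto_fst).smul ht
    rwa [zero_smul] at this
  have hwY' : Tendsto (fun p : ℕ × E3 => ptY + C.del (σ p.1) • C.stageP ρ (σ p.1)
      (C.stageX (σ p.1) (C.stageQ ρ (σ p.1) p.2))) (atTop ×ˢ 𝓝 x) (𝓝 ptY) := by
    simpa using hwY.const_add ptY
  filter_upwards [((h.tendsto_posQ x).prodMk hwX').eventually hQ, hwX.eventually hQP,
    (hposP.prodMk hwY').eventually hP, hwY.eventually hPQ, tendsto_fst.eventually h.angle_P,
    tendsto_fst.eventually h.angle_Q] with p h1 h2 h3 h4 ⟨z, hz⟩ ⟨z', hz'⟩ F hF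
  have e1 := h1 F _ hF (2 * (σ p.1).n) (C.rotY_iterate_posQ ρ (σ p.1) hz' p.2).symm
  have e2 := h2 F _ hF
  have e3 := h3 F _ hF (2 * (σ p.1).m)
    (C.rotX_iterate_posP ρ (σ p.1) hz (C.stageX (σ p.1) (C.stageQ ρ (σ p.1) p.2))).symm
  have e4 := h4 F _ hF
  have hν : (!₂[C.param (σ p.1) μ 3, C.param (σ p.1) μ 4, C.param (σ p.1) μ 5] : E3) =
      C.nu (σ p.1) := by
    ext i; fin_cases i <;> rfl
  have hμ : (!₂[C.param (σ p.1) μ 0, C.param (σ p.1) μ 1, C.param (σ p.1) μ 2] : E3) =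
      !₂[0, C.hQ (σ p.1) + C.del (σ p.1) ^ 2 * μ, 0] := by
    ext i; fin_cases i <;> rfl
  rw [hν, C.transQP_add_nu] at e2
  rw [hμ, C.transPQ_add] at e4
  rw [Function.iterate_add_apply, Function.iterate_add_apply, Function.iterate_add_apply]
  rw [e1, e2, e3, e4, renorm]

end SaddleFocusCycle

end Renormalization

/-! ### Parametrisations of neighbourhoods of the tangency point -/

/-- The linear map with which the rescaled coordinates near `Ytil` are read. -/
def scale (δ : ℝ) (w : E3) : E3 := !₂[δ * w 0, δ ^ 2 * w 1, δ * w 2]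

/-- The diffeomorphism of space onto a neighbourhood of the origin which is close to the identity
where `δ • w` is small and whose image is mapped to the unit ball by the scaling. -/
def shrink (δ : ℝ) (w : E3) : E3 := (√(1 + ‖scale δ w‖ ^ 2))⁻¹ • w

/-- The inverse of `shrink δ`. -/
def expand (δ : ℝ) (w : E3) : E3 := (√(1 - ‖scale δ w‖ ^ 2))⁻¹ • w

theorem contDiff_scale {n : WithTop ℕ∞} : ContDiff ℝ n (fun q : ℝ × E3 => scale q.1 q.2) := by
  have h := fun i => (contDiff_coord (n := n) i).comp
    (contDiff_snd : ContDiff ℝ n (fun q : ℝ × E3 => q.2))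
  simp only [Function.comp_def] at h
  have h0 := h 0
  have h1 := h 1
  have h2 := h 2
  exact contDiff_vec3 (by fun_prop) (by fun_prop) (by fun_prop)

theorem scale_zero (w : E3) : scale 0 w = 0 := by
  ext i; fin_cases i <;> simp [scale]

theorem scale_smul (δ c : ℝ) (w : E3) : scale δ (c • w) = c • scale δ w := by
  ext i; fin_cases i <;> simp [scale] <;> ring

theorem posQ_eq (δ h : ℝ) (w : E3) : posQ δ h w = !₂[1, h, 1] + scale δ w := by
  ext i; fin_cases i <;> simp [posQ, scale]

theorem contDiff_shrink {n : WithTop ℕ∞} : ContDiff ℝ n (fun q : ℝ × E3 => shrink q.1 q.2) := by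
  have h : ∀ q : ℝ × E3, 0 < 1 + ‖scale q.1 q.2‖ ^ 2 := fun q => by positivity
  refine ContDiff.smul (ContDiff.inv ?_ fun q => Real.sqrt_ne_zero'.2 (h q)) contDiff_snd
  exact (contDiff_const.add (contDiff_scale.norm_sq ℝ)).sqrt fun q => (h q).ne'

theorem shrink_zero (w : E3) : shrink 0 w = w := by simp [shrink, scale_zero]

theorem expand_zero (w : E3) : expand 0 w = w := by simp [expand, scale_zero]

theorem contDiffAt_expand {n : WithTop ℕ∞} (x : E3) :
    ContDiffAt ℝ n (fun q : ℝ × E3 => expand q.1 q.2) (0, x) := by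
  have h : 1 - ‖scale 0 x‖ ^ 2 ≠ 0 := by simp [scale_zero]
  have h' : √(1 - ‖scale 0 x‖ ^ 2) ≠ 0 := by simp [scale_zero]
  have h1 : ContDiffAt ℝ n (fun q : ℝ × E3 => √(1 - ‖scale q.1 q.2‖ ^ 2)) (0, x) :=
    (contDiffAt_const.sub (contDiff_scale.norm_sq ℝ).contDiffAt).sqrt h
  exact (h1.inv h').smul contDiffAt_snd

theorem shrink_expand {δ : ℝ} {w : E3} (hw : ‖scale δ w‖ < 1) : shrink δ (expand δ w) = w := by
  have h1 : 0 < 1 - ‖scale δ w‖ ^ 2 := by nlinarith [norm_nonneg (scale δ w)]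
  have h2 : 1 + ‖scale δ (expand δ w)‖ ^ 2 = (1 - ‖scale δ w‖ ^ 2)⁻¹ := by
    rw [expand, scale_smul, norm_smul, mul_pow, norm_inv, inv_pow, Real.norm_eq_abs, sq_abs,
      Real.sq_sqrt h1.le]
    field_simp
    ring
  rw [shrink, h2, Real.sqrt_inv, inv_inv, expand, smul_inv_smul₀ (Real.sqrt_pos.2 h1).ne']

theorem scale_scale_inv {δ : ℝ} (hδ : δ ≠ 0) (w : E3) : scale δ (scale δ⁻¹ w) = w := by
  ext i; fin_cases i <;> simp [scale, hδ]

/-- The scaling as a homeomorphism. -/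
def scaleHomeomorph (δ : ℝ) (hδ : δ ≠ 0) : E3 ≃ₜ E3 where
  toFun := scale δ
  invFun := scale δ⁻¹
  left_inv w := by simpa using scale_scale_inv (inv_ne_zero hδ) w
  right_inv w := scale_scale_inv hδ w
  continuous_toFun := (contDiff_scale (n := 0)).continuous.comp (Continuous.prodMk_right δ)
  continuous_invFun := (contDiff_scale (n := 0)).continuous.comp (Continuous.prodMk_right δ⁻¹)

theorem add_ball_subset_cube {h : ℝ} (h0 : 0 < h) (h1 : h ≤ 1) {w : E3} (hw : ‖w‖ < 1) :
    !₂[1, h, 1] + w ∈ cube := by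
  intro i
  have h2 := abs_le.1 ((PiLp.norm_apply_le w i).trans hw.le)
  fin_cases i <;> simp at h2 ⊢ <;> constructor <;> linarith

/-- The parametrisation of a neighbourhood of a point close to `Ytil` by all of space, in the
rescaled coordinates up to a diffeomorphism which is close to the identity on compact sets. -/
theorem exists_parametrization {M : Type*} [TopologicalSpace M] [ChartedSpace E3 M] {r : ℕ}
    [IsManifold (𝓡 3) r M] {ch : OpenPartialHomeomorph M E3}
    (hch : ch ∈ IsManifold.maximalAtlas (𝓡 3) r M) (hcube : cube ⊆ ch.target) {δ h : ℝ}
    (hδ : δ ≠ 0) (h0 : 0 < h) (h1 : h ≤ 1) :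
    ∃ Ψ : OpenPartialHomeomorph E3 M, Ψ.source = univ ∧ ContMDiff (𝓡 3) (𝓡 3) r Ψ ∧
      ContMDiffOn (𝓡 3) (𝓡 3) r Ψ.symm Ψ.target ∧
      (∀ w, Ψ w = ch.symm (posQ δ h (shrink δ w))) ∧
      ∀ w, ‖scale δ w‖ < 1 → ch.symm (posQ δ h w) ∈ Ψ.target ∧
        Ψ.symm (ch.symm (posQ δ h w)) = expand δ w := by
  set B : OpenPartialHomeomorph E3 E3 := OpenPartialHomeomorph.univUnitBall with hB
  set T : E3 ≃ₜ E3 := Homeomorph.addLeft !₂[1, h, 1] with hT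
  have hmem : ∀ w, !₂[1, h, 1] + B w ∈ ch.target := fun w => by
    refine hcube (add_ball_subset_cube h0 h1 ?_)
    exact mem_ball_zero_iff.1 (B.map_source (mem_univ w))
  set Ψ : OpenPartialHomeomorph E3 M :=
    (((scaleHomeomorph δ hδ).toOpenPartialHomeomorph.trans B).trans
      T.toOpenPartialHomeomorph).trans ch.symm with hΨ
  have hsource : Ψ.source = univ := by
    ext w
    simp only [hΨ, mem_univ, iff_true]
    exact ⟨⟨⟨mem_univ _, mem_univ _⟩, mem_univ _⟩, hmem (scale δ w)⟩
  have hval : ∀ w, Ψ w = ch.symm (posQ δ h (shrink δ w)) := fun w => by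
    rw [posQ_eq, shrink, scale_smul]
    rfl
  have hsymm : ∀ p, Ψ.symm p = scale δ⁻¹ (B.symm (-!₂[1, h, 1] + ch p)) := fun p => rfl
  have htarget : ∀ p ∈ Ψ.target, p ∈ ch.source ∧ -!₂[1, h, 1] + ch p ∈ Metric.ball (0 : E3) 1 := by
    intro p hp
    obtain ⟨w, -, rfl⟩ := (Ψ.image_source_eq_target.symm ▸ hp : p ∈ Ψ '' Ψ.source)
    have hm := hmem (scale δ w)
    have hw : Ψ w = ch.symm (!₂[1, h, 1] + B (scale δ w)) := rfl
    refine ⟨hw ▸ ch.map_target hm, ?_⟩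
    rw [hw, ch.right_inv hm, neg_add_cancel_left]
    exact B.map_source (mem_univ _)
  have hleft : ∀ w, Ψ.symm (Ψ w) = w := fun w => Ψ.left_inv (hsource ▸ mem_univ w)
  refine ⟨Ψ, hsource, ?_, ?_, hval, fun w hw => ?_⟩
  · have hg : ContDiff ℝ r (fun w : E3 => !₂[1, h, 1] + B (scale δ w)) :=
      contDiff_const.add (OpenPartialHomeomorph.contDiff_univUnitBall.comp
        (contDiff_scale.comp (contDiff_const.prodMk contDiff_id)))
    exact (contMDiffOn_symm_of_mem_maximalAtlas hch).comp_contMDiff hg.contMDiff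
      fun w => hmem (scale δ w)
  · have hg : ContDiffOn ℝ r (fun w : E3 => scale δ⁻¹ (B.symm (-!₂[1, h, 1] + w)))
        {w | -!₂[1, h, 1] + w ∈ Metric.ball (0 : E3) 1} := by
      refine (contDiff_scale.comp (contDiff_const.prodMk contDiff_id)).comp_contDiffOn
        (OpenPartialHomeomorph.contDiffOn_univUnitBall_symm.comp (by fun_prop) fun w hw => hw)
    exact (hg.contMDiffOn.comp ((contMDiffOn_of_mem_maximalAtlas hch).mono
      fun p hp => (htarget p hp).1) fun p hp => (htarget p hp).2).congr fun p _ => hsymm p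
  · have hw' : ch.symm (posQ δ h w) = Ψ (expand δ w) := by rw [hval, shrink_expand hw]
    rw [hw']
    exact ⟨Ψ.map_source (hsource ▸ mem_univ _), hleft _⟩

/-! ### Conjugation by the parametrisations -/

theorem contDiff_varsigma : ContDiffOn ℝ ∞
    (fun q : ℝ × (Fin 3 → ℝ) × (Fin 4 → ℝ) × (Fin 3 → ℝ) × ℝ =>
      varsigma q.1 q.2.1 q.2.2.1 q.2.2.2.1 q.2.2.2.2) {q | q.2.1 1 ≠ q.2.1 2} := by
  refine contDiffOn_pi.2 fun i q hq => ?_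
  have hq' : q.2.1 2 - q.2.1 1 ≠ 0 := sub_ne_zero.2 (Ne.symm hq)
  have h2 : √2 ≠ 0 := by positivity
  refine ContDiffAt.contDiffWithinAt ?_
  fin_cases i <;> simp only [varsigma] <;> simp <;> fun_prop (disch := simp [hq'])

namespace SaddleFocusCycle

variable {M : Type*} [TopologicalSpace M] [ChartedSpace E3 M] {r : ℕ} {f : M ≃ₘ^r⟮𝓡 3, 𝓡 3⟯ M}
  {C : SaddleFocusCycle r f} {ρ s : ℝ} {σ : ℕ → Itinerary}

theorem contDiff_param (C : SaddleFocusCycle r f) (σ : Itinerary) {n : WithTop ℕ∞} :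
    ContDiff ℝ n (C.param σ) := by
  refine contDiff_euclidean.2 fun i => ?_
  fin_cases i <;> simp [param] <;> fun_prop

theorem Resonant.tendsto_shrink (h : C.Resonant ρ s σ) (x : E3) :
    Tendsto (fun p : ℕ × E3 => shrink (C.del (σ p.1)) p.2) (atTop ×ˢ 𝓝 x) (𝓝 x) := by
  have h1 : Tendsto (fun q : ℝ × E3 => shrink q.1 q.2) (𝓝 (0, x)) (𝓝 x) := by
    have := (contDiff_shrink (n := 0)).continuous.tendsto ((0 : ℝ), x)
    rwa [shrink_zero] at this
  have h2 : Tendsto (fun p : ℕ × E3 => (C.del (σ p.1), p.2)) (atTop ×ˢ 𝓝 x) (𝓝 (0, x)) :=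
    (h.del.comp tendsto_fst).prodMk_nhds tendsto_snd
  simpa only [Function.comp_def] using h1.comp h2

theorem Resonant.tendsto_prod_shrink (h : C.Resonant ρ s σ) (x : E3) :
    Tendsto (fun p : ℕ × E3 => (p.1, shrink (C.del (σ p.1)) p.2)) (atTop ×ˢ 𝓝 x)
      (atTop ×ˢ 𝓝 x) := tendsto_fst.prodMk (h.tendsto_shrink x)

theorem Resonant.tendsto_chart_posQ (h : C.Resonant ρ s σ) (x : E3) :
    Tendsto (fun p : ℕ × E3 => C.chQ.symm
      (posQ (C.del (σ p.1)) (C.hQ (σ p.1)) (shrink (C.del (σ p.1)) p.2))) (atTop ×ˢ 𝓝 x)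
      (𝓝 C.tangencyPoint) := by
  have h1 : Tendsto C.chQ.symm (𝓝 ptYtil) (𝓝 C.tangencyPoint) :=
    (C.chQ.continuousAt_symm (C.cube_Q ptYtil_mem_cube)).tendsto
  have h2 := (h.tendsto_posQ x).comp (h.tendsto_prod_shrink x)
  simpa only [Function.comp_def] using h1.comp h2

theorem Resonant.tendsto_norm_scale (h : C.Resonant ρ s σ) {R : ℕ → E3 → E3} {R₀ : E3 → E3}
    {x : E3} (hR : JetTendsto r atTop R R₀ x) :
    Tendsto (fun p : ℕ × E3 => ‖scale (C.del (σ p.1)) (R p.1 (shrink (C.del (σ p.1)) p.2))‖)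
      (atTop ×ˢ 𝓝 x) (𝓝 0) := by
  have h1 : Tendsto (fun q : ℝ × E3 => scale q.1 q.2) (𝓝 (0, R₀ x)) (𝓝 0) := by
    have := (contDiff_scale (n := 0)).continuous.tendsto ((0 : ℝ), R₀ x)
    rwa [scale_zero] at this
  have h2 := hR.tendsto.comp (h.tendsto_prod_shrink x)
  have h3 : Tendsto (fun p : ℕ × E3 => (C.del (σ p.1), R p.1 (shrink (C.del (σ p.1)) p.2)))
      (atTop ×ˢ 𝓝 x) (𝓝 (0, R₀ x)) := (h.del.comp tendsto_fst).prodMk_nhds h2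
  have h4 := (h1.comp h3).norm
  simpa only [Function.comp_def, norm_zero] using h4

/-- Jet limits are not affected by the conjugation with `shrink`, which tends to the identity. -/
theorem Resonant.jet_conj (h : C.Resonant ρ s σ) {R : ℕ → E3 → E3} {R₀ : E3 → E3} {x : E3}
    (hR : JetTendsto r atTop R R₀ x) :
    JetTendsto r atTop
      (fun k w => expand (C.del (σ k)) (R k (shrink (C.del (σ k)) w))) R₀ x := by
  have hκ : JetTendsto r atTop (fun k w => shrink (C.del (σ k)) w) (fun w => w) x :=
    (JetTendsto.comp_contDiffAt (h := fun q : ℝ × E3 => shrink q.1 q.2) contDiff_shrink.contDiffAt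
      ((JetTendsto.const h.del).prodMk JetTendsto.ident)).congr_limit
      (Eventually.of_forall fun w => (shrink_zero w).symm)
  exact (JetTendsto.comp_contDiffAt (h := fun q : ℝ × E3 => expand q.1 q.2)
    (g₀ := fun w => ((0 : ℝ), R₀ w)) (contDiffAt_expand _) ((JetTendsto.const h.del).prodMk
      (JetTendsto.comp (g₀ := fun w => w) hR hκ))).congr_limit
      (Eventually.of_forall fun w => (expand_zero _).symm)

end SaddleFocusCycle

end HetCycle

end

theorem theorem1 {M : Type*} [TopologicalSpace M] [ChartedSpace E3 M] [IsManifold (𝓡 3) ∞ M]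
    [T2Space M] [CompactSpace M] (r : ℕ) (hr : 2 ≤ r)
    (f : M ≃ₘ^r⟮𝓡 3, 𝓡 3⟯ M) (C : SaddleFocusCycle r f)
    (hnr : Irrational (Real.log |C.lamQ| / Real.log |C.sigP|)) :
    ContDiffOn ℝ ∞
      (fun q : ℝ × (Fin 3 → ℝ) × (Fin 4 → ℝ) × (Fin 3 → ℝ) × ℝ =>
        varsigma q.1 q.2.1 q.2.2.1 q.2.2.2.1 q.2.2.2.2) {q | q.2.1 1 ≠ q.2.1 2} ∧
    ∃ F : E8 → M ≃ₘ^r⟮𝓡 3, 𝓡 3⟯ M, IsUnfoldingFamily C F ∧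
      ∀ ξ : ℝ, 0 < ξ →
        ∃ (m n : ℕ → ℕ) (Ψ : ℕ → OpenPartialHomeomorph E3 M) (υ : ℕ → ℝ × ℝ × ℝ → E8),
          Tendsto m atTop atTop ∧ Tendsto n atTop atTop ∧
          (∀ k, (Ψ k).source = univ ∧ ContMDiff (𝓡 3) (𝓡 3) r (Ψ k) ∧
            ContMDiffOn (𝓡 3) (𝓡 3) r (Ψ k).symm (Ψ k).target) ∧
          (∀ k, ContDiffOn ℝ ∞ (υ k) paramDomain) ∧
          (∀ Δ : Set E3, IsCompact Δ → ∀ U ∈ 𝓝 C.tangencyPoint, ∀ᶠ k in atTop, Ψ k '' Δ ⊆ U) ∧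
          (∀ L : Set (ℝ × ℝ × ℝ), IsCompact L → L ⊆ paramDomain →
            ∀ U ∈ 𝓝 (0 : E8), ∀ᶠ k in atTop, υ k '' L ⊆ U) ∧
          ∀ μ : ℝ,
            (∀ K : Set E3, IsCompact K → ∀ᶠ k in atTop, ∀ w ∈ K,
              (F (υ k (μ, C.phiP, C.phiQ)))^[C.N₂ + m k + C.N₁ + n k] (Ψ k w) ∈ (Ψ k).target) ∧
            TendstoCr r
              (fun k => (Ψ k).symm ∘
                (F (υ k (μ, C.phiP, C.phiQ)))^[C.N₂ + m k + C.N₁ + n k] ∘ Ψ k)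
              (endoE ξ μ (varsigma (C.β 1) C.a C.b C.c ξ)) := by
  have hr0 : r ≠ 0 := by omega
  have : IsManifold (𝓡 3) r M :=
    IsManifold.of_le (n := ∞) (by exact_mod_cast le_top)
  refine ⟨contDiff_varsigma, ?_⟩
  obtain ⟨ρ, ⟨⟨⟨hret, hV⟩, hρ0⟩, hρ1⟩⟩ := ((((C.eventually_iterate_eq_renorm hr0).and
    (C.eventually_pairwise_disjoint_V hr0)).and self_mem_nhdsWithin).and
    (nhdsWithin_le_nhds (Iio_mem_nhds (show (0 : ℝ) < 1 by norm_num)))).exists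
  obtain ⟨F, hF, ε, hε, hform⟩ := C.exists_unfoldingFamily hr0 ⟨hρ0, hρ1⟩ hV
  refine ⟨F, hF, fun ξ hξ => ?_⟩
  obtain ⟨s, σ, h, hs⟩ := C.exists_resonant hρ0 hξ hnr
  choose Ψ hsource hsmooth hsmooth' hval hmem using fun k => exists_parametrization C.chQ_mem
    C.cube_Q (C.del_pos (σ k)).ne' (C.hQ_pos (σ k)) (C.hQ_le_one (σ k))
  refine ⟨fun k => C.perP * (2 * (σ k).m), fun k => C.perQ * (2 * (σ k).n), Ψ,
    fun k q => C.param (σ k) q.1, h.m.const_mul_atTop' C.perP_pos, h.n.const_mul_atTop' C.perQ_pos,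
    fun k => ⟨hsource k, hsmooth k, hsmooth' k⟩,
    fun k => ((C.contDiff_param (σ k)).comp contDiff_fst).contDiffOn, ?_, ?_, fun μ => ?_⟩
  · intro Δ hΔ U hU
    have h1 := eventually_forall_mem_of_isCompact (l := atTop) hΔ
      (P := fun p : ℕ × E3 => Ψ p.1 p.2 ∈ U) fun x => by
        filter_upwards [(h.tendsto_chart_posQ x).eventually hU] with p hp
        rwa [hval]
    filter_upwards [h1] with k hk
    exact image_subset_iff.2 hk
  · intro L hL _ U hU
    have h1 := eventually_forall_mem_of_isCompact (l := atTop) hL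
      (P := fun p : ℕ × ℝ × ℝ × ℝ => C.param (σ p.1) p.2.1 ∈ U) fun x => by
        have h2 : Tendsto (fun p : ℕ × ℝ × ℝ × ℝ => (p.1, p.2.1)) (atTop ×ˢ 𝓝 x)
            (atTop ×ˢ 𝓝 x.1) :=
          tendsto_fst.prodMk ((continuous_fst.tendsto x).comp tendsto_snd)
        exact h2.eventually ((h.tendsto_param x.1).eventually hU)
    filter_upwards [h1] with k hk
    exact image_subset_iff.2 hk
  · set N : ℕ → ℕ := fun k =>
      C.N₂ + C.perP * (2 * (σ k).m) + C.N₁ + C.perQ * (2 * (σ k).n) with hN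
    have hsmall : ∀ᶠ k in atTop, ∀ p, F (C.param (σ k) μ) p =
        C.Γ ρ (bump ρ) (C.param (σ k) μ) (f p) := by
      have h1 : Tendsto (fun k : ℕ => (k, μ)) atTop (atTop ×ˢ 𝓝 μ) :=
        tendsto_id.prodMk tendsto_const_nhds
      filter_upwards [h1.eventually ((h.tendsto_param μ).eventually
        (Metric.closedBall_mem_nhds 0 hε))] with k hk
      refine hform _ fun i => ?_
      have h2 : ‖C.param (σ k) μ i‖ ≤ ε :=
        (PiLp.norm_apply_le _ i).trans (mem_closedBall_zero_iff.1 hk)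
      exact abs_le.1 h2
    have hkey : ∀ x, ∀ᶠ p in atTop ×ˢ 𝓝 x,
        (F (C.param (σ p.1) μ))^[N p.1] (Ψ p.1 p.2) ∈ (Ψ p.1).target ∧
        (Ψ p.1).symm ((F (C.param (σ p.1) μ))^[N p.1] (Ψ p.1 p.2)) =
          expand (C.del (σ p.1)) (C.renorm ρ (σ p.1) μ (shrink (C.del (σ p.1)) p.2)) := by
      intro x
      filter_upwards [(h.tendsto_prod_shrink x).eventually (hret s σ h μ x),
        (h.tendsto_norm_scale (h.jet_renorm hr hρ0 hs μ x)).eventually (gt_mem_nhds one_pos),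
        tendsto_fst.eventually hsmall] with p h5 h6 h7
      rw [hval, h5 _ h7]
      exact hmem _ _ h6
    refine ⟨fun K hK => eventually_forall_mem_of_isCompact hK
      (P := fun p : ℕ × E3 => (F (C.param (σ p.1) μ))^[N p.1] (Ψ p.1 p.2) ∈ (Ψ p.1).target)
      fun x => (hkey x).mono fun p hp => hp.1, tendstoCr_of_jetTendsto fun x => ?_⟩
    exact (h.jet_conj (h.jet_renorm hr hρ0 hs μ x)).congr ((hkey x).mono fun p hp => hp.2)
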